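/- Let $h:\mathbb{R}\to\mathbb{R}$ be convex and continuous with $h(u)\ge \alpha_1|u|^2+\alpha_2$ for all $u\in\mathbb{R}$, for some $\alpha_1>0$, $\alpha_2\ge 0$. Let $H(u)=h(u)$ for $u\ge 0$ and $H(u)=+\infty$ for $u<0$, and let $H^*(p)=\sup\{pu-H(u):u\in\mathbb{R}\}$, $p\in\mathbb{R}$, be its Legendre conjugate. Let $f\in C_b^2(\mathbb{R})$ with $f''\in L^1(\mathbb{R})$, and let $\sigma\in C_b^2(\mathbb{R})$ (no lower bound on $|\sigma|$ is assumed). Here $C^2_b(\mathbb{R})$ is the space of $C^2$ functions that are bounded together with their derivatives of order $1$ and $2$. Define the operator $A:D(A)\subset L^1(\mathbb{R})\to L^1(\mathbb{R})$ by $$Ay=-\Bigl(H^*\Bigl(\frac{\sigma^2}{2}\,y\Bigr)\Bigr)''-f\,y',$$ $$D(A)=\Bigl\{y\in L^1(\mathbb{R})\,:\ H^*\Bigl(\frac{\sigma^2}{2}\,y\Bigr)\in L^1_{\mathrm{loc}}(\mathbb{R}),\ \ f\,y'+\Bigl(H^*\Bigl(\frac{\sigma^2}{2}\,y\Bigr)\Bigr)''\in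 L^1(\mathbb{R})\Bigr\},$$ where derivatives are taken in $\mathcal{D}'(\mathbb{R})$ and $\langle f\,y',\varphi\rangle=-\int_{\mathbb{R}}y\,(f\varphi)'\,dx$ for test functions $\varphi\in C_c^\infty(\mathbb{R})$. Then $A$ is quasi-$m$-accretive in $L^1(\mathbb{R})$; that is, there is $\lambda_0\in\mathbb{R}$ such that $\lambda_0I+A$ is $m$-accretive. Here an operator $B$ in a Banach space $X$ is accretive if for all $u_1,u_2\in D(B)$ and $v_i\in Bu_i$ there is $\eta\in J(u_1-u_2)$ with $\langle v_1-v_2,\eta\rangle\ge 0$, where $J(u)=\{\eta\in X':\langle u,\eta\rangle=\|u\|^2=\|\eta\|^2\}$ is the duality mapping, and it is $m$-accretive if moreover the range of $\lambda I+B$ is $X$ for all $\lambda>0$. -/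

import Mathlib

open MeasureTheory Set
open scoped ContDiff

noncomputable section

namespace DegenerateFP

/-! ### Nonlinear accretive operators in a Banach space -/

section Accretive

variable {X : Type*} [NormedAddCommGroup X] [NormedSpace ℝ X]

/-- The (normalized) duality mapping `J : X → 2^{X'}`,
`J u = {η ∈ X' | η u = ‖u‖ ^ 2 = ‖η‖ ^ 2}`. -/
def dualityMap (u : X) : Set (StrongDual ℝ X) :=
  {η | η u = ‖u‖ ^ 2 ∧ ‖η‖ ^ 2 = ‖u‖ ^ 2}

/-- A (possibly multivalued, nonlinear) operator `A` in `X` is a map `A : X → 2^X`; its domain is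
`{u | (A u).Nonempty}`. It is accretive if for all `vᵢ ∈ A uᵢ` there is `η ∈ J (u₁ - u₂)` with
`⟨v₁ - v₂, η⟩ ≥ 0`. -/
def IsAccretive (A : X → Set X) : Prop :=
  ∀ u₁ u₂ v₁ v₂ : X, v₁ ∈ A u₁ → v₂ ∈ A u₂ → ∃ η ∈ dualityMap (u₁ - u₂), 0 ≤ η (v₁ - v₂)

/-- The operator `c I + A`, with the same domain as `A`. -/
def shift (c : ℝ) (A : X → Set X) : X → Set X :=
  fun u => {w | ∃ v ∈ A u, w = c • u + v}

/-- `A` is `m`-accretive if it is accretive and the range of `μ I + A` is `X` for all `μ > 0`. -/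
def IsMAccretive (A : X → Set X) : Prop :=
  IsAccretive A ∧ ∀ μ : ℝ, 0 < μ → ∀ w : X, ∃ u : X, w ∈ shift μ A u

/-- `A` is quasi-`m`-accretive if `c I + A` is `m`-accretive for some real `c`. -/
def IsQuasiMAccretive (A : X → Set X) : Prop :=
  ∃ c : ℝ, IsMAccretive (shift c A)

end Accretive

/-! ### The Legendre conjugate -/

/-- `H = h + I_{[0,∞)}`: equal to `h u` for `u ≥ 0` and to `+∞` otherwise. -/
def extendH (h : ℝ → ℝ) (u : ℝ) : EReal := if 0 ≤ u then (h u : EReal) else ⊤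

/-- The Legendre conjugate `p ↦ sup {p u - H u | u ∈ ℝ}` of an extended-real valued function. -/
def legendreConj (H : ℝ → EReal) (p : ℝ) : EReal := ⨆ u : ℝ, ((p * u : ℝ) : EReal) - H u

/-- `H^*` for `H = h + I_{[0,∞)}`, as a real function. (It is finite when `h` grows at least
quadratically, see `coe_Hstar`.) -/
def Hstar (h : ℝ → ℝ) (p : ℝ) : ℝ := (legendreConj (extendH h) p).toReal

theorem bddAbove_of_quadratic {h : ℝ → ℝ} {a b : ℝ} (ha : 0 < a)
    (hh : ∀ u, a * |u| ^ 2 + b ≤ h u) (p : ℝ) :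
    BddAbove (range fun u : Ici (0 : ℝ) => p * (u : ℝ) - h u) := by
  refine ⟨p ^ 2 / (4 * a) - b, ?_⟩
  rintro _ ⟨u, rfl⟩
  have h1 := hh u
  rw [sq_abs] at h1
  have h2 : p * (u : ℝ) - a * (u : ℝ) ^ 2 ≤ p ^ 2 / (4 * a) := by
    rw [le_div_iff₀ (by positivity)]
    nlinarith [sq_nonneg (p - 2 * a * (u : ℝ))]
  simp only
  linarith

theorem legendreConj_extendH {h : ℝ → ℝ} {a b : ℝ} (ha : 0 < a)
    (hh : ∀ u, a * |u| ^ 2 + b ≤ h u) (p : ℝ) :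
    legendreConj (extendH h) p = ((⨆ u : Ici (0 : ℝ), (p * (u : ℝ) - h u) : ℝ) : EReal) := by
  have hb := bddAbove_of_quadratic ha hh p
  apply le_antisymm
  · refine iSup_le fun u => ?_
    by_cases hu : 0 ≤ u
    · rw [extendH, if_pos hu, ← EReal.coe_sub, EReal.coe_le_coe_iff]
      exact le_ciSup hb (⟨u, hu⟩ : Ici (0 : ℝ))
    · rw [extendH, if_neg hu, EReal.sub_top]
      exact bot_le
  · have hge : ∀ u : Ici (0 : ℝ),
        ((p * (u : ℝ) - h u : ℝ) : EReal) ≤ legendreConj (extendH h) p := by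
      intro u
      refine le_trans ?_ (le_iSup (fun u : ℝ => ((p * u : ℝ) : EReal) - extendH h u) (u : ℝ))
      have hu : (0 : ℝ) ≤ (u : ℝ) := u.2
      simp only [extendH, if_pos hu]
      rw [EReal.coe_sub]
    induction hL : legendreConj (extendH h) p using EReal.rec with
    | bot =>
      have h0 := hge ⟨(0 : ℝ), Set.mem_Ici.2 le_rfl⟩
      rw [hL] at h0
      exact absurd h0 (by simp [EReal.coe_ne_bot, -EReal.coe_sub])
    | top => exact le_top
    | coe x =>
      rw [EReal.coe_le_coe_iff]
      haveI : Nonempty (Ici (0 : ℝ)) := ⟨⟨(0 : ℝ), Set.mem_Ici.2 le_rfl⟩⟩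
      refine ciSup_le fun u => ?_
      have := hge u
      rw [hL, EReal.coe_le_coe_iff] at this
      exact this

theorem Hstar_eq {h : ℝ → ℝ} {a b : ℝ} (ha : 0 < a)
    (hh : ∀ u, a * |u| ^ 2 + b ≤ h u) (p : ℝ) :
    Hstar h p = ⨆ u : Ici (0 : ℝ), (p * (u : ℝ) - h u) := by
  rw [Hstar, legendreConj_extendH ha hh, EReal.toReal_coe]

theorem coe_Hstar {h : ℝ → ℝ} {a b : ℝ} (ha : 0 < a)
    (hh : ∀ u, a * |u| ^ 2 + b ≤ h u) (p : ℝ) :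
    (Hstar h p : EReal) = legendreConj (extendH h) p := by
  rw [Hstar, legendreConj_extendH ha hh, EReal.toReal_coe]

/-! ### Function spaces and the operator -/

/-- `f ∈ C_b^k(ℝ)`: `f` is `k` times continuously differentiable, and `f` and its derivatives up
to order `k` are bounded. -/
def MemCb (k : ℕ) (f : ℝ → ℝ) : Prop :=
  ContDiff ℝ k f ∧ ∀ i ≤ k, ∃ C : ℝ, ∀ x, |iteratedDeriv i f x| ≤ C

/-- Test functions on `ℝ`. -/
def IsTestFun (φ : ℝ → ℝ) : Prop := ContDiff ℝ ∞ φ ∧ HasCompactSupport φ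

/-- The space `L¹(ℝ)`. -/
abbrev L1R : Type := Lp ℝ 1 (volume : Measure ℝ)

/-- The operator `A y = -(H^*(σ² y / 2))'' - f y'` in `L¹(ℝ)`, derivatives being taken in
`𝓓'(ℝ)`: `v ∈ A y` if and only if `H^*(σ² y / 2)` is locally integrable (so that it is a
distribution) and `v = -(H^*(σ² y / 2))'' - f y'` in `𝓓'(ℝ)`. Here `f y'` is the product of the
`C²` function `f` and the distribution `y'` of order at most one,
`⟨f y', φ⟩ = ⟨y', f φ⟩ = -∫ y (f φ)'`. The domain of `A` consists of the `y ∈ L¹(ℝ)` for which the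
distribution on the right-hand side belongs to `L¹(ℝ)`. -/
def opA (h σ f : ℝ → ℝ) (y : L1R) : Set L1R :=
  {v | LocallyIntegrable (fun x => Hstar h (σ x ^ 2 / 2 * y x)) volume ∧
    ∀ φ : ℝ → ℝ, IsTestFun φ →
      ∫ x, v x * φ x =
        -(∫ x, Hstar h (σ x ^ 2 / 2 * y x) * iteratedDeriv 2 φ x)
          - -(∫ x, y x * deriv (fun t => f t * φ t) x)}

end DegenerateFP

end

open Filter Topology

noncomputable section

namespace DegenerateFP

/-! ### Accretive operators: Lipschitz resolvents and propagation of the range condition. -/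

section AbstractAccretive

variable {X : Type*} [NormedAddCommGroup X] [NormedSpace ℝ X]

/-! Write j for H^*, a for σ²/2 and c₁ for a bound of |f'|. The operator shown to be m-accretive is
c₁ I + A.

Accretivity is a Kato inequality for differences. Let z = y₁ - y₂, v = v₁ - v₂ and w = j(a y₁) - j(a
y₂). The equation -w'' - f z' = v says that w has a continuous representative W with W' + f z = g
and g' = f' z - v (`exists_fluxRep`). The at most quadratic growth of j forces the flux g to vanish
at both infinities, and W has the sign of z because j is nondecreasing. What is needed is that g'
has nonpositive integral over {z > 0}. In one dimension this is a statement about intervals: up to a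
null set, {z > 0, g > 0} is the part of {g > 0} where W > 0, or W = 0 and f ≥ 0, and a point moving
to the right leaves it only at a zero of g (`IsFlux.upSet_forward`). Hence every component
contributes a difference g(right end) - g(left end) ≤ 0. Reflection treats {g < 0}, and g' = 0 a.e.
on {g = 0}. Neither nondegeneracy of σ nor strict monotonicity of j enters.

For the range, accretivity and closedness (`isClosed_opB`) reduce the problem to one large constant
lam and to right-hand sides F dominated by a multiple N of the profile 1/(1+x²). The nonlinearity
j(a r) is replaced by J(a r) + ε r with J smooth and Lipschitz; that problem is solved by a
contraction in L¹ for the unknown w = J(a y) + ε y (`exists_range_reg_large`). Uniformly in the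
regularization, y is bounded in L¹, lies above -N/(1+x²) by comparison, W is bounded, and linear
coercivity of j bounds a y from above (`exists_isRegSol`).

The limit is taken along an ultrafilter. Shifted to be nonnegative, the approximations converge
vaguely to a finite measure, and the degenerate set is where singular mass could appear. It does not
(`absolutelyContinuous_limit`): on {a > 0} the upper bound on a y excludes it; on {a = 0, f ≠ 0} the
flux equation tested with f times a cutoff does; on {a = f = 0} the second order equation tested
with a cutoff in a + f² does, because lam + f' > 0. Finally W converges pointwise on {a > 0}, being
locally equi-Lipschitz there, and monotonicity of j identifies its limit in terms of the weak limit
of y (`ae_eq_of_weak_limit`), while near {a = 0} W is negligible since |W| ≤ (D a + ε)|y|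
(`integral_eq_of_weak_limit`). -/

theorem IsAccretive.norm_sub_le {A : X → Set X} (hA : IsAccretive A) {t : ℝ} (ht : 0 ≤ t)
    {u₁ u₂ v₁ v₂ : X} (h₁ : v₁ ∈ A u₁) (h₂ : v₂ ∈ A u₂) :
    ‖u₁ - u₂‖ ≤ ‖(u₁ - u₂) + t • (v₁ - v₂)‖ := by
  obtain ⟨η, ⟨hη, hn⟩, h0⟩ := hA u₁ u₂ v₁ v₂ h₁ h₂
  have hn' : ‖η‖ = ‖u₁ - u₂‖ := by
    rwa [sq_eq_sq₀ (norm_nonneg _) (norm_nonneg _)] at hn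
  have h1 : η ((u₁ - u₂) + t • (v₁ - v₂)) ≤ ‖η‖ * ‖(u₁ - u₂) + t • (v₁ - v₂)‖ :=
    (le_abs_self _).trans (η.le_opNorm _)
  rw [map_add, map_smul, hη, hn', smul_eq_mul] at h1
  rcases (norm_nonneg (u₁ - u₂)).eq_or_lt with h | h
  · rw [← h]; exact norm_nonneg _
  · have := mul_nonneg ht h0
    nlinarith

theorem IsAccretive.norm_sub_le_div {A : X → Set X} (hA : IsAccretive A) {μ : ℝ} (hμ : 0 < μ)
    {u₁ u₂ w₁ w₂ : X} (h₁ : w₁ ∈ shift μ A u₁) (h₂ : w₂ ∈ shift μ A u₂) :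
    ‖u₁ - u₂‖ ≤ μ⁻¹ * ‖w₁ - w₂‖ := by
  obtain ⟨v₁, hv₁, rfl⟩ := h₁
  obtain ⟨v₂, hv₂, rfl⟩ := h₂
  have := hA.norm_sub_le (inv_nonneg.2 hμ.le) hv₁ hv₂
  have e : (u₁ - u₂) + μ⁻¹ • (v₁ - v₂) = μ⁻¹ • ((μ • u₁ + v₁) - (μ • u₂ + v₂)) := by
    rw [add_sub_add_comm, smul_add, ← smul_sub, smul_smul, inv_mul_cancel₀ hμ.ne', one_smul]
  rwa [e, norm_smul, Real.norm_of_nonneg (inv_nonneg.2 hμ.le)] at this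

variable [CompleteSpace X]

/-- The equation μ u + v = w is the fixed point problem u = R(w + (μ₀ - μ) u) for the resolvent R at
μ₀, which is μ₀⁻¹-Lipschitz. The contraction factor |μ₀ - μ|/μ₀ is below 1 exactly for 0 < μ < 2 μ₀.
-/
theorem IsAccretive.range_of_lt {A : X → Set X} (hA : IsAccretive A) {μ₀ μ : ℝ} (hμ₀ : 0 < μ₀)
    (hR : ∀ w : X, ∃ u : X, w ∈ shift μ₀ A u) (hμ : 0 < μ) (hlt : μ < 2 * μ₀) (w : X) :
    ∃ u : X, w ∈ shift μ A u := by
  choose R hR using hR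
  have hc : |μ₀ - μ| / μ₀ < 1 := by
    rw [div_lt_one hμ₀, abs_lt]; constructor <;> linarith
  have hlip : LipschitzWith (Real.toNNReal (|μ₀ - μ| / μ₀)) fun u => R (w + (μ₀ - μ) • u) := by
    refine LipschitzWith.of_dist_le_mul fun a b => ?_
    rw [dist_eq_norm, dist_eq_norm, Real.coe_toNNReal _ (by positivity)]
    refine (hA.norm_sub_le_div hμ₀ (hR _) (hR _)).trans (le_of_eq ?_)
    rw [add_sub_add_left_eq_sub, ← smul_sub, norm_smul, Real.norm_eq_abs]
    field_simp
  have hcw : ContractingWith (Real.toNNReal (|μ₀ - μ| / μ₀)) fun u => R (w + (μ₀ - μ) • u) :=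
    ⟨by rw [← NNReal.coe_lt_coe, Real.coe_toNNReal _ (by positivity)]; exact hc, hlip⟩
  obtain ⟨u, hfix⟩ : ∃ u, R (w + (μ₀ - μ) • u) = u := ⟨_, hcw.fixedPoint_isFixedPt⟩
  have h1 := hR (w + (μ₀ - μ) • u)
  rw [hfix] at h1
  obtain ⟨v, hv, e⟩ := h1
  refine ⟨_, v, hv, ?_⟩
  rw [sub_smul] at e
  rw [eq_sub_of_add_eq e]; abel

/-- Since 3/2 < 2, the range condition climbs from μ₀ to (3/2)^n μ₀; from a large parameter any
smaller positive one is reached in a single step. -/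
theorem IsAccretive.isMAccretive {A : X → Set X} (hA : IsAccretive A) {μ₀ : ℝ} (hμ₀ : 0 < μ₀)
    (hR : ∀ w : X, ∃ u : X, w ∈ shift μ₀ A u) : IsMAccretive A := by
  refine ⟨hA, fun μ hμ => ?_⟩
  have h1 : ∀ n : ℕ, ∀ w : X, ∃ u : X, w ∈ shift ((3 / 2 : ℝ) ^ n * μ₀) A u := by
    intro n
    induction n with
    | zero => simpa using hR
    | succ n ih =>
      have hp : 0 < (3 / 2 : ℝ) ^ n * μ₀ := by positivity
      exact hA.range_of_lt hp ih (by positivity) (by rw [pow_succ]; nlinarith)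
  obtain ⟨n, hn⟩ := pow_unbounded_of_one_lt (μ / μ₀) (by norm_num : (1 : ℝ) < 3 / 2)
  rw [div_lt_iff₀ hμ₀] at hn
  exact hA.range_of_lt (by positivity) (h1 n) hμ (by linarith)

/-- For a closed accretive operator, dense range of `μ I + A` implies full range. -/
theorem IsAccretive.range_of_dense {A : X → Set X} (hA : IsAccretive A)
    (hcl : ∀ (u v : ℕ → X) (u₀ v₀ : X), (∀ n, v n ∈ A (u n)) → Tendsto u atTop (𝓝 u₀) →
      Tendsto v atTop (𝓝 v₀) → v₀ ∈ A u₀)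
    {μ : ℝ} (hμ : 0 < μ) (hR : Dense {w : X | ∃ u : X, w ∈ shift μ A u}) (w : X) :
    ∃ u : X, w ∈ shift μ A u := by
  obtain ⟨W, hW, hlim⟩ := mem_closure_iff_seq_limit.1 (hR w)
  choose u hu using hW
  have hc : CauchySeq u := by
    rw [Metric.cauchySeq_iff']
    intro ε hε
    obtain ⟨N, hN⟩ := Metric.cauchySeq_iff'.1 hlim.cauchySeq (μ * ε) (by positivity)
    refine ⟨N, fun n hn => ?_⟩
    rw [dist_eq_norm]
    refine (hA.norm_sub_le_div hμ (hu n) (hu N)).trans_lt ?_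
    rw [← dist_eq_norm, inv_mul_lt_iff₀ hμ]
    exact hN n hn
  obtain ⟨u₀, hu₀⟩ := cauchySeq_tendsto_of_complete hc
  choose v hv e using hu
  have hv' : v = fun n => W n - μ • u n := by
    funext n; rw [e n]; abel
  refine ⟨u₀, w - μ • u₀, hcl u v u₀ _ hv hu₀ ?_, by abel⟩
  rw [hv']
  exact hlim.sub (hu₀.const_smul μ)

end AbstractAccretive

end DegenerateFP

namespace DegenerateFP

/-! ### Primitives of locally integrable functions -/

/-- `P` is a primitive of the locally integrable function `p`. -/
def IsAntideriv (P p : ℝ → ℝ) : Prop :=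
  LocallyIntegrable p volume ∧ ∀ a b, P b - P a = ∫ x in a..b, p x

namespace IsAntideriv

variable {P p Q q : ℝ → ℝ}

theorem intervalIntegrable (h : LocallyIntegrable p volume) (a b : ℝ) :
    IntervalIntegrable p volume a b :=
  intervalIntegrable_iff.mpr <| (h.integrableOn_isCompact isCompact_uIcc).mono_set uIoc_subset_uIcc

theorem eq_add (h : IsAntideriv P p) (a : ℝ) : P = fun x => P a + ∫ t in a..x, p t := by
  funext x; rw [← h.2 a x]; ring

theorem continuous (h : IsAntideriv P p) : Continuous P := by
  rw [h.eq_add 0]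
  exact continuous_const.add
    (intervalIntegral.continuous_primitive (fun a b => intervalIntegrable h.1 a b) 0)

theorem ae_hasDerivAt (h : IsAntideriv P p) : ∀ᵐ x, HasDerivAt P (p x) x := by
  filter_upwards [LocallyIntegrable.ae_hasDerivAt_integral h.1] with x hx
  rw [h.eq_add 0]
  exact (hx 0).const_add _

theorem absolutelyContinuous (h : IsAntideriv P p) (a b : ℝ) :
    AbsolutelyContinuousOnInterval P a b := by
  have h1 := (intervalIntegrable h.1 a b).absolutelyContinuousOnInterval_intervalIntegral
    (c := a) left_mem_uIcc
  have h2 : AbsolutelyContinuousOnInterval (fun _ : ℝ => P a) a b :=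
    (LipschitzWith.const (P a)).lipschitzOnWith.absolutelyContinuousOnInterval
  rw [h.eq_add a]
  exact h2.add h1

theorem integral (h : LocallyIntegrable p volume) (a c : ℝ) :
    IsAntideriv (fun x => c + ∫ t in a..x, p t) p := by
  refine ⟨h, fun x y => ?_⟩
  rw [add_sub_add_left_eq_sub]
  exact intervalIntegral.integral_interval_sub_left (intervalIntegrable h _ _)
    (intervalIntegrable h _ _)

theorem add (h : IsAntideriv P p) (h' : IsAntideriv Q q) :
    IsAntideriv (fun x => P x + Q x) (fun x => p x + q x) := by
  refine ⟨h.1.add h'.1, fun a b => ?_⟩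
  rw [intervalIntegral.integral_add (intervalIntegrable h.1 _ _) (intervalIntegrable h'.1 _ _),
    ← h.2, ← h'.2]; ring

theorem neg (h : IsAntideriv P p) : IsAntideriv (fun x => -P x) (fun x => -p x) := by
  refine ⟨h.1.neg, fun a b => ?_⟩
  rw [intervalIntegral.integral_neg, ← h.2]; ring

theorem sub (h : IsAntideriv P p) (h' : IsAntideriv Q q) :
    IsAntideriv (fun x => P x - Q x) (fun x => p x - q x) := by
  simpa only [sub_eq_add_neg] using h.add h'.neg

/-- Reflection `x ↦ -x`. -/
theorem comp_neg (h : IsAntideriv P p) : IsAntideriv (fun x => P (-x)) (fun x => -p (-x)) := by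
  refine ⟨?_, fun a b => ?_⟩
  · refine LocallyIntegrable.neg fun x => ?_
    obtain ⟨s, hs, hs'⟩ := h.1 (-x)
    refine ⟨-s, ?_, ?_⟩
    · have := (continuous_neg (G := ℝ)).continuousAt.preimage_mem_nhds hs
      simpa using this
    · have := (Measure.measurePreserving_neg (volume : Measure ℝ)).integrableOn_comp_preimage
        (Homeomorph.neg ℝ).measurableEmbedding (f := p) (s := s)
      exact this.2 hs'
  · rw [intervalIntegral.integral_neg, intervalIntegral.integral_comp_neg fun x => p x,
      intervalIntegral.integral_symm, ← h.2]; simp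

/-- Integration by parts against a compactly supported `C¹` function. -/
theorem integral_mul_deriv (h : IsAntideriv P p) {ψ : ℝ → ℝ} (hψ : ContDiff ℝ 1 ψ)
    (hc : HasCompactSupport ψ) : ∫ x, P x * deriv ψ x = -∫ x, p x * ψ x := by
  obtain ⟨M, hM⟩ := hc.isCompact.isBounded.subset_ball 0
  have hM' : ∀ x, x ∉ Ioo (-M) M → x ∉ tsupport ψ := fun x hx hx' => by
    have := hM hx'
    rw [Real.ball_eq_Ioo, zero_sub, zero_add] at this
    exact hx this
  have z : ∀ x, x ∉ Ioo (-M) M → ψ x = 0 := fun x hx => image_eq_zero_of_notMem_tsupport (hM' x hx)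
  have z' : ∀ x, x ∉ Ioo (-M) M → deriv ψ x = 0 := fun x hx =>
    image_eq_zero_of_notMem_tsupport fun h' => hM' x hx (tsupport_deriv_subset (f := ψ) h')
  have hψac : AbsolutelyContinuousOnInterval ψ (-M) M :=
    hψ.contDiffOn.absolutelyContinuousOnInterval
  have key := (h.absolutelyContinuous (-M) M).integral_mul_deriv_eq_deriv_mul hψac
  rw [z M (by simp), z (-M) (by simp)] at key
  have e1 : ∫ x in (-M)..M, P x * deriv ψ x = ∫ x, P x * deriv ψ x :=
    intervalIntegral.integral_eq_integral_of_support_subset fun x hx => by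
      by_contra hx'
      exact hx (by simp only [z' x (fun h' => hx' ⟨h'.1, h'.2.le⟩), mul_zero])
  have e2 : ∫ x in (-M)..M, p x * ψ x = ∫ x, p x * ψ x :=
    intervalIntegral.integral_eq_integral_of_support_subset fun x hx => by
      by_contra hx'
      exact hx (by simp only [z x (fun h' => hx' ⟨h'.1, h'.2.le⟩), mul_zero])
  have e3 : ∫ x in (-M)..M, deriv P x * ψ x = ∫ x in (-M)..M, p x * ψ x := by
    refine intervalIntegral.integral_congr_ae ?_
    filter_upwards [h.ae_hasDerivAt] with x hx _
    rw [hx.deriv]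
  rw [← e1, key, e3, e2]; ring

/-- The derivative of a primitive vanishes a.e. on each level set. -/
theorem ae_eq_zero (h : IsAntideriv P p) : ∀ᵐ x, P x = 0 → p x = 0 := by
  -- Zeros of `P` isolated from the right are countable. At any other zero, a nonzero derivative
  -- would exclude nearby zeros, a contradiction.
  have hc := (countable_setOfPred_isolated_right_within (s := {x : ℝ | P x = 0})).ae_notMem
    (volume : Measure ℝ)
  filter_upwards [h.ae_hasDerivAt, hc] with x hx hx' h0
  by_contra hne
  refine hx' ⟨h0, ?_⟩
  have := hx.eventually_ne (c := 0) hne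
  rw [← empty_mem_iff_bot]
  have h2 : ∀ᶠ y in 𝓝[{x | P x = 0} ∩ Ioi x] x, P y ≠ 0 :=
    this.filter_mono (nhdsWithin_mono _ fun y hy => (mem_Ioi.1 hy.2).ne')
  have h3 : ∀ᶠ y in 𝓝[{x | P x = 0} ∩ Ioi x] x, P y = 0 := by
    filter_upwards [self_mem_nhdsWithin] with y hy using hy.1
  filter_upwards [h2, h3] with y h4 h5 using h4 h5

end IsAntideriv

/-! ### Test functions and the lemma of Du Bois-Reymond -/

theorem IsTestFun.deriv {φ : ℝ → ℝ} (h : IsTestFun φ) : IsTestFun (deriv φ) :=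
  ⟨(contDiff_infty_iff_deriv.1 h.1).2, h.2.deriv⟩

theorem IsTestFun.integrable {φ : ℝ → ℝ} (h : IsTestFun φ) : Integrable φ :=
  h.1.continuous.integrable_of_hasCompactSupport h.2

theorem iteratedDeriv_two (φ : ℝ → ℝ) : iteratedDeriv 2 φ = deriv (deriv φ) := by
  rw [iteratedDeriv_succ, iteratedDeriv_one]

theorem IsTestFun.exists_deriv_eq {χ : ℝ → ℝ} (h : IsTestFun χ) (h0 : ∫ x, χ x = 0) :
    ∃ φ, IsTestFun φ ∧ _root_.deriv φ = χ := by
  obtain ⟨M, hM⟩ := h.2.isCompact.isBounded.subset_ball 0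
  have z : ∀ x, x ∉ Ioo (-M) M → χ x = 0 := fun x hx =>
    image_eq_zero_of_notMem_tsupport fun hx' => by
      have := hM hx'
      rw [Real.ball_eq_Ioo, zero_sub, zero_add] at this
      exact hx this
  have hd : ∀ x, HasDerivAt (fun x => ∫ t in (-M)..x, χ t) (χ x) x := fun x =>
    (h.1.continuous.integral_hasStrictDerivAt (-M) x).hasDerivAt
  have hd' : _root_.deriv (fun x => ∫ t in (-M)..x, χ t) = χ := funext fun x => (hd x).deriv
  refine ⟨fun x => ∫ t in (-M)..x, χ t, ⟨?_, ?_⟩, hd'⟩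
  · rw [contDiff_infty_iff_deriv, hd']
    exact ⟨fun x => (hd x).differentiableAt, h.1⟩
  · refine HasCompactSupport.intro (isCompact_Icc (a := -M) (b := M)) fun x hx => ?_
    by_cases h1 : x ≤ M
    · have hx1 : x < -M := by
        by_contra h2; exact hx ⟨not_lt.1 h2, h1⟩
      rw [intervalIntegral.integral_symm, neg_eq_zero]
      refine intervalIntegral.integral_zero_ae (Eventually.of_forall fun t ht => ?_)
      rw [uIoc_of_le hx1.le] at ht
      exact z t fun h' => (not_lt.2 ht.2) h'.1
    · rw [← h0]
      refine intervalIntegral.integral_eq_integral_of_support_subset fun t ht => ?_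
      by_contra h'
      refine ht (z t fun h'' => h' ⟨h''.1, h''.2.le.trans (not_le.1 h1).le⟩)

theorem exists_testFun_integral_eq_one : ∃ ρ, IsTestFun ρ ∧ ∫ x, ρ x = 1 := by
  let b : ContDiffBump (0 : ℝ) := ⟨1, 2, by norm_num, by norm_num⟩
  exact ⟨b.normed volume, ⟨b.contDiff_normed, b.hasCompactSupport_normed⟩, b.integral_normed⟩

theorem IsTestFun.integrable_mul {u φ : ℝ → ℝ} (hφ : IsTestFun φ)
    (hu : LocallyIntegrable u volume) : Integrable fun x => u x * φ x := by
  have := hu.integrable_smul_left_of_hasCompactSupport hφ.1.continuous hφ.2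
  refine this.congr (Eventually.of_forall fun x => ?_)
  simp [mul_comm]

theorem IsTestFun.sub_const_mul {φ ρ : ℝ → ℝ} (hφ : IsTestFun φ) (hρ : IsTestFun ρ) (c : ℝ) :
    IsTestFun fun x => φ x - c * ρ x :=
  ⟨hφ.1.sub (contDiff_const.mul hρ.1), hφ.2.sub hρ.2.mul_left⟩

theorem ae_eq_const_of_integral_mul_deriv {u : ℝ → ℝ} (hu : LocallyIntegrable u volume)
    (h : ∀ φ, IsTestFun φ → ∫ x, u x * deriv φ x = 0) : ∃ c : ℝ, ∀ᵐ x, u x = c := by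
  obtain ⟨ρ, hρ, hρ1⟩ := exists_testFun_integral_eq_one
  refine ⟨∫ x, u x * ρ x, ?_⟩
  refine ae_eq_of_integral_contDiff_smul_eq hu (locallyIntegrable_const _) fun ψ hψ hψc => ?_
  have hψt : IsTestFun ψ := ⟨hψ, hψc⟩
  -- Subtracting (∫ ψ) ρ makes the mean vanish, so the result is the derivative of a test function.
  obtain ⟨φ, hφ, e⟩ := (hψt.sub_const_mul hρ (∫ x, ψ x)).exists_deriv_eq (by
    rw [integral_sub hψt.integrable (hρ.integrable.const_mul _), integral_const_mul, hρ1]; ring)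
  have h1 := h φ hφ
  rw [e] at h1
  have e1 : ∀ x, u x * (ψ x - (∫ x, ψ x) * ρ x) = u x * ψ x - (∫ x, ψ x) * (u x * ρ x) :=
    fun x => by ring
  simp_rw [e1] at h1
  rw [integral_sub (hψt.integrable_mul hu) ((hρ.integrable_mul hu).const_mul _),
    integral_const_mul] at h1
  simp_rw [smul_eq_mul, mul_comm (ψ _)]
  rw [integral_const_mul]
  linarith

theorem ae_eq_affine_of_integral_mul_iteratedDeriv {u : ℝ → ℝ} (hu : LocallyIntegrable u volume)
    (h : ∀ φ, IsTestFun φ → ∫ x, u x * iteratedDeriv 2 φ x = 0) :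
    ∃ c d : ℝ, ∀ᵐ x, u x = c * x + d := by
  obtain ⟨ρ, hρ, hρ1⟩ := exists_testFun_integral_eq_one
  -- With this `c`, ∫ u ψ' = c ∫ ψ for every test function ψ, while c x contributes -c ∫ ψ; so u + c
  -- x is orthogonal to all derivatives ψ'.
  set c := ∫ x, u x * deriv ρ x with hc
  have hlin : LocallyIntegrable (fun x : ℝ => c * x) volume :=
    (continuous_const.mul continuous_id).locallyIntegrable
  have hanti : IsAntideriv (fun x : ℝ => c * x) (fun _ => c) :=
    ⟨locallyIntegrable_const _, fun a b => by simp; ring⟩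
  obtain ⟨d, hd⟩ := ae_eq_const_of_integral_mul_deriv (hu.add hlin) fun ψ hψ => by
    obtain ⟨φ, hφ, e⟩ := (hψ.sub_const_mul hρ (∫ x, ψ x)).exists_deriv_eq (by
      rw [integral_sub hψ.integrable (hρ.integrable.const_mul _), integral_const_mul, hρ1]; ring)
    have h1 := h φ hφ
    have e2 : iteratedDeriv 2 φ = fun x => deriv ψ x - (∫ x, ψ x) * deriv ρ x := by
      rw [iteratedDeriv_two, e]
      funext x
      have d1 := (hψ.1.differentiable (by simp)).differentiableAt (x := x) |>.hasDerivAt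
      have d2 := (hρ.1.differentiable (by simp)).differentiableAt (x := x) |>.hasDerivAt
      exact (d1.sub (d2.const_mul _)).deriv
    rw [e2] at h1
    have e1 : ∀ x, u x * (deriv ψ x - (∫ x, ψ x) * deriv ρ x)
      = u x * deriv ψ x - (∫ x, ψ x) * (u x * deriv ρ x) := fun x => by ring
    simp_rw [e1] at h1
    rw [integral_sub (hψ.deriv.integrable_mul hu) ((hρ.deriv.integrable_mul hu).const_mul _),
      integral_const_mul] at h1
    have h2 := hanti.integral_mul_deriv (hψ.1.of_le (by simp)) hψ.2
    rw [integral_const_mul] at h2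
    have e3 : ∀ x, (u + fun x => c * x) x * deriv ψ x = u x * deriv ψ x + c * x * deriv ψ x :=
      fun x => by simp [add_mul]
    simp_rw [e3]
    rw [integral_add (hψ.deriv.integrable_mul hu) (hψ.deriv.integrable_mul hlin), h2]
    rw [← hc] at h1
    linarith
  refine ⟨-c, d, ?_⟩
  filter_upwards [hd] with x hx
  simp only [Pi.add_apply] at hx
  linarith

end DegenerateFP

namespace DegenerateFP

/-! ### The Kato inequality for one-dimensional degenerate equations -/

/-- Induction along the interval: the supremum of the t with [a, t] contained in `U` belongs to `U`
by closure from the left, and openness to the right prevents it from stopping before b. -/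
theorem mem_of_real_induction {U : Set ℝ} {a b : ℝ} (hab : a ≤ b) (ha : a ∈ U)
    (h1 : ∀ x ∈ Ico a b, x ∈ U → ∃ y > x, Icc x y ⊆ U)
    (h2 : ∀ x ∈ Ioc a b, Ico a x ⊆ U → x ∈ U) : b ∈ U := by
  set S := {t | t ∈ Icc a b ∧ Icc a t ⊆ U} with hS
  have haS : a ∈ S := ⟨⟨le_rfl, hab⟩, by simpa using ha⟩
  have hbdd : BddAbove S := ⟨b, fun t ht => ht.1.2⟩
  set t := sSup S
  have hat : a ≤ t := le_csSup hbdd haS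
  have htb : t ≤ b := csSup_le ⟨a, haS⟩ fun t ht => ht.1.2
  have hlt : Ico a t ⊆ U := fun r hr => by
    obtain ⟨s, hs, hrs⟩ := exists_lt_of_lt_csSup ⟨a, haS⟩ hr.2
    exact hs.2 ⟨hr.1, hrs.le⟩
  have htU : t ∈ U := by
    rcases hat.eq_or_lt with h | h
    · rwa [← h]
    · exact h2 t ⟨h, htb⟩ hlt
  rcases htb.eq_or_lt with h | h
  · rwa [← h]
  · obtain ⟨y, hy, hyU⟩ := h1 t ⟨hat, h⟩ htU
    have : min y b ∈ S := by
      refine ⟨⟨le_min (hat.trans hy.le) hab, min_le_right _ _⟩, fun r hr => ?_⟩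
      rcases lt_or_ge r t with h' | h'
      · exact hlt ⟨hr.1, h'⟩
      · exact hyU ⟨h', hr.2.trans (min_le_left _ _)⟩
    have h3 := le_csSup hbdd this
    exact absurd h3 (not_le.2 (lt_min hy h))

/-- The flux formulation of `-W'' - f z' = v` with `p = f' z - v`: `W' + f z = g`, `g' = p`, where
`g` vanishes at infinity and `W` has the sign of `z`. -/
structure IsFlux (f z p g W : ℝ → ℝ) (L : ℝ) : Prop where
  lip : ∀ a b, |f a - f b| ≤ L * |a - b|
  int_z : Integrable z
  int_p : Integrable p
  antideriv_g : IsAntideriv g p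
  antideriv_W : IsAntideriv W fun x => g x - f x * z x
  tendsto_top : Tendsto g atTop (𝓝 0)
  tendsto_bot : Tendsto g atBot (𝓝 0)
  pos : ∀ᵐ x, 0 < z x → 0 ≤ W x
  neg : ∀ᵐ x, z x < 0 → W x ≤ 0

namespace IsFlux

variable {f z p g W : ℝ → ℝ} {L : ℝ}

theorem continuous_f (h : IsFlux f z p g W L) : Continuous f := by
  refine (LipschitzWith.of_dist_le' (K := L) fun a b => ?_).continuous
  rw [Real.dist_eq, Real.dist_eq]; exact h.lip a b

/-- Reflection preserves the signs of z and W and reverses those of f and g, so results on {g > 0}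
transfer to {g < 0}. -/
theorem reflect (h : IsFlux f z p g W L) :
    IsFlux (fun x => -f (-x)) (fun x => z (-x)) (fun x => p (-x)) (fun x => -g (-x))
      (fun x => W (-x)) L where
  lip a b := by
    have := h.lip (-b) (-a)
    have e1 : -f (-a) - -f (-b) = f (-b) - f (-a) := by ring
    have e2 : -b - -a = a - b := by ring
    rwa [e1, ← e2]
  int_z := h.int_z.comp_neg
  int_p := h.int_p.comp_neg
  antideriv_g := by
    have := h.antideriv_g.comp_neg.neg
    simpa using this
  antideriv_W := by
    have := h.antideriv_W.comp_neg
    refine cast ?_ this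
    congr 1
    funext x; ring
  tendsto_top := by
    simpa using (h.tendsto_bot.comp tendsto_neg_atTop_atBot).neg
  tendsto_bot := by
    simpa using (h.tendsto_top.comp tendsto_neg_atBot_atTop).neg
  pos := (Measure.measurePreserving_neg (volume : Measure ℝ)).quasiMeasurePreserving.ae h.pos
  neg := (Measure.measurePreserving_neg (volume : Measure ℝ)).quasiMeasurePreserving.ae h.neg

theorem le_of_nonneg (h : IsFlux f z p g W L) {a b : ℝ} (hab : a ≤ b)
    (hg : ∀ᵐ x, x ∈ Ioc a b → 0 ≤ g x - f x * z x) : W a ≤ W b := by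
  have := h.antideriv_W.2 a b
  have h2 : 0 ≤ ∫ x in a..b, (g x - f x * z x) := by
    rw [intervalIntegral.integral_of_le hab]
    refine integral_nonneg_of_ae ?_
    exact (ae_restrict_iff' measurableSet_Ioc).2 hg
  linarith

/-- The region where the sign of `z` is `1`, as long as `g > 0`. -/
def upSet (f W : ℝ → ℝ) : Set ℝ := {x | 0 < W x ∨ (W x = 0 ∧ 0 ≤ f x)}

/-- The only delicate points have W = 0. If f > 0 there, W cannot become negative: it would entail z
≤ 0 and hence W' = g - f z > 0. If f = 0 there, the Lipschitz bound makes f z negligible against g,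
and W becomes positive at once. -/
theorem upSet_right (h : IsFlux f z p g W L) {x b : ℝ} (hxb : x < b)
    (hg : ∀ y ∈ Icc x b, 0 < g y) (hx : x ∈ upSet f W) : ∃ y > x, Icc x y ⊆ upSet f W := by
  have hWc := h.antideriv_W.continuous
  have hgc := h.antideriv_g.continuous
  rcases hx with hx | ⟨hx, hfx⟩
  · have := (hWc.tendsto x).eventually_const_lt hx
    obtain ⟨ε, hε, hb⟩ := Metric.eventually_nhds_iff_ball.1 this
    refine ⟨x + ε / 2, by linarith, fun r hr => Or.inl (hb r ?_)⟩
    rw [Real.ball_eq_Ioo]; constructor <;> linarith [hr.1, hr.2]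
  rcases hfx.eq_or_lt with hfx | hfx
  -- Since |f| ≤ L (r - x) on [x, r], W(r) ≥ (r - x)(g(x)/2 - L ∫ |z|) close to x, and the integral
  -- tends to 0 with r - x.
  · have hgx : 0 < g x := hg x ⟨le_rfl, hxb.le⟩
    have e1 := (hgc.tendsto x).eventually_const_lt (show g x / 2 < g x by linarith)
    have hZ : Continuous fun y => ∫ t in x..y, |z t| :=
      intervalIntegral.continuous_primitive
        (fun a b => h.int_z.abs.intervalIntegrable) x
    have hL : 0 ≤ L := by
      have := h.lip 1 0; simp at this; exact (abs_nonneg _).trans this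
    have e2 := (hZ.tendsto x).eventually_lt_const
      (show ∫ t in x..x, |z t| < g x / (2 * (L + 1)) by
        rw [intervalIntegral.integral_same]; positivity)
    obtain ⟨ε, hε, hb⟩ := Metric.eventually_nhds_iff_ball.1 (e1.and e2)
    refine ⟨x + ε / 2, by linarith, fun r hr => ?_⟩
    have hball : ∀ s ∈ Icc x r, s ∈ Metric.ball x ε := fun s hs => by
      rw [Real.ball_eq_Ioo]; constructor <;> linarith [hr.1, hr.2, hs.1, hs.2]
    rcases hr.1.eq_or_lt with hxr | hxr
    · rw [← hxr]; exact Or.inr ⟨hx, hfx.le⟩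
    left
    have h1 := h.antideriv_W.2 x r
    have ig : IntervalIntegrable g volume x r := hgc.intervalIntegrable _ _
    have izf : IntervalIntegrable (fun t => f t * z t) volume x r :=
      h.int_z.intervalIntegrable.continuousOn_mul h.continuous_f.continuousOn
    have iza : IntervalIntegrable (fun t => |z t|) volume x r := h.int_z.abs.intervalIntegrable
    rw [intervalIntegral.integral_sub ig izf] at h1
    have h2 : (r - x) * (g x / 2) ≤ ∫ t in x..r, g t := by
      have := intervalIntegral.integral_mono_on hr.1 (intervalIntegrable_const (c := g x / 2)) ig
        fun s hs => (hb s (hball s hs)).1.le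
      rwa [intervalIntegral.integral_const, smul_eq_mul] at this
    have h3 : ∫ t in x..r, f t * z t ≤ ∫ t in x..r, (L * (r - x)) * |z t| := by
      refine intervalIntegral.integral_mono_on hr.1 izf (iza.const_mul _) fun s hs => ?_
      have h4 := h.lip s x
      rw [← hfx, sub_zero, abs_of_nonneg (sub_nonneg.2 hs.1)] at h4
      calc f s * z s ≤ |f s| * |z s| := by rw [← abs_mul]; exact le_abs_self _
        _ ≤ _ := by
          refine mul_le_mul_of_nonneg_right (h4.trans ?_) (abs_nonneg _)
          exact mul_le_mul_of_nonneg_left (by linarith [hs.2]) hL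
    rw [intervalIntegral.integral_const_mul] at h3
    have h5 := (hb r (hball r ⟨hr.1, le_rfl⟩)).2
    have h6 : L * (∫ t in x..r, |z t|) < g x / 2 := by
      have h7 : 0 ≤ ∫ t in x..r, |z t| :=
        intervalIntegral.integral_nonneg hr.1 fun s _ => abs_nonneg _
      rw [lt_div_iff₀ (by positivity)] at h5
      nlinarith
    have : 0 < (r - x) * (g x / 2 - L * (∫ t in x..r, |z t|)) :=
      mul_pos (by linarith) (by linarith)
    rw [hx] at h1
    nlinarith
  · have := (h.continuous_f.tendsto x).eventually_const_lt hfx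
    obtain ⟨ε, hε, hb⟩ := Metric.eventually_nhds_iff_ball.1 this
    refine ⟨min b (x + ε / 2), lt_min hxb (by linarith), fun r hr => ?_⟩
    have hrb : r ≤ b := hr.2.trans (min_le_left _ _)
    have hre : r ≤ x + ε / 2 := hr.2.trans (min_le_right _ _)
    have hball : ∀ s ∈ Icc x r, 0 < f s := fun s hs => hb s (by
      rw [Real.ball_eq_Ioo]; constructor <;> linarith [hs.1, hs.2])
    suffices hW : 0 ≤ W r by
      rcases hW.eq_or_lt with h' | h'
      · exact Or.inr ⟨h'.symm, (hball r ⟨hr.1, le_rfl⟩).le⟩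
      · exact Or.inl h'
    by_contra hneg
    -- After the last point `s` where W ≥ 0, W is negative, so z ≤ 0 and g - f z ≥ 0. Thus W does
    -- not decrease from `s` to `r`, against W(r) < 0 ≤ W(s).
    set S := {s | s ∈ Icc x r ∧ 0 ≤ W s}
    have hSc : IsCompact S := isCompact_Icc.inter_right (isClosed_Ici.preimage hWc)
    have hSn : S.Nonempty := ⟨x, ⟨le_rfl, hr.1⟩, hx.ge⟩
    have hs := hSc.sSup_mem hSn
    set s := sSup S
    have : W s ≤ W r := by
      refine h.le_of_nonneg hs.1.2 ?_
      filter_upwards [h.pos] with t ht htm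
      have hWt : W t < 0 := by
        by_contra h'
        have : t ≤ s := le_csSup hSc.bddAbove ⟨⟨hs.1.1.trans htm.1.le, htm.2⟩, not_lt.1 h'⟩
        exact absurd htm.1 (not_lt.2 this)
      have hzt : z t ≤ 0 := by
        by_contra h'; exact absurd (ht (not_le.1 h')) (not_le.2 hWt)
      have hft := hball t ⟨hs.1.1.trans htm.1.le, htm.2⟩
      have hgt := hg t ⟨hs.1.1.trans htm.1.le, htm.2.trans hrb⟩
      nlinarith
    exact hneg (hs.2.trans this)

/-- By continuity W(x) ≥ 0. If W(x) = 0 and f(x) < 0, then f < 0 just to the left, where membership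
now means W > 0; so z ≥ 0 and W' = g - f z > 0, and W cannot come down to 0. -/
theorem upSet_left (h : IsFlux f z p g W L) {a x : ℝ} (hax : a < x)
    (hg : ∀ y ∈ Icc a x, 0 < g y) (hU : Ico a x ⊆ upSet f W) : x ∈ upSet f W := by
  have hWc := h.antideriv_W.continuous
  have hWx : 0 ≤ W x := by
    have hcl : Icc a x ⊆ {y | 0 ≤ W y} := by
      rw [← closure_Ico hax.ne]
      refine closure_minimal (fun y hy => ?_) (isClosed_Ici.preimage hWc)
      rcases hU hy with h' | h'
      · exact h'.le
      · exact h'.1.ge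
    exact hcl ⟨hax.le, le_rfl⟩
  rcases hWx.eq_or_lt with hx | hx
  swap
  · exact Or.inl hx
  refine Or.inr ⟨hx.symm, ?_⟩
  by_contra hfx
  have := (h.continuous_f.tendsto x).eventually_lt_const (not_le.1 hfx)
  obtain ⟨ε, hε, hb⟩ := Metric.eventually_nhds_iff_ball.1 this
  set y := max a (x - ε / 2)
  have hyx : y < x := max_lt hax (by linarith)
  have hball : ∀ s ∈ Icc y x, f s < 0 := fun s hs => hb s (by
    have := (le_max_right a (x - ε / 2)).trans hs.1
    rw [Real.ball_eq_Ioo]; constructor <;> linarith [hs.2])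
  have hWpos : ∀ s ∈ Ico y x, 0 < W s := fun s hs => by
    rcases hU ⟨(le_max_left _ _).trans hs.1, hs.2⟩ with h' | h'
    · exact h'
    · exact absurd h'.2 (not_le.2 (hball s ⟨hs.1, hs.2.le⟩))
  have : W y ≤ W x := by
    refine h.le_of_nonneg hyx.le ?_
    have hne : ∀ᵐ t : ℝ, t ≠ x := by simp [ae_iff, measure_singleton]
    filter_upwards [h.neg, hne] with t ht htx htm
    have hWt := hWpos t ⟨htm.1.le, lt_of_le_of_ne htm.2 htx⟩
    have hzt : 0 ≤ z t := by
      by_contra h'; exact absurd (ht (not_le.1 h')) (not_le.2 hWt)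
    have hft := hball t ⟨htm.1.le, htm.2⟩
    have hgt := hg t ⟨(le_max_left _ _).trans htm.1.le, htm.2⟩
    nlinarith
  linarith [hWpos y ⟨le_rfl, hyx⟩]

theorem upSet_forward (h : IsFlux f z p g W L) {a b : ℝ} (hab : a ≤ b)
    (hg : ∀ y ∈ Icc a b, 0 < g y) (ha : a ∈ upSet f W) : b ∈ upSet f W :=
  mem_of_real_induction hab ha
    (fun _ hx hxU => h.upSet_right hx.2 (fun y hy => hg y ⟨hx.1.trans hy.1, hy.2⟩) hxU)
    (fun _ hx hxU => h.upSet_left hx.1 (fun y hy => hg y ⟨hy.1, hy.2.trans hx.2⟩) hxU)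

end IsFlux

/-- A measurable set of positivity of `g` which can be left, moving to the right, only at zeros of
`g`, carries a nonpositive integral of `g'`. -/
theorem setIntegral_nonpos_of_forward {g p : ℝ → ℝ} (hg : IsAntideriv g p) (hp : Integrable p)
    (htop : Tendsto g atTop (𝓝 0)) {U : Set ℝ} (hUg : ∀ x ∈ U, 0 < g x)
    (hfw : ∀ x ∈ U, ∀ y, x ≤ y → (∀ t ∈ Icc x y, 0 < g t) → y ∈ U) :
    ∫ x in U, p x ≤ 0 := by
  have hgc := hg.continuous
  have hfw' : ∀ x ∈ U, ∀ y, (∀ t ∈ Icc x y, 0 < g t) → Icc x y ⊆ U := fun x hx y hy t ht =>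
    hfw x hx t ht.1 fun s hs => hy s ⟨hs.1, hs.2.trans ht.2⟩
  have hright : ∀ x, 0 < g x → ∃ ε > 0, ∀ t ∈ Icc (x - ε) (x + ε), 0 < g t := fun x hx => by
    obtain ⟨ε, hε, hb⟩ := Metric.eventually_nhds_iff_ball.1
      ((hgc.tendsto x).eventually_const_lt hx)
    refine ⟨ε / 2, by linarith, fun t ht => hb t ?_⟩
    rw [Real.ball_eq_Ioo]; constructor <;> linarith [ht.1, ht.2]
  -- `U` need not be open, but each of its points starts an interval inside `U`. Hence every
  -- component meets the dense sequence and countably many components suffice.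
  set C : ℕ → Set ℝ := fun n => ordConnectedComponent U (TopologicalSpace.denseSeq ℝ n) with hC
  have hCo : ∀ n, (C n).OrdConnected := fun n => inferInstance
  have hCm : ∀ n, MeasurableSet (C n) := fun n => (hCo n).measurableSet
  have hCU : ∀ n, C n ⊆ U := fun n => ordConnectedComponent_subset
  have hCmax : ∀ n, ∀ x ∈ C n, ∀ y, Icc x y ⊆ U → x ≤ y → y ∈ C n := by
    intro n x hx y hxy hle
    have h1 : y ∈ ordConnectedComponent U x := by
      rw [mem_ordConnectedComponent, uIcc_of_le hle]; exact hxy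
    exact mem_ordConnectedComponent_trans hx h1
  have hunion : ⋃ n, C n = U := by
    refine Subset.antisymm (iUnion_subset hCU) fun x hx => ?_
    obtain ⟨ε, hε, hb⟩ := hright x (hUg x hx)
    have hsub : Icc x (x + ε) ⊆ U :=
      hfw' x hx _ fun t ht => hb t ⟨by linarith [ht.1], ht.2⟩
    obtain ⟨n, hn⟩ := (TopologicalSpace.denseRange_denseSeq ℝ).exists_mem_open
      (isOpen_Ioo (a := x) (b := x + ε)) ⟨x + ε / 2, by constructor <;> linarith⟩
    refine mem_iUnion.2 ⟨n, ?_⟩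
    rw [hC, mem_ordConnectedComponent, uIcc_of_ge hn.1.le]
    exact fun t ht => hsub ⟨ht.1, ht.2.trans hn.2.le⟩
  -- On a truncated component with end points a ≤ b the integral is g(b) - g(a), with g(a) ≥ 0 by
  -- closure. If b < M then g(b) ≤ 0, for otherwise the component would extend past b; if b = M the
  -- error |g(M)| disappears as M → ∞.
  have htrunc : ∀ n, ∀ M : ℝ, ∫ x in C n ∩ Ioc (-M) M, p x ≤ |g M| := by
    intro n M
    set D := C n ∩ Ioc (-M) M with hD
    rcases D.eq_empty_or_nonempty with h0 | hne
    · rw [h0, setIntegral_empty]; exact abs_nonneg _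
    have hDo : D.OrdConnected := (hCo n).inter ordConnected_Ioc
    have hDa : BddAbove D := ⟨M, fun x hx => hx.2.2⟩
    have hDb : BddBelow D := ⟨-M, fun x hx => hx.2.1.le⟩
    set a := sInf D
    set b := sSup D
    have hab : a ≤ b := csInf_le_csSup hne hDb hDa
    have hsub1 : D ⊆ Icc a b := subset_Icc_csInf_csSup hDb hDa
    have hsub2 : Ioo a b ⊆ D := fun x hx => by
      obtain ⟨s, hs, hs'⟩ := exists_lt_of_csInf_lt hne hx.1
      obtain ⟨t, ht, ht'⟩ := exists_lt_of_lt_csSup hne hx.2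
      exact hDo.out hs ht ⟨hs'.le, ht'.le⟩
    have hae : D =ᵐ[volume] Ioc a b := by
      refine Filter.EventuallyEq.trans (g := (Icc a b : Set ℝ)) ?_ Ioc_ae_eq_Icc.symm
      exact (LE.le.eventuallyLE hsub1).antisymm
        (Ioo_ae_eq_Icc.symm.le.trans (LE.le.eventuallyLE hsub2))
    rw [setIntegral_congr_set hae, ← intervalIntegral.integral_of_le hab, ← hg.2]
    have hcl : ∀ x ∈ closure D, 0 ≤ g x := fun x hx =>
      closure_minimal (fun y hy => (hUg y (hCU n hy.1)).le) (isClosed_Ici.preimage hgc) hx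
    have hga := hcl a (csInf_mem_closure hne hDb)
    suffices g b ≤ |g M| by linarith
    have hbM : b ≤ M := csSup_le hne fun x hx => hx.2.2
    rcases hbM.eq_or_lt with h' | h'
    · rw [h']; exact le_abs_self _
    refine le_trans ?_ (abs_nonneg _)
    by_contra hgb
    obtain ⟨ε, hε, hb⟩ := hright b (not_le.1 hgb)
    obtain ⟨s, hs, hs'⟩ := exists_lt_of_lt_csSup hne (show b - ε < b by linarith)
    have hsb : s ≤ b := le_csSup hDa hs
    set r := min M (b + ε)
    have hbr : b < r := lt_min h' (by linarith)
    have hr : r ∈ D := by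
      refine ⟨hCmax n s hs.1 r ?_ (by linarith), ?_, min_le_left _ _⟩
      · exact hfw' s (hCU n hs.1) r fun t ht =>
          hb t ⟨by linarith [ht.1], ht.2.trans (min_le_right _ _)⟩
      · linarith [hs.2.1]
    exact absurd (le_csSup hDa hr) (not_le.2 hbr)
  have hCle : ∀ n, ∫ x in C n, p x ≤ 0 := by
    intro n
    have hmono : Monotone fun k : ℕ => C n ∩ Ioc (-(k : ℝ)) k := fun i j hij => by
      have : (i : ℝ) ≤ j := by exact_mod_cast hij
      exact inter_subset_inter_right _ (Ioc_subset_Ioc (by linarith) this)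
    have hlim := tendsto_setIntegral_of_monotone (μ := volume) (f := p)
      (fun k : ℕ => (hCm n).inter measurableSet_Ioc) hmono hp.integrableOn
    have hU : ⋃ k : ℕ, C n ∩ Ioc (-(k : ℝ)) k = C n := by
      rw [← inter_iUnion]
      refine inter_eq_left.2 fun x _ => ?_
      obtain ⟨k, hk⟩ := exists_nat_gt |x|
      rw [abs_lt] at hk
      exact mem_iUnion.2 ⟨k, hk.1, hk.2.le⟩
    rw [hU] at hlim
    have hlim2 : Tendsto (fun k : ℕ => |g k|) atTop (𝓝 0) := by
      simpa using (htop.comp tendsto_natCast_atTop_atTop).abs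
    exact le_of_tendsto_of_tendsto hlim hlim2 (Eventually.of_forall fun k => htrunc n k)
  -- Two components coincide or are disjoint, so making the family disjoint only deletes
  -- repetitions.
  have hdis : ∀ n, disjointed C n = C n ∨ disjointed C n = ∅ := by
    intro n
    rw [disjointed_apply]
    by_cases hex : ∃ m < n, (C m ∩ C n).Nonempty
    · obtain ⟨m, hm, x, hx1, hx2⟩ := hex
      right
      have : C n ⊆ C m := fun y hy => by
        have h1 : x ∈ ordConnectedComponent U y := by
          rw [mem_ordConnectedComponent]
          exact ((hCo n).uIcc_subset hy hx2).trans (hCU n)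
        exact mem_ordConnectedComponent_trans hx1 (mem_ordConnectedComponent_comm.1 h1)
      refine sdiff_eq_bot_iff.2 ?_
      refine this.trans ?_
      exact Finset.le_sup (f := C) (Finset.mem_Iio.2 hm)
    · left
      rw [sdiff_eq_left, Finset.disjoint_sup_right]
      intro m hm
      rw [disjoint_iff_inter_eq_empty, inter_comm, ← not_nonempty_iff_eq_empty]
      exact fun h' => hex ⟨m, Finset.mem_Iio.1 hm, h'⟩
  have hsum := hasSum_integral_iUnion (μ := volume) (f := p) (s := disjointed C)
    (fun n => MeasurableSet.disjointed hCm n) (disjoint_disjointed C) hp.integrableOn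
  rw [iUnion_disjointed, hunion] at hsum
  refine hasSum_le (fun n => ?_) hsum hasSum_zero
  rcases hdis n with h | h
  · rw [h]; exact hCle n
  · rw [h, setIntegral_empty]

namespace IsFlux

variable {f z p g W : ℝ → ℝ} {L : ℝ}

/-- The set {z > 0} is only measurable; on {g > 0} it agrees a.e. with `upSet`, defined through the
continuous functions W and f. The case W = 0 is settled by W' = g - f z = 0 a.e. there, so that f z
= g > 0. -/
theorem setIntegral_pos_le (h : IsFlux f z p g W L) (hz0 : ∀ᵐ x, z x = 0 → W x = 0) :
    ∫ x in {x | 0 < z x ∧ 0 < g x}, p x ≤ 0 := by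
  have hae : ({x | 0 < z x ∧ 0 < g x} : Set ℝ) =ᵐ[volume] {x | 0 < g x ∧ x ∈ upSet f W} := by
    filter_upwards [h.pos, h.neg, hz0, h.antideriv_W.ae_eq_zero] with x h1 h2 h3 h4
    refine propext ⟨fun ⟨hz, hg⟩ => ⟨hg, ?_⟩, fun ⟨hg, hx⟩ => ⟨?_, hg⟩⟩
    · rcases (h1 hz).eq_or_lt with h5 | h5
      · refine Or.inr ⟨h5.symm, ?_⟩
        have := h4 h5.symm
        by_contra hf
        nlinarith [not_le.1 hf]
      · exact Or.inl h5
    · rcases hx with h5 | ⟨h5, h6⟩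
      · by_contra hz
        rcases (not_lt.1 hz).eq_or_lt with h7 | h7
        · exact h5.ne' (h3 h7)
        · exact absurd (h2 h7) (not_le.2 h5)
      · have := h4 h5
        by_contra hz
        nlinarith [not_lt.1 hz]
  rw [setIntegral_congr_set hae]
  refine setIntegral_nonpos_of_forward h.antideriv_g h.int_p h.tendsto_top (fun x hx => hx.1) ?_
  intro x hx y hxy hg
  exact ⟨hg y ⟨hxy, le_rfl⟩, h.upSet_forward hxy hg hx.2⟩

/-- The Kato inequality. -/
theorem kato (h : IsFlux f z p g W L) (hz0 : ∀ᵐ x, z x = 0 → W x = 0) :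
    ∫ x in {x | 0 < z x}, p x ≤ 0 := by
  -- Split {z > 0} by the sign of g: the first two parts are the lemma and its reflection, and on {g
  -- = 0} the density p = g' vanishes a.e.
  have hpos := h.setIntegral_pos_le hz0
  have hneg := h.reflect.setIntegral_pos_le
    ((Measure.measurePreserving_neg (volume : Measure ℝ)).quasiMeasurePreserving.ae hz0)
  have e1 : ∫ x in {x | 0 < z (-x) ∧ 0 < -g (-x)}, p (-x)
      = ∫ x in {x | 0 < z x ∧ g x < 0}, p x := by
    have := (Measure.measurePreserving_neg (volume : Measure ℝ)).setIntegral_preimage_emb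
      (Homeomorph.neg ℝ).measurableEmbedding p {x | 0 < z x ∧ g x < 0}
    rw [← this]
    simp
  rw [e1] at hneg
  have hgc := h.antideriv_g.continuous
  have hm1 : MeasurableSet {x | 0 < g x} := measurableSet_lt measurable_const hgc.measurable
  have hm2 : MeasurableSet {x | g x < 0} := measurableSet_lt hgc.measurable measurable_const
  have d1 : ∫ x in {x | 0 < z x}, p x
      = (∫ x in {x | 0 < z x} ∩ {x | 0 < g x}, p x)
        + ∫ x in {x | 0 < z x} \ {x | 0 < g x}, p x :=
    (integral_inter_add_sdiff hm1 h.int_p.integrableOn).symm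
  have d2 : ∫ x in {x | 0 < z x} \ {x | 0 < g x}, p x
      = (∫ x in ({x | 0 < z x} \ {x | 0 < g x}) ∩ {x | g x < 0}, p x)
        + ∫ x in ({x | 0 < z x} \ {x | 0 < g x}) \ {x | g x < 0}, p x :=
    (integral_inter_add_sdiff hm2 h.int_p.integrableOn).symm
  have e2 : ({x | 0 < z x} \ {x | 0 < g x}) ∩ {x | g x < 0} = {x | 0 < z x ∧ g x < 0} := by
    ext x; simp only [mem_inter_iff, Set.mem_sdiff, mem_ofPred_eq, not_lt]
    constructor
    · rintro ⟨⟨h1, _⟩, h2⟩; exact ⟨h1, h2⟩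
    · rintro ⟨h1, h2⟩; exact ⟨⟨h1, h2.le⟩, h2⟩
  have e3 : ∫ x in ({x | 0 < z x} \ {x | 0 < g x}) \ {x | g x < 0}, p x = 0 := by
    refine setIntegral_eq_zero_of_ae_eq_zero ?_
    filter_upwards [h.antideriv_g.ae_eq_zero] with x hx hxm
    exact hx (le_antisymm (not_lt.1 hxm.1.2) (not_lt.1 hxm.2))
  rw [d1, d2, e2, e3]
  exact add_nonpos hpos (by rwa [add_zero])

end IsFlux

end DegenerateFP

namespace DegenerateFP

/-! ### From the weak formulation to fluxes -/

/-- A drift coefficient of class `C²`, bounded together with its derivative. -/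
structure IsDrift (f : ℝ → ℝ) (c₀ c₁ : ℝ) : Prop where
  contDiff : ContDiff ℝ 2 f
  bdd : ∀ x, |f x| ≤ c₀
  bdd_deriv : ∀ x, |deriv f x| ≤ c₁

namespace IsDrift

variable {f : ℝ → ℝ} {c₀ c₁ : ℝ}

theorem continuous (h : IsDrift f c₀ c₁) : Continuous f := h.contDiff.continuous

theorem continuous_deriv (h : IsDrift f c₀ c₁) : Continuous (deriv f) :=
  h.contDiff.continuous_deriv (by norm_num)

theorem hasDerivAt (h : IsDrift f c₀ c₁) (x : ℝ) : HasDerivAt f (deriv f x) x :=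
  (h.contDiff.differentiable (by norm_num)).differentiableAt.hasDerivAt

theorem lip (h : IsDrift f c₀ c₁) (a b : ℝ) : |f a - f b| ≤ c₁ * |a - b| := by
  have := Convex.norm_image_sub_le_of_norm_deriv_le (f := f) (s := univ) (C := c₁) (x := b) (y := a)
    (fun x _ => (h.hasDerivAt x).differentiableAt) (fun x _ => h.bdd_deriv x) convex_univ
    (mem_univ _) (mem_univ _)
  exact this

theorem nonneg₀ (h : IsDrift f c₀ c₁) : 0 ≤ c₀ := (abs_nonneg _).trans (h.bdd 0)

theorem nonneg₁ (h : IsDrift f c₀ c₁) : 0 ≤ c₁ := (abs_nonneg _).trans (h.bdd_deriv 0)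

theorem integrable_mul (h : IsDrift f c₀ c₁) {z : ℝ → ℝ} (hz : Integrable z) :
    Integrable fun x => f x * z x :=
  hz.bdd_mul h.continuous.aestronglyMeasurable (Eventually.of_forall h.bdd)

theorem integrable_deriv_mul (h : IsDrift f c₀ c₁) {z : ℝ → ℝ} (hz : Integrable z) :
    Integrable fun x => deriv f x * z x :=
  hz.bdd_mul h.continuous_deriv.aestronglyMeasurable (Eventually.of_forall h.bdd_deriv)

theorem deriv_mul (h : IsDrift f c₀ c₁) {φ : ℝ → ℝ} {x : ℝ} (hφ : DifferentiableAt ℝ φ x) :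
    deriv (fun t => f t * φ t) x = deriv f x * φ x + f x * deriv φ x :=
  ((h.hasDerivAt x).mul hφ.hasDerivAt).deriv

end IsDrift

/-- A primitive of `g - q` with `q` integrable and `g` having a nonzero limit at `+∞` cannot have
subquadratic growth in terms of an integrable function. -/
theorem limit_eq_zero_of_growth {W g q ρ : ℝ → ℝ} {c C : ℝ} (hW : IsAntideriv W fun x => g x - q x)
    (hgc : Continuous g) (hq : Integrable q) (hg : Tendsto g atTop (𝓝 c)) (hρ : Integrable ρ)
    (hC : ∀ᵐ x, |W x| ≤ C * (1 + ρ x ^ 2)) : c = 0 := by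
  by_contra hne
  wlog hc : 0 < c generalizing W g q c
  · refine this (W := fun x => -W x) (g := fun x => -g x) (q := fun x => -q x) (c := -c)
      ?_ hgc.neg hq.neg hg.neg (by simpa using hC) (by simpa using hne) ?_
    · refine cast ?_ hW.neg
      congr 1; funext x; ring
    · have := lt_of_le_of_ne (not_lt.1 hc) hne
      linarith
  obtain ⟨x₀, hx₀⟩ := eventually_atTop.1 (hg.eventually_const_lt (show c / 2 < c by linarith))
  have hlow : ∀ x ≥ x₀, W x₀ + (x - x₀) * (c / 2) - ∫ t, |q t| ≤ W x := by
    intro x hx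
    have h1 := hW.2 x₀ x
    have ig : IntervalIntegrable g volume x₀ x := hgc.intervalIntegrable _ _
    rw [intervalIntegral.integral_sub ig hq.intervalIntegrable] at h1
    have h2 : (x - x₀) * (c / 2) ≤ ∫ t in x₀..x, g t := by
      have := intervalIntegral.integral_mono_on hx (intervalIntegrable_const (c := c / 2)) ig
        fun s hs => (hx₀ s hs.1).le
      rwa [intervalIntegral.integral_const, smul_eq_mul] at this
    have h3 : ∫ t in x₀..x, q t ≤ ∫ t, |q t| := by
      rw [intervalIntegral.integral_of_le hx]
      refine (le_abs_self _).trans (abs_integral_le_integral_abs.trans ?_)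
      exact setIntegral_le_integral hq.abs (Eventually.of_forall fun t => abs_nonneg _)
    linarith
  -- Beyond `x₁`, W ≥ 2|C| + 1, whereas C (1 + ρ²) ≤ 2|C| where |ρ| < 1. So |ρ| ≥ 1 on a half-line,
  -- impossible for an integrable function.
  set x₁ := max x₀ (x₀ + (2 * |C| + 1 + (∫ t, |q t|) - W x₀) / (c / 2))
  have hbig : ∀ x ≥ x₁, 2 * |C| + 1 ≤ W x := by
    intro x hx
    have h1 := hlow x ((le_max_left _ _).trans hx)
    have h2 : (2 * |C| + 1 + (∫ t, |q t|) - W x₀) / (c / 2) ≤ x - x₀ := by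
      have : x₀ + _ ≤ x := (le_max_right _ _).trans hx
      linarith
    rw [div_le_iff₀ (by linarith)] at h2
    linarith
  have hfin : volume {x | (1 : ℝ) ≤ ‖ρ x‖} < ⊤ := hρ.measure_norm_ge_lt_top one_pos
  have hsub : ∀ᵐ x, x ∈ Ici x₁ → x ∈ {x | (1 : ℝ) ≤ ‖ρ x‖} := by
    filter_upwards [hC] with x hx hx₁
    by_contra h1
    have h2 : ρ x ^ 2 ≤ 1 := by
      have : |ρ x| < 1 := not_le.1 h1
      rw [← sq_abs]
      nlinarith [abs_nonneg (ρ x)]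
    have h3 := hbig x hx₁
    have h4 : C * (1 + ρ x ^ 2) ≤ |C| * 2 :=
      mul_le_mul (le_abs_self C) (by linarith) (by positivity) (abs_nonneg _)
    have := le_abs_self (W x)
    linarith
  have h5 : volume (Ici x₁) ≤ volume {x | (1 : ℝ) ≤ ‖ρ x‖} := measure_mono_ae hsub
  rw [Real.volume_Ici] at h5
  exact absurd hfin (not_lt.2 h5)

end DegenerateFP

namespace DegenerateFP

/-- `W` and `g` represent the solution of `-w'' - f z' = v` in flux form. -/
structure FluxRep (f z v w g W : ℝ → ℝ) : Prop where
  ae_eq : ∀ᵐ x, W x = w x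
  antideriv_g : IsAntideriv g fun x => deriv f x * z x - v x
  antideriv_W : IsAntideriv W fun x => g x - f x * z x
  tendsto_top : Tendsto g atTop (𝓝 0)
  tendsto_bot : Tendsto g atBot (𝓝 0)

/-- Integrating twice: let g₀ be a primitive of f' z - v and K one of f z - g₀. Then w + K has zero
second distributional derivative and is a.e. affine, c x + d. So W = c x + d - K and g = g₀ + c. The
growth bound forces both limits of g to vanish, the one at -∞ by reflection. -/
theorem exists_fluxRep {f : ℝ → ℝ} {c₀ c₁ : ℝ} (hf : IsDrift f c₀ c₁) {z v w ρ : ℝ → ℝ} {C : ℝ}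
    (hz : Integrable z) (hv : Integrable v) (hw : LocallyIntegrable w volume)
    (heq : ∀ φ, IsTestFun φ → ∫ x, v x * φ x =
      -(∫ x, w x * iteratedDeriv 2 φ x) - -(∫ x, z x * deriv (fun t => f t * φ t) x))
    (hρ : Integrable ρ) (hC : ∀ᵐ x, |w x| ≤ C * (1 + ρ x ^ 2)) :
    ∃ g W, FluxRep f z v w g W := by
  have hp : Integrable fun x => deriv f x * z x - v x := (hf.integrable_deriv_mul hz).sub hv
  have hfz := hf.integrable_mul hz
  have hg₀ := IsAntideriv.integral hp.locallyIntegrable 0 0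
  set g₀ : ℝ → ℝ := fun x => 0 + ∫ t in (0 : ℝ)..x, (deriv f t * z t - v t) with hg₀def
  have hk : LocallyIntegrable (fun x => f x * z x - g₀ x) volume :=
    hfz.locallyIntegrable.sub hg₀.continuous.locallyIntegrable
  have hK := IsAntideriv.integral hk 0 0
  set K : ℝ → ℝ := fun x => 0 + ∫ t in (0 : ℝ)..x, (f t * z t - g₀ t) with hKdef
  have hKl := hK.continuous.locallyIntegrable (μ := volume)
  obtain ⟨c, d, hcd⟩ := ae_eq_affine_of_integral_mul_iteratedDeriv (hw.add hKl) fun φ hφ => by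
    have h1 : ∫ x, K x * iteratedDeriv 2 φ x = -∫ x, (f x * z x - g₀ x) * deriv φ x := by
      rw [iteratedDeriv_two]
      exact hK.integral_mul_deriv (hφ.deriv.1.of_le (by simp)) hφ.deriv.2
    have h2 := hg₀.integral_mul_deriv (hφ.1.of_le (by simp)) hφ.2
    have i1 := hφ.deriv.integrable_mul hfz.locallyIntegrable
    have i2 := hφ.deriv.integrable_mul (hg₀.continuous.locallyIntegrable (μ := volume))
    have i3 := hφ.integrable_mul (hf.integrable_deriv_mul hz).locallyIntegrable
    have i4 := hφ.integrable_mul hv.locallyIntegrable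
    have h3 : ∫ x, (f x * z x - g₀ x) * deriv φ x
        = (∫ x, f x * z x * deriv φ x) - ∫ x, g₀ x * deriv φ x := by
      rw [← integral_sub i1 i2]; simp_rw [sub_mul]
    have h4 : ∫ x, (deriv f x * z x - v x) * φ x
        = (∫ x, deriv f x * z x * φ x) - ∫ x, v x * φ x := by
      rw [← integral_sub i3 i4]; simp_rw [sub_mul]
    have h5 : ∫ x, z x * deriv (fun t => f t * φ t) x
        = (∫ x, deriv f x * z x * φ x) + ∫ x, f x * z x * deriv φ x := by
      rw [← integral_add i3 i1]
      refine integral_congr_ae (Eventually.of_forall fun x => ?_)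
      simp only
      rw [hf.deriv_mul (hφ.1.differentiable (by simp)).differentiableAt]; ring
    have h6 : ∫ x, (w + K) x * iteratedDeriv 2 φ x
        = (∫ x, w x * iteratedDeriv 2 φ x) + ∫ x, K x * iteratedDeriv 2 φ x := by
      rw [iteratedDeriv_two, ← integral_add (hφ.deriv.deriv.integrable_mul hw)
        (hφ.deriv.deriv.integrable_mul hKl)]
      simp_rw [Pi.add_apply, add_mul]
    have h7 := heq φ hφ
    rw [h6, h1, h3, h2, h4]
    rw [h5] at h7
    linarith
  have hg := IsAntideriv.integral hp.locallyIntegrable 0 c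
  set g : ℝ → ℝ := fun x => c + ∫ t in (0 : ℝ)..x, (deriv f t * z t - v t) with hgdef
  have hlin : IsAntideriv (fun x : ℝ => c * x + d) (fun _ => c) :=
    ⟨locallyIntegrable_const _, fun a b => by simp; ring⟩
  have hW : IsAntideriv (fun x => c * x + d - K x) fun x => g x - f x * z x := by
    refine cast ?_ (hlin.sub hK)
    congr 1; funext x
    simp only [hgdef, hg₀def]; ring
  have hWw : ∀ᵐ x, c * x + d - K x = w x := by
    filter_upwards [hcd] with x hx
    simp only [Pi.add_apply] at hx
    linarith
  have hgrow : ∀ᵐ x, |c * x + d - K x| ≤ C * (1 + ρ x ^ 2) := by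
    filter_upwards [hWw, hC] with x h1 h2
    rwa [h1]
  have htop : Tendsto g atTop (𝓝 (c + ∫ x in Ioi 0, (deriv f x * z x - v x))) :=
    (intervalIntegral_tendsto_integral_Ioi 0 hp.integrableOn tendsto_id).const_add c
  have hbot : Tendsto g atBot (𝓝 (c - ∫ x in Iic 0, (deriv f x * z x - v x))) := by
    have := (intervalIntegral_tendsto_integral_Iic 0 hp.integrableOn tendsto_id).const_sub c
    refine this.congr fun x => ?_
    simp only [hgdef, id]
    rw [intervalIntegral.integral_symm 0 x]; ring
  have h0 := limit_eq_zero_of_growth hW hg.continuous hfz htop hρ hgrow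
  have h0' : -(c - ∫ x in Iic 0, (deriv f x * z x - v x)) = 0 := by
    refine limit_eq_zero_of_growth (W := fun x => c * (-x) + d - K (-x)) (g := fun x => -g (-x))
      (q := fun x => -(f (-x) * z (-x))) (ρ := fun x => ρ (-x)) (C := C) ?_
      (hg.continuous.comp continuous_neg).neg hfz.comp_neg.neg
      (hbot.comp tendsto_neg_atTop_atBot).neg hρ.comp_neg
      ((Measure.measurePreserving_neg (volume : Measure ℝ)).quasiMeasurePreserving.ae hgrow)
    refine cast ?_ hW.comp_neg
    congr 1; funext x; ring
  refine ⟨g, _, hWw, hg, hW, ?_, ?_⟩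
  · rwa [h0] at htop
  · rwa [neg_eq_zero.1 h0'] at hbot

/-! ### The operator for a general nonlinearity -/

/-- The operator `y ↦ -(β(x, y))'' - f y'` in `L¹(ℝ)`. -/
def opB (β : ℝ → ℝ → ℝ) (f : ℝ → ℝ) (y : L1R) : Set L1R :=
  {v | LocallyIntegrable (fun x => β x (y x)) volume ∧
    ∀ φ : ℝ → ℝ, IsTestFun φ →
      ∫ x, v x * φ x =
        -(∫ x, β x (y x) * iteratedDeriv 2 φ x)
          - -(∫ x, y x * deriv (fun t => f t * φ t) x)}

/-- Nonlinearities which are nondecreasing and of at most quadratic growth. -/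
structure IsNonlin (β : ℝ → ℝ → ℝ) (C : ℝ) : Prop where
  mono : ∀ x, Monotone (β x)
  growth : ∀ x r, |β x r| ≤ C * (1 + r ^ 2)

theorem IsNonlin.nonneg {β : ℝ → ℝ → ℝ} {C : ℝ} (h : IsNonlin β C) : 0 ≤ C := by
  simpa using (abs_nonneg _).trans (h.growth 0 0)

variable {β : ℝ → ℝ → ℝ} {C : ℝ} {f : ℝ → ℝ} {c₀ c₁ : ℝ}

theorem integrable_L1R (y : L1R) : Integrable (fun x => y x) := L1.integrable_coeFn y

theorem opB_sub_eq (hf : IsDrift f c₀ c₁) {y₁ y₂ v₁ v₂ : L1R}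
    (h₁ : v₁ ∈ opB β f y₁) (h₂ : v₂ ∈ opB β f y₂) {φ : ℝ → ℝ} (hφ : IsTestFun φ) :
    ∫ x, (v₁ x - v₂ x) * φ x =
      -(∫ x, (β x (y₁ x) - β x (y₂ x)) * iteratedDeriv 2 φ x)
        - -(∫ x, (y₁ x - y₂ x) * deriv (fun t => f t * φ t) x) := by
  have hi : ∀ y : L1R, Integrable fun x => y x * deriv (fun t => f t * φ t) x := fun y => by
    have i1 := hφ.integrable_mul (hf.integrable_deriv_mul (integrable_L1R y)).locallyIntegrable
    have i2 := hφ.deriv.integrable_mul (hf.integrable_mul (integrable_L1R y)).locallyIntegrable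
    refine (i1.add i2).congr (Eventually.of_forall fun x => ?_)
    simp only [Pi.add_apply]
    rw [hf.deriv_mul (hφ.1.differentiable (by simp)).differentiableAt]; ring
  have e := h₁.2 φ hφ
  have e' := h₂.2 φ hφ
  simp_rw [sub_mul]
  rw [integral_sub (hφ.integrable_mul (integrable_L1R v₁).locallyIntegrable)
      (hφ.integrable_mul (integrable_L1R v₂).locallyIntegrable),
    integral_sub (hi y₁) (hi y₂), iteratedDeriv_two,
    integral_sub (hφ.deriv.deriv.integrable_mul h₁.1) (hφ.deriv.deriv.integrable_mul h₂.1),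
    ← iteratedDeriv_two, e, e']
  ring

/-- Quadratic growth bounds the difference of the nonlinear terms by 2C(1 + ρ²) with ρ = |y₁| + |y₂|
integrable; this is the condition that makes the flux vanish at infinity. -/
theorem exists_fluxRep_sub (hβ : IsNonlin β C) (hf : IsDrift f c₀ c₁) {y₁ y₂ v₁ v₂ : L1R}
    (h₁ : v₁ ∈ opB β f y₁) (h₂ : v₂ ∈ opB β f y₂) :
    ∃ g W, FluxRep f (fun x => y₁ x - y₂ x) (fun x => v₁ x - v₂ x)
      (fun x => β x (y₁ x) - β x (y₂ x)) g W := by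
  refine exists_fluxRep hf (ρ := fun x => |y₁ x| + |y₂ x|) (C := 2 * C)
    ((integrable_L1R y₁).sub (integrable_L1R y₂)) ((integrable_L1R v₁).sub (integrable_L1R v₂))
    (h₁.1.sub h₂.1) (fun φ hφ => opB_sub_eq hf h₁ h₂ hφ)
    ((integrable_L1R y₁).abs.add (integrable_L1R y₂).abs) (Eventually.of_forall fun x => ?_)
  have a1 := hβ.growth x (y₁ x)
  have a2 := hβ.growth x (y₂ x)
  have a3 := abs_sub (β x (y₁ x)) (β x (y₂ x))
  have a4 : 0 ≤ C * (|y₁ x| * |y₂ x|) := by have := hβ.nonneg; positivity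
  have a5 := sq_abs (y₁ x)
  have a6 := sq_abs (y₂ x)
  have a7 : 0 ≤ C * (|y₁ x| ^ 2 + |y₂ x| ^ 2) := by have := hβ.nonneg; positivity
  rw [← a5] at a1
  rw [← a6] at a2
  nlinarith

/-- Monotonicity of `β x` gives W the sign of z, and z = 0 gives W = 0, whatever the flat parts of
`β x`. -/
theorem kato_opB (hβ : IsNonlin β C) (hf : IsDrift f c₀ c₁) {y₁ y₂ v₁ v₂ : L1R}
    (h₁ : v₁ ∈ opB β f y₁) (h₂ : v₂ ∈ opB β f y₂) :
    ∫ x in {x | 0 < y₁ x - y₂ x}, (deriv f x * (y₁ x - y₂ x) - (v₁ x - v₂ x)) ≤ 0 := by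
  obtain ⟨g, W, h⟩ := exists_fluxRep_sub hβ hf h₁ h₂
  have hz := (integrable_L1R y₁).sub (integrable_L1R y₂)
  have hv := (integrable_L1R v₁).sub (integrable_L1R v₂)
  have hF : IsFlux f (fun x => y₁ x - y₂ x)
      (fun x => deriv f x * (y₁ x - y₂ x) - (v₁ x - v₂ x)) g W c₁ :=
    { lip := hf.lip
      int_z := hz
      int_p := (hf.integrable_deriv_mul hz).sub hv
      antideriv_g := h.antideriv_g
      antideriv_W := h.antideriv_W
      tendsto_top := h.tendsto_top
      tendsto_bot := h.tendsto_bot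
      pos := by
        filter_upwards [h.ae_eq] with x hx hlt
        rw [hx]
        exact sub_nonneg.2 (hβ.mono x (sub_pos.1 hlt).le)
      neg := by
        filter_upwards [h.ae_eq] with x hx hlt
        rw [hx]
        exact sub_nonpos.2 (hβ.mono x (sub_neg.1 hlt).le) }
  refine hF.kato ?_
  filter_upwards [h.ae_eq] with x hx h0
  rw [hx, sub_eq_zero.1 h0, sub_self]

/-- Comparison principle. -/
theorem ae_le_of_opB (hβ : IsNonlin β C) (hf : IsDrift f c₀ c₁) {y₁ y₂ v₁ v₂ : L1R}
    (h₁ : v₁ ∈ opB β f y₁) (h₂ : v₂ ∈ opB β f y₂) {μ : ℝ} (hμ : c₁ < μ)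
    (hle : ∀ᵐ x, μ * y₁ x + v₁ x ≤ μ * y₂ x + v₂ x) : ∀ᵐ x, y₁ x ≤ y₂ x := by
  have hz := (integrable_L1R y₁).sub (integrable_L1R y₂)
  have hv := (integrable_L1R v₁).sub (integrable_L1R v₂)
  have k := kato_opB hβ hf h₁ h₂
  set S := {x | 0 < y₁ x - y₂ x}
  have hS : MeasurableSet S := measurableSet_lt measurable_const
    ((Lp.stronglyMeasurable y₁).sub (Lp.stronglyMeasurable y₂)).measurable
  -- On `S` the hypothesis gives v₂ - v₁ ≥ μ (y₁ - y₂), and f' ≥ -c₁; the Kato inequality then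
  -- annihilates the positive part of y₁ - y₂.
  have h3 : ∫ x in S, (μ - c₁) * (y₁ x - y₂ x)
      ≤ ∫ x in S, (deriv f x * (y₁ x - y₂ x) - (v₁ x - v₂ x)) := by
    refine setIntegral_mono_on_ae (hz.const_mul _).integrableOn
      ((hf.integrable_deriv_mul hz).sub hv).integrableOn hS ?_
    filter_upwards [hle] with x hx hxS
    have := (abs_le.1 (hf.bdd_deriv x)).1
    have hxS' : 0 < y₁ x - y₂ x := hxS
    nlinarith
  have h4 : 0 ≤ᵐ[volume.restrict S] fun x => (μ - c₁) * (y₁ x - y₂ x) := by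
    refine (ae_restrict_iff' hS).2 (Eventually.of_forall fun x hx => ?_)
    exact mul_nonneg (by linarith) (le_of_lt hx)
  have h5 := (setIntegral_eq_zero_iff_of_nonneg_ae h4 (hz.const_mul _).integrableOn).1
    (le_antisymm (h3.trans k) (integral_nonneg_of_ae h4))
  have h6 := (ae_restrict_iff' hS).1 h5
  filter_upwards [h6] with x hx
  by_contra hlt
  have hxS : 0 < y₁ x - y₂ x := by linarith
  have := hx hxS
  simp only [Pi.zero_apply, mul_eq_zero] at this
  rcases this with h | h <;> linarith

/-- Integration against the sign of `z`, as a functional on `L¹`. -/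
theorem exists_signFunctional (z : L1R) :
    ∃ η : StrongDual ℝ L1R, ‖η‖ ≤ 1 ∧
      ∀ v : L1R, η v = (∫ x in {x | 0 < z x}, v x) - ∫ x in {x | z x < 0}, v x := by
  have hzm := (Lp.stronglyMeasurable z).measurable
  have hP : MeasurableSet {x | 0 < z x} := measurableSet_lt measurable_const hzm
  have hN : MeasurableSet {x | z x < 0} := measurableSet_lt hzm measurable_const
  let L : L1R →ₗ[ℝ] ℝ :=
    { toFun := fun v => (∫ x in {x | 0 < z x}, v x) - ∫ x in {x | z x < 0}, v x
      map_add' := fun v w => by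
        have e : ∀ S : Set ℝ, ∫ x in S, (v + w) x = (∫ x in S, v x) + ∫ x in S, w x := fun S => by
          rw [← integral_add (integrable_L1R v).integrableOn (integrable_L1R w).integrableOn]
          exact integral_congr_ae (ae_restrict_of_ae (Lp.coeFn_add v w))
        simp only [e]; ring
      map_smul' := fun c v => by
        have e : ∀ S : Set ℝ, ∫ x in S, (c • v) x = c * ∫ x in S, v x := fun S => by
          rw [← integral_const_mul]
          exact integral_congr_ae (ae_restrict_of_ae (Lp.coeFn_smul c v))
        simp only [e, smul_eq_mul, RingHom.id_apply]; ring }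
  refine ⟨L.mkContinuous 1 fun v => ?_, L.mkContinuous_norm_le zero_le_one _, fun v => rfl⟩
  have hd : Disjoint {x | 0 < z x} {x | z x < 0} :=
    Set.disjoint_left.2 fun x (h1 : 0 < z x) (h2 : z x < 0) => lt_asymm h1 h2
  calc ‖L v‖ ≤ |∫ x in {x | 0 < z x}, v x| + |∫ x in {x | z x < 0}, v x| := abs_sub _ _
    _ ≤ (∫ x in {x | 0 < z x}, |v x|) + ∫ x in {x | z x < 0}, |v x| :=
        add_le_add abs_integral_le_integral_abs abs_integral_le_integral_abs
    _ = ∫ x in {x | 0 < z x} ∪ {x | z x < 0}, |v x| :=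
        (setIntegral_union hd hN (integrable_L1R v).abs.integrableOn
          (integrable_L1R v).abs.integrableOn).symm
    _ ≤ ∫ x, |v x| :=
        setIntegral_le_integral (integrable_L1R v).abs (Eventually.of_forall fun t => abs_nonneg _)
    _ = 1 * ‖v‖ := by rw [one_mul, L1.norm_eq_integral_norm]; rfl

/-- Apply the Kato inequality to (u₁, u₂) and to (u₂, u₁) and add: the integral of sign(z)(v₁ - v₂)
is at least that of f' |z|, hence at least -c₁ ‖z‖, which the shift compensates. The element of the
duality map is ‖z‖ sign z, with sign 0 = 0. -/
theorem isAccretive_opB (hβ : IsNonlin β C) (hf : IsDrift f c₀ c₁) :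
    IsAccretive (shift c₁ (opB β f)) := by
  rintro u₁ u₂ _ _ ⟨v₁, h₁, rfl⟩ ⟨v₂, h₂, rfl⟩
  obtain ⟨η, hη1, hη⟩ := exists_signFunctional (u₁ - u₂)
  set z := u₁ - u₂ with hz
  have hzm := (Lp.stronglyMeasurable z).measurable
  have hP : MeasurableSet {x | 0 < z x} := measurableSet_lt measurable_const hzm
  have hN : MeasurableSet {x | z x < 0} := measurableSet_lt hzm measurable_const
  have hzc : ∀ᵐ x, z x = u₁ x - u₂ x := Lp.coeFn_sub u₁ u₂
  have hvc : ∀ᵐ x, (v₁ - v₂) x = v₁ x - v₂ x := Lp.coeFn_sub v₁ v₂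
  have hnorm : η z = ‖z‖ := by
    have e1 : ∫ x in {x | 0 < z x}, z x = ∫ x, {x | 0 < z x}.indicator (fun x => z x) x :=
      (integral_indicator hP).symm
    have e2 : ∫ x in {x | z x < 0}, z x = ∫ x, {x | z x < 0}.indicator (fun x => z x) x :=
      (integral_indicator hN).symm
    rw [hη, e1, e2, ← integral_sub ((integrable_L1R z).indicator hP)
      ((integrable_L1R z).indicator hN), L1.norm_eq_integral_norm]
    refine integral_congr_ae (Eventually.of_forall fun x => ?_)
    simp only [indicator, mem_ofPred_eq, Real.norm_eq_abs]
    rcases lt_trichotomy (z x) 0 with h | h | h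
    · rw [if_neg h.not_gt, if_pos h, abs_of_neg h]; ring
    · simp [h]
    · rw [if_pos h, if_neg h.not_gt, abs_of_pos h]; ring
  have k1 : -(c₁ * ∫ x in {x | 0 < z x}, z x) ≤ ∫ x in {x | 0 < z x}, (v₁ - v₂) x := by
    have k := kato_opB hβ hf h₁ h₂
    have e : ({x | 0 < u₁ x - u₂ x} : Set ℝ) =ᵐ[volume] {x | 0 < z x} := by
      filter_upwards [hzc] with x hx
      exact propext (by change 0 < _ ↔ 0 < _; rw [hx])
    rw [setIntegral_congr_set e] at k
    have : ∫ x in {x | 0 < z x}, -c₁ * z x - (v₁ - v₂) x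
        ≤ ∫ x in {x | 0 < z x}, (deriv f x * (u₁ x - u₂ x) - (v₁ x - v₂ x)) := by
      refine setIntegral_mono_on_ae
        (((integrable_L1R z).const_mul _).sub (integrable_L1R _)).integrableOn
        ((hf.integrable_deriv_mul ((integrable_L1R u₁).sub (integrable_L1R u₂))).sub
          ((integrable_L1R v₁).sub (integrable_L1R v₂))).integrableOn hP ?_
      filter_upwards [hzc, hvc] with x hx hx' hxp
      have := (abs_le.1 (hf.bdd_deriv x)).1
      have hxp' : 0 < z x := hxp
      rw [← hx, hx']
      nlinarith
    rw [integral_sub ((integrable_L1R z).const_mul _).integrableOn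
      (integrable_L1R _).integrableOn, integral_const_mul] at this
    linarith
  have k2 : c₁ * (∫ x in {x | z x < 0}, z x) ≤ -∫ x in {x | z x < 0}, (v₁ - v₂) x := by
    have k := kato_opB hβ hf h₂ h₁
    have e : ({x | 0 < u₂ x - u₁ x} : Set ℝ) =ᵐ[volume] {x | z x < 0} := by
      filter_upwards [hzc] with x hx
      refine propext ?_
      change 0 < _ ↔ _ < 0
      rw [hx, sub_pos, sub_neg]
    rw [setIntegral_congr_set e] at k
    have : ∫ x in {x | z x < 0}, c₁ * z x + (v₁ - v₂) x
        ≤ ∫ x in {x | z x < 0}, (deriv f x * (u₂ x - u₁ x) - (v₂ x - v₁ x)) := by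
      refine setIntegral_mono_on_ae
        (((integrable_L1R z).const_mul _).add (integrable_L1R _)).integrableOn
        ((hf.integrable_deriv_mul ((integrable_L1R u₂).sub (integrable_L1R u₁))).sub
          ((integrable_L1R v₂).sub (integrable_L1R v₁))).integrableOn hN ?_
      filter_upwards [hzc, hvc] with x hx hx' hxp
      have := (abs_le.1 (hf.bdd_deriv x)).1
      have hxp' : z x < 0 := hxp
      rw [← neg_sub (u₁ x), ← hx, hx']
      nlinarith
    rw [integral_add ((integrable_L1R z).const_mul _).integrableOn
      (integrable_L1R _).integrableOn, integral_const_mul] at this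
    linarith
  have hη0 : 0 ≤ η (c₁ • z + (v₁ - v₂)) := by
    rw [map_add, map_smul, smul_eq_mul, hη z, hη (v₁ - v₂)]
    nlinarith
  refine ⟨‖z‖ • η, ⟨?_, ?_⟩, ?_⟩
  · rw [smul_apply, hnorm, smul_eq_mul, sq]
  · have h1 : ‖‖z‖ • η‖ = ‖z‖ * ‖η‖ := by rw [norm_smul, norm_norm]
    rcases (norm_nonneg z).eq_or_lt with h0 | h0
    · rw [h1, ← h0]; simp
    · have h2 : ‖z‖ ≤ ‖η‖ * ‖z‖ := by
        have := (le_abs_self _).trans (η.le_opNorm z)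
        rwa [hnorm] at this
      have h3 : ‖η‖ = 1 := le_antisymm hη1 (by nlinarith)
      rw [h1, h3, mul_one]
  · rw [smul_apply, smul_eq_mul]
    have e : c₁ • u₁ + v₁ - (c₁ • u₂ + v₂) = c₁ • z + (v₁ - v₂) := by
      rw [hz, smul_sub]; abel
    rw [e]
    exact mul_nonneg (norm_nonneg _) hη0

end DegenerateFP

namespace DegenerateFP

/-! ### Convolution operators on `L¹` and the one-sided exponential kernels -/

/-- Convolution of `p` with the kernel `k`. -/
def conv (k p : ℝ → ℝ) (x : ℝ) : ℝ := ∫ t, p t * k (x - t)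

section Conv

variable {k p q : ℝ → ℝ}

theorem conv_integrand (hk : Integrable k) (hp : Integrable p) :
    Integrable (fun z : ℝ × ℝ => p z.2 * k (z.1 - z.2)) (volume.prod volume) :=
  hp.convolution_integrand (ContinuousLinearMap.mul ℝ ℝ) hk

theorem integrable_conv (hk : Integrable k) (hp : Integrable p) : Integrable (conv k p) :=
  (conv_integrand hk hp).integral_prod_left

theorem integral_abs_conv_sub_le (hk : Integrable k) (hp : Integrable p) (hq : Integrable q) :
    ∫ x, |conv k p x - conv k q x| ≤ (∫ x, |k x|) * ∫ x, |p x - q x| := by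
  have h1 : ∀ᵐ x, |conv k p x - conv k q x| ≤ ∫ t, |p t - q t| * |k (x - t)| := by
    filter_upwards [(conv_integrand hk hp).prod_right_ae, (conv_integrand hk hq).prod_right_ae]
      with x hx hx'
    have e : conv k p x - conv k q x = ∫ t, (p t - q t) * k (x - t) := by
      rw [conv, conv, ← integral_sub hx hx']
      simp_rw [sub_mul]
    rw [e]
    refine abs_integral_le_integral_abs.trans (le_of_eq ?_)
    simp_rw [abs_mul]
  have hi := conv_integrand hk.abs (hp.sub hq).abs
  have h2 := integral_mono_ae ((integrable_conv hk hp).sub (integrable_conv hk hq)).abs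
    hi.integral_prod_left h1
  refine h2.trans (le_of_eq ?_)
  have e := integral_integral_swap (f := fun x t => |p t - q t| * |k (x - t)|) hi
  simp only [Pi.sub_apply] at e ⊢
  rw [e]
  simp_rw [integral_const_mul, integral_sub_right_eq_self (fun x => |k x|)]
  rw [integral_mul_const, mul_comm]

theorem integral_conv_mul (hk : Integrable k) (hp : Integrable p) {χ : ℝ → ℝ}
    (hχ : Continuous χ) (hc : HasCompactSupport χ) :
    ∫ x, conv k p x * χ x = ∫ t, p t * ∫ x, k (x - t) * χ x := by
  obtain ⟨M, hM⟩ := hχ.bounded_above_of_compact_support hc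
  have hi : Integrable (fun z : ℝ × ℝ => χ z.1 * (p z.2 * k (z.1 - z.2)))
      (volume.prod volume) :=
    (conv_integrand hk hp).bdd_mul (hχ.comp continuous_fst).aestronglyMeasurable
      (Eventually.of_forall fun z => hM z.1)
  have e1 : ∀ x, conv k p x * χ x = ∫ t, χ x * (p t * k (x - t)) := fun x => by
    rw [integral_const_mul, mul_comm, conv]
  simp_rw [e1]
  rw [integral_integral_swap hi]
  refine integral_congr_ae (Eventually.of_forall fun t => ?_)
  simp only
  rw [← integral_const_mul]
  refine integral_congr_ae (Eventually.of_forall fun x => ?_)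
  simp only; ring

end Conv

/-- The kernel `exp (-κ s) 1_{s > 0}`. -/
def kerR (κ : ℝ) : ℝ → ℝ := (Ioi (0 : ℝ)).indicator fun s => Real.exp (-κ * s)

/-- The kernel `exp (κ s) 1_{s ≤ 0}`. -/
def kerL (κ : ℝ) : ℝ → ℝ := (Iic (0 : ℝ)).indicator fun s => Real.exp (κ * s)

section Kernels

variable {κ : ℝ}

theorem integrable_kerR (hκ : 0 < κ) : Integrable (kerR κ) :=
  (integrable_indicator_iff measurableSet_Ioi).2 (integrableOn_exp_mul_Ioi (by linarith) 0)

theorem integrable_kerL (hκ : 0 < κ) : Integrable (kerL κ) :=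
  (integrable_indicator_iff measurableSet_Iic).2 (integrableOn_exp_mul_Iic hκ 0)

theorem integral_abs_kerR (hκ : 0 < κ) : ∫ x, |kerR κ x| = κ⁻¹ := by
  have : ∀ x, |kerR κ x| = kerR κ x := fun x =>
    abs_of_nonneg (indicator_nonneg (fun _ _ => (Real.exp_pos _).le) x)
  simp_rw [this]
  rw [kerR, integral_indicator measurableSet_Ioi, integral_exp_mul_Ioi (by linarith)]
  simp [neg_div_neg_eq]

theorem integral_abs_kerL (hκ : 0 < κ) : ∫ x, |kerL κ x| = κ⁻¹ := by
  have : ∀ x, |kerL κ x| = kerL κ x := fun x =>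
    abs_of_nonneg (indicator_nonneg (fun _ _ => (Real.exp_pos _).le) x)
  simp_rw [this]
  rw [kerL, integral_indicator measurableSet_Iic, integral_exp_mul_Iic hκ]
  simp

theorem hasDerivAt_test {φ : ℝ → ℝ} (hφ : IsTestFun φ) (x : ℝ) :
    HasDerivAt φ (deriv φ x) x :=
  (hφ.1.differentiable (by simp)).differentiableAt.hasDerivAt

/-- Tested against κ² φ - φ'', the two one-sided kernels give κ φ + φ' and κ φ - φ'. Their sum
isolates φ and their difference φ', which explains the weights 1/(2κ) and 1/2 in `helmholtz`. -/
theorem integral_kerR_mul {φ : ℝ → ℝ} (hφ : IsTestFun φ) (t : ℝ) :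
    ∫ x, kerR κ (x - t) * (κ ^ 2 * φ x - deriv (deriv φ) x) = κ * φ t + deriv φ t := by
  -- An explicit antiderivative of the integrand; vanishing at +∞, it contributes only through its
  -- value at `t`.
  set u : ℝ → ℝ := fun x => -(Real.exp (-κ * (x - t)) * (κ * φ x + deriv φ x))
  have hd : ∀ x, HasDerivAt u
      (Real.exp (-κ * (x - t)) * (κ ^ 2 * φ x - deriv (deriv φ) x)) x := fun x => by
    have e1 : HasDerivAt (fun x => Real.exp (-κ * (x - t)))
        (Real.exp (-κ * (x - t)) * (-κ * 1)) x :=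
      (((hasDerivAt_id x).sub_const t).const_mul (-κ)).exp
    have e2 := ((hasDerivAt_test hφ x).const_mul κ).add (hasDerivAt_test hφ.deriv x)
    refine (e1.mul e2).neg.congr_deriv ?_
    simp only [Pi.add_apply]; ring
  have hc : HasCompactSupport fun x => κ * φ x + deriv φ x :=
    hφ.2.mul_left.add hφ.2.deriv
  have hcu : HasCompactSupport u := hc.mul_left.neg
  have hcd : HasCompactSupport fun x => κ ^ 2 * φ x - deriv (deriv φ) x :=
    hφ.2.mul_left.sub hφ.2.deriv.deriv
  have hcont : Continuous fun x => κ ^ 2 * φ x - deriv (deriv φ) x :=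
    (continuous_const.mul hφ.1.continuous).sub hφ.deriv.deriv.1.continuous
  have hint : Integrable fun x => Real.exp (-κ * (x - t)) * (κ ^ 2 * φ x - deriv (deriv φ) x) :=
    ((by fun_prop : Continuous fun x : ℝ => Real.exp (-κ * (x - t))).mul
      hcont).integrable_of_hasCompactSupport hcd.mul_left
  have hlim : Tendsto u atTop (𝓝 0) := by
    refine tendsto_const_nhds.congr' ?_
    have := hcu.compl_mem_cocompact
    have h2 : ∀ᶠ x in atTop, x ∈ (tsupport u)ᶜ := atTop_le_cocompact this
    filter_upwards [h2] with x hx using (image_eq_zero_of_notMem_tsupport hx).symm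
  have e : ∀ x, kerR κ (x - t) * (κ ^ 2 * φ x - deriv (deriv φ) x)
      = (Ioi t).indicator
        (fun x => Real.exp (-κ * (x - t)) * (κ ^ 2 * φ x - deriv (deriv φ) x)) x := fun x => by
    simp only [kerR, indicator, mem_Ioi, sub_pos]
    split_ifs <;> simp
  simp_rw [e]
  rw [integral_indicator measurableSet_Ioi,
    integral_Ioi_of_hasDerivAt_of_tendsto' (fun x _ => hd x) hint.integrableOn hlim]
  simp [u]

theorem integral_kerL_mul {φ : ℝ → ℝ} (hφ : IsTestFun φ) (t : ℝ) :
    ∫ x, kerL κ (x - t) * (κ ^ 2 * φ x - deriv (deriv φ) x) = κ * φ t - deriv φ t := by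
  set u : ℝ → ℝ := fun x => Real.exp (κ * (x - t)) * (κ * φ x - deriv φ x)
  have hd : ∀ x, HasDerivAt u
      (Real.exp (κ * (x - t)) * (κ ^ 2 * φ x - deriv (deriv φ) x)) x := fun x => by
    have e1 : HasDerivAt (fun x => Real.exp (κ * (x - t)))
        (Real.exp (κ * (x - t)) * (κ * 1)) x :=
      (((hasDerivAt_id x).sub_const t).const_mul κ).exp
    have e2 := ((hasDerivAt_test hφ x).const_mul κ).sub (hasDerivAt_test hφ.deriv x)
    refine (e1.mul e2).congr_deriv ?_
    simp only [Pi.sub_apply]; ring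
  have hc : HasCompactSupport fun x => κ * φ x - deriv φ x :=
    hφ.2.mul_left.sub hφ.2.deriv
  have hcu : HasCompactSupport u := hc.mul_left
  have hcd : HasCompactSupport fun x => κ ^ 2 * φ x - deriv (deriv φ) x :=
    hφ.2.mul_left.sub hφ.2.deriv.deriv
  have hcont : Continuous fun x => κ ^ 2 * φ x - deriv (deriv φ) x :=
    (continuous_const.mul hφ.1.continuous).sub hφ.deriv.deriv.1.continuous
  have hint : Integrable fun x => Real.exp (κ * (x - t)) * (κ ^ 2 * φ x - deriv (deriv φ) x) :=
    ((by fun_prop : Continuous fun x : ℝ => Real.exp (κ * (x - t))).mul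
      hcont).integrable_of_hasCompactSupport hcd.mul_left
  have hlim : Tendsto u atBot (𝓝 0) := by
    refine tendsto_const_nhds.congr' ?_
    have := hcu.compl_mem_cocompact
    have h2 : ∀ᶠ x in atBot, x ∈ (tsupport u)ᶜ := atBot_le_cocompact this
    filter_upwards [h2] with x hx using (image_eq_zero_of_notMem_tsupport hx).symm
  have e : ∀ x, kerL κ (x - t) * (κ ^ 2 * φ x - deriv (deriv φ) x)
      = (Iic t).indicator
        (fun x => Real.exp (κ * (x - t)) * (κ ^ 2 * φ x - deriv (deriv φ) x)) x := fun x => by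
    simp only [kerL, indicator, mem_Iic, sub_nonpos]
    split_ifs <;> simp
  simp_rw [e]
  rw [integral_indicator measurableSet_Iic,
    integral_Iic_of_hasDerivAt_of_tendsto' (fun x _ => hd x) hint.integrableOn hlim]
  simp [u]

end Kernels

end DegenerateFP

namespace DegenerateFP

/-! ### The range condition for nondegenerate Lipschitz nonlinearities -/

/-- The solution `w ∈ L¹` of `κ² w - w'' = G + H'`. -/
def helmholtz (κ : ℝ) (G H : ℝ → ℝ) (x : ℝ) : ℝ :=
  conv (kerR κ) (fun t => G t / (2 * κ) - H t / 2) x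
    + conv (kerL κ) (fun t => G t / (2 * κ) + H t / 2) x

section Helmholtz

variable {κ : ℝ} {G H G' H' : ℝ → ℝ}

theorem integrable_helmholtz (hκ : 0 < κ) (hG : Integrable G) (hH : Integrable H) :
    Integrable (helmholtz κ G H) :=
  (integrable_conv (integrable_kerR hκ) ((hG.div_const _).sub (hH.div_const _))).add
    (integrable_conv (integrable_kerL hκ) ((hG.div_const _).add (hH.div_const _)))

theorem integral_helmholtz_mul (hκ : 0 < κ) (hG : Integrable G) (hH : Integrable H) {φ : ℝ → ℝ}
    (hφ : IsTestFun φ) :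
    ∫ x, helmholtz κ G H x * (κ ^ 2 * φ x - deriv (deriv φ) x)
      = (∫ x, G x * φ x) - ∫ x, H x * deriv φ x := by
  have hm : Integrable fun t => G t / (2 * κ) - H t / 2 := (hG.div_const _).sub (hH.div_const _)
  have hp : Integrable fun t => G t / (2 * κ) + H t / 2 := (hG.div_const _).add (hH.div_const _)
  have hcd : HasCompactSupport fun x => κ ^ 2 * φ x - deriv (deriv φ) x :=
    hφ.2.mul_left.sub hφ.2.deriv.deriv
  have hcont : Continuous fun x => κ ^ 2 * φ x - deriv (deriv φ) x :=
    (continuous_const.mul hφ.1.continuous).sub hφ.deriv.deriv.1.continuous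
  have e1 := integral_conv_mul (integrable_kerR hκ) hm hcont hcd
  have e2 := integral_conv_mul (integrable_kerL hκ) hp hcont hcd
  simp_rw [integral_kerR_mul hφ] at e1
  simp_rw [integral_kerL_mul hφ] at e2
  have hb : ∀ {u : ℝ → ℝ}, Integrable u →
      Integrable fun x => u x * (κ ^ 2 * φ x - deriv (deriv φ) x) := fun {u} hu => by
    obtain ⟨M, hM⟩ := hcont.bounded_above_of_compact_support hcd
    exact hu.mul_bdd hcont.aestronglyMeasurable (Eventually.of_forall hM)
  have hl : ∀ {u : ℝ → ℝ} (s : ℝ), Integrable u →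
      Integrable fun x => u x * (κ * φ x + s * deriv φ x) := fun {u} s hu => by
    refine (((hφ.integrable_mul hu.locallyIntegrable).const_mul κ).add
      ((hφ.deriv.integrable_mul hu.locallyIntegrable).const_mul s)).congr
      (Eventually.of_forall fun x => ?_)
    simp only [Pi.add_apply]; ring
  have hl1 := hl 1 hm
  have hl2 := hl (-1) hp
  simp only [one_mul, neg_one_mul, ← sub_eq_add_neg] at hl1 hl2
  simp_rw [helmholtz, add_mul]
  rw [integral_add (hb (integrable_conv (integrable_kerR hκ) hm))
    (hb (integrable_conv (integrable_kerL hκ) hp)), e1, e2, ← integral_add hl1 hl2,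
    ← integral_sub (hφ.integrable_mul hG.locallyIntegrable)
      (hφ.deriv.integrable_mul hH.locallyIntegrable)]
  refine integral_congr_ae (Eventually.of_forall fun x => ?_)
  simp only
  field_simp
  ring

/-- Each kernel has L¹ norm κ⁻¹. The resulting gains, κ⁻² on the source and κ⁻¹ on the divergence
term, allow a large κ to absorb the drift. -/
theorem integral_abs_helmholtz_sub_le (hκ : 0 < κ) (hG : Integrable G) (hH : Integrable H)
    (hG' : Integrable G') (hH' : Integrable H') :
    ∫ x, |helmholtz κ G H x - helmholtz κ G' H' x|
      ≤ (κ ^ 2)⁻¹ * (∫ x, |G x - G' x|) + κ⁻¹ * ∫ x, |H x - H' x| := by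
  have hm : ∀ {G H : ℝ → ℝ}, Integrable G → Integrable H →
    Integrable fun t => G t / (2 * κ) - H t / 2 := fun hG hH => (hG.div_const _).sub (hH.div_const _)
  have hp : ∀ {G H : ℝ → ℝ}, Integrable G → Integrable H →
    Integrable fun t => G t / (2 * κ) + H t / 2 := fun hG hH => (hG.div_const _).add (hH.div_const _)
  have b1 := integral_abs_conv_sub_le (integrable_kerR hκ) (hm hG hH) (hm hG' hH')
  have b2 := integral_abs_conv_sub_le (integrable_kerL hκ) (hp hG hH) (hp hG' hH')
  rw [integral_abs_kerR hκ] at b1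
  rw [integral_abs_kerL hκ] at b2
  have i1 := integrable_conv (integrable_kerR hκ) (hm hG hH)
  have i1' := integrable_conv (integrable_kerR hκ) (hm hG' hH')
  have i2 := integrable_conv (integrable_kerL hκ) (hp hG hH)
  have i2' := integrable_conv (integrable_kerL hκ) (hp hG' hH')
  have hsplit : ∫ x, |helmholtz κ G H x - helmholtz κ G' H' x|
      ≤ (∫ x, |conv (kerR κ) (fun t => G t / (2 * κ) - H t / 2) x
          - conv (kerR κ) (fun t => G' t / (2 * κ) - H' t / 2) x|)
        + ∫ x, |conv (kerL κ) (fun t => G t / (2 * κ) + H t / 2) x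
          - conv (kerL κ) (fun t => G' t / (2 * κ) + H' t / 2) x| := by
    have j1 : Integrable fun x => |conv (kerR κ) (fun t => G t / (2 * κ) - H t / 2) x
        - conv (kerR κ) (fun t => G' t / (2 * κ) - H' t / 2) x| := (i1.sub i1').abs
    have j2 : Integrable fun x => |conv (kerL κ) (fun t => G t / (2 * κ) + H t / 2) x
        - conv (kerL κ) (fun t => G' t / (2 * κ) + H' t / 2) x| := (i2.sub i2').abs
    rw [← integral_add j1 j2]
    refine integral_mono ((integrable_helmholtz hκ hG hH).sub (integrable_helmholtz hκ hG' hH')).abs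
      ((i1.sub i1').abs.add (i2.sub i2').abs) fun x => ?_
    simp only [helmholtz]
    rw [add_sub_add_comm]
    exact abs_add_le _ _
  have dG : Integrable fun x => |G x - G' x| := (hG.sub hG').abs
  have dH : Integrable fun x => |H x - H' x| := (hH.sub hH').abs
  have hbound : ∀ s : ℝ, |s| = 1 → ∀ x,
      |G x / (2 * κ) + s * (H x / 2) - (G' x / (2 * κ) + s * (H' x / 2))|
      ≤ (2 * κ)⁻¹ * |G x - G' x| + 2⁻¹ * |H x - H' x| := fun s hs x => by
    have e : G x / (2 * κ) + s * (H x / 2) - (G' x / (2 * κ) + s * (H' x / 2))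
      = (2 * κ)⁻¹ * (G x - G' x) + s * (2⁻¹ * (H x - H' x)) := by ring
    rw [e]
    refine (abs_add_le _ _).trans (le_of_eq ?_)
    rw [abs_mul, abs_mul, abs_mul, hs, one_mul, abs_of_pos (by positivity : 0 < (2 * κ)⁻¹),
      abs_of_pos (by norm_num : (0 : ℝ) < 2⁻¹)]
  have hI : ∫ x, ((2 * κ)⁻¹ * |G x - G' x| + 2⁻¹ * |H x - H' x|)
      = (2 * κ)⁻¹ * (∫ x, |G x - G' x|) + 2⁻¹ * ∫ x, |H x - H' x| := by
    rw [integral_add (dG.const_mul _) (dH.const_mul _), integral_const_mul, integral_const_mul]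
  have c1 : ∫ x, |G x / (2 * κ) - H x / 2 - (G' x / (2 * κ) - H' x / 2)|
      ≤ (2 * κ)⁻¹ * (∫ x, |G x - G' x|) + 2⁻¹ * ∫ x, |H x - H' x| := by
    rw [← hI]
    refine integral_mono ((hm hG hH).sub (hm hG' hH')).abs
      ((dG.const_mul _).add (dH.const_mul _)) fun x => ?_
    have := hbound (-1) (by simp) x
    simpa [sub_eq_add_neg] using this
  have c2 : ∫ x, |G x / (2 * κ) + H x / 2 - (G' x / (2 * κ) + H' x / 2)|
      ≤ (2 * κ)⁻¹ * (∫ x, |G x - G' x|) + 2⁻¹ * ∫ x, |H x - H' x| := by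
    rw [← hI]
    refine integral_mono ((hp hG hH).sub (hp hG' hH')).abs
      ((dG.const_mul _).add (dH.const_mul _)) fun x => ?_
    have := hbound 1 (by simp) x
    simpa using this
  have hκ' := inv_pos.2 hκ
  calc _ ≤ _ := hsplit
    _ ≤ κ⁻¹ * ((2 * κ)⁻¹ * (∫ x, |G x - G' x|) + 2⁻¹ * ∫ x, |H x - H' x|)
        + κ⁻¹ * ((2 * κ)⁻¹ * (∫ x, |G x - G' x|) + 2⁻¹ * ∫ x, |H x - H' x|) :=
      add_le_add (b1.trans (mul_le_mul_of_nonneg_left c1 hκ'.le))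
        (b2.trans (mul_le_mul_of_nonneg_left c2 hκ'.le))
    _ = _ := by field_simp; ring

end Helmholtz

/-- A nondecreasing Lipschitz function vanishing at `0`. -/
structure IsLipMono (J : ℝ → ℝ) (L : ℝ) : Prop where
  mono : Monotone J
  lip : ∀ p q, |J p - J q| ≤ L * |p - q|
  zero : J 0 = 0

section Inverse

variable {J : ℝ → ℝ} {L ε : ℝ}

theorem IsLipMono.nonneg (hJ : IsLipMono J L) : 0 ≤ L := by
  simpa using (abs_nonneg _).trans (hJ.lip 1 0)

theorem IsLipMono.continuous (hJ : IsLipMono J L) : Continuous J :=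
  (LipschitzWith.of_dist_le' (K := L) fun a b => by
    rw [Real.dist_eq, Real.dist_eq]; exact hJ.lip a b).continuous

theorem IsLipMono.strictMono_reg (hJ : IsLipMono J L) (hε : 0 < ε) {a : ℝ} (ha : 0 ≤ a) :
    StrictMono fun r => J (a * r) + ε * r := by
  intro r s hrs
  have := hJ.mono (mul_le_mul_of_nonneg_left hrs.le ha)
  have := mul_lt_mul_of_pos_left hrs hε
  simp only; linarith

theorem IsLipMono.surjective_reg (hJ : IsLipMono J L) (hε : 0 < ε) {a : ℝ} (ha : 0 ≤ a) :
    Function.Surjective fun r => J (a * r) + ε * r := by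
  refine Continuous.surjective ?_ ?_ ?_
  · exact (hJ.continuous.comp (continuous_const.mul continuous_id)).add
      (continuous_const.mul continuous_id)
  · refine tendsto_atTop_mono' _ ?_ (tendsto_id.const_mul_atTop hε)
    filter_upwards [eventually_ge_atTop 0] with r hr
    have := hJ.mono (mul_nonneg ha hr)
    rw [hJ.zero] at this
    simp only [id]; linarith
  · refine tendsto_atBot_mono' _ ?_ (tendsto_id.const_mul_atBot hε)
    filter_upwards [eventually_le_atBot 0] with r hr
    have := hJ.mono (mul_nonpos_of_nonneg_of_nonpos ha hr)
    rw [hJ.zero] at this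
    simp only [id]; linarith

theorem isNonlin_reg (hJ : IsLipMono J L) (hε : 0 < ε) {a : ℝ → ℝ} {A : ℝ}
    (ha : ∀ x, 0 ≤ a x) (hA : ∀ x, a x ≤ A) :
    IsNonlin (fun x r => J (a x * r) + ε * r) (L * A + ε) where
  mono x := (hJ.strictMono_reg hε (ha x)).monotone
  growth x r := by
    have h1 := hJ.lip (a x * r) 0
    rw [hJ.zero, sub_zero, sub_zero, abs_mul, abs_of_nonneg (ha x)] at h1
    have h2 : |r| ≤ 1 + r ^ 2 := by rw [← sq_abs]; nlinarith [sq_nonneg (|r| - 1), abs_nonneg r]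
    have h3 := abs_add_le (J (a x * r)) (ε * r)
    rw [abs_mul, abs_of_pos hε] at h3
    have h4 : L * (a x * |r|) ≤ L * A * |r| := by
      rw [mul_assoc]
      exact mul_le_mul_of_nonneg_left (mul_le_mul_of_nonneg_right (hA x) (abs_nonneg _)) hJ.nonneg
    have h5 : 0 ≤ L * A + ε := add_nonneg (mul_nonneg hJ.nonneg ((ha 0).trans (hA 0))) hε.le
    calc _ ≤ (L * A + ε) * |r| := by linarith
      _ ≤ _ := mul_le_mul_of_nonneg_left h2 h5

end Inverse

/-- Take w = J(a y) + ε y as unknown, so y = B(w). With μ = ε κ², the equation μ y - w'' - f y' = F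
becomes κ² w - w'' = κ² J(a y) - f' y + F + (f y)', because κ² w - μ y = κ² J(a y). This is a fixed
point problem for the Helmholtz resolvent, contractive in L¹ for large κ. -/
theorem exists_range_reg_large {J : ℝ → ℝ} {L ε : ℝ} (hJ : IsLipMono J L) (hε : 0 < ε)
    {a : ℝ → ℝ} {A : ℝ} (ha : ∀ x, 0 ≤ a x) (hA : ∀ x, a x ≤ A) (hac : Continuous a)
    {f : ℝ → ℝ} {c₀ c₁ : ℝ} (hf : IsDrift f c₀ c₁) :
    ∃ μ, c₁ < μ ∧ ∀ F : L1R, ∃ y v : L1R,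
      v ∈ opB (fun x r => J (a x * r) + ε * r) f y ∧ F = μ • y + v := by
  have hA0 : 0 ≤ A := (ha 0).trans (hA 0)
  have hL0 := hJ.nonneg
  set Λ := ε + A * L with hΛ
  have hΛ0 : 0 < Λ := by positivity
  choose B hB using fun x => hJ.surjective_reg hε (ha x)
  simp only at hB
  have hBm : ∀ {w : ℝ → ℝ}, Measurable w → Measurable fun x => B x (w x) := fun {w} hw => by
    refine measurable_of_Iic fun c => ?_
    have : (fun x => B x (w x)) ⁻¹' Iic c = {x | w x ≤ J (a x * c) + ε * c} := by
      ext x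
      have := (hJ.strictMono_reg hε (ha x)).le_iff_le (a := B x (w x)) (b := c)
      simp only [hB] at this
      exact this.symm
    rw [this]
    exact measurableSet_le hw ((hJ.continuous.comp (hac.mul continuous_const)).add
      continuous_const).measurable
  have hBlip : ∀ x w w', ε * |B x w - B x w'| + |J (a x * B x w) - J (a x * B x w')|
      = |w - w'| := fun x w w' => by
    wlog hle : w' ≤ w generalizing w w'
    · rw [abs_sub_comm (B x w), abs_sub_comm (J _), abs_sub_comm w]
      exact this w' w (not_le.1 hle).le
    have h1 : B x w' ≤ B x w := by
      rw [← (hJ.strictMono_reg hε (ha x)).le_iff_le]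
      simpa only [hB] using hle
    have h2 := hJ.mono (mul_le_mul_of_nonneg_left h1 (ha x))
    rw [abs_of_nonneg (sub_nonneg.2 h1), abs_of_nonneg (sub_nonneg.2 h2),
      abs_of_nonneg (sub_nonneg.2 hle)]
    have e1 := hB x w
    have e2 := hB x w'
    linarith
  -- Ellipticity produces the gap: the increments of ε B and of J(a B) add up in absolute value to
  -- |w - w'|, and the first is at least ε |w - w'| / Λ.
  have hJB : ∀ x w w', |J (a x * B x w) - J (a x * B x w')| ≤ (1 - ε / Λ) * |w - w'| := by
    intro x w w'
    have h1 := hBlip x w w'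
    have h2 := hJ.lip (a x * B x w) (a x * B x w')
    rw [← mul_sub, abs_mul, abs_of_nonneg (ha x)] at h2
    have h3 : L * (a x * |B x w - B x w'|) ≤ A * L * |B x w - B x w'| := by
      rw [mul_comm A, mul_assoc]
      exact mul_le_mul_of_nonneg_left (mul_le_mul_of_nonneg_right (hA x) (abs_nonneg _)) hL0
    have h4 : |w - w'| / Λ ≤ |B x w - B x w'| := by
      rw [div_le_iff₀ hΛ0, hΛ]
      linarith
    have h5 : (1 - ε / Λ) * |w - w'| = |w - w'| - ε * (|w - w'| / Λ) := by ring
    rw [h5]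
    nlinarith
  have hBle : ∀ x w w', |B x w - B x w'| ≤ ε⁻¹ * |w - w'| := fun x w w' => by
    rw [← div_eq_inv_mul, le_div_iff₀ hε, mul_comm]
    linarith [hBlip x w w', abs_nonneg (J (a x * B x w) - J (a x * B x w'))]
  have hB0 : ∀ x, B x 0 = 0 := fun x => by
    refine (hJ.strictMono_reg hε (ha x)).injective ?_
    simp only [hB, mul_zero, hJ.zero, add_zero]
  have hBi : ∀ w : L1R, Integrable fun x => B x (w x) := fun w => by
    refine ((integrable_L1R w).abs.const_mul ε⁻¹).mono'
      (hBm (Lp.stronglyMeasurable w).measurable).aestronglyMeasurable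
      (Eventually.of_forall fun x => ?_)
    simpa [hB0] using hBle x (w x) 0
  have hJi : ∀ w : L1R, Integrable fun x => J (a x * B x (w x)) := fun w => by
    refine ((integrable_L1R w).abs.const_mul (1 - ε / Λ)).mono'
      (hJ.continuous.measurable.comp (hac.measurable.mul
        (hBm (Lp.stronglyMeasurable w).measurable))).aestronglyMeasurable
      (Eventually.of_forall fun x => ?_)
    simpa [hB0, hJ.zero] using hJB x (w x) 0
  have hc0 := hf.nonneg₀
  have hc1 := hf.nonneg₁
  -- The second summand makes the drift cost at most ε/(2Λ), half of the gap ε/Λ; the third ensures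
  -- ε κ² > c₁; the 1 gives κ ≤ κ².
  set κ : ℝ := 1 + (c₁ + c₀) * (2 * Λ) / ε ^ 2 + c₁ / ε with hκdef
  have hκ1 : 1 ≤ κ := by
    have : 0 ≤ (c₁ + c₀) * (2 * Λ) / ε ^ 2 + c₁ / ε := by positivity
    linarith
  have hκ0 : 0 < κ := by linarith
  have hκsq : κ ≤ κ ^ 2 := by nlinarith
  have hθ1 : (c₁ + c₀) / (ε * κ) ≤ ε / (2 * Λ) := by
    rw [div_le_div_iff₀ (by positivity) (by positivity)]
    have : (c₁ + c₀) * (2 * Λ) / ε ^ 2 ≤ κ := by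
      have : 0 ≤ c₁ / ε := by positivity
      linarith
    rw [div_le_iff₀ (by positivity)] at this
    nlinarith
  have hμ : c₁ < ε * κ ^ 2 := by
    have h1 : c₁ / ε < κ := by
      have : 0 ≤ (c₁ + c₀) * (2 * Λ) / ε ^ 2 := by positivity
      linarith
    rw [div_lt_iff₀ hε] at h1
    nlinarith
  clear_value κ Λ
  refine ⟨ε * κ ^ 2, hμ, fun F => ?_⟩
  set G : L1R → ℝ → ℝ := fun w x =>
    κ ^ 2 * J (a x * B x (w x)) - deriv f x * B x (w x) + F x with hGdef
  set H : L1R → ℝ → ℝ := fun w x => f x * B x (w x) with hHdef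
  have hG : ∀ w, Integrable (G w) := fun w =>
    (((hJi w).const_mul _).sub (hf.integrable_deriv_mul (hBi w))).add (integrable_L1R F)
  have hH : ∀ w, Integrable (H w) := fun w => hf.integrable_mul (hBi w)
  set Φ : L1R → L1R := fun w => (integrable_helmholtz hκ0 (hG w) (hH w)).toL1 _ with hΦ
  have hθ0 : 0 ≤ 1 - ε / (2 * Λ) := by
    have : ε / (2 * Λ) ≤ 1 := by
      rw [div_le_one (by positivity), hΛ]
      have : 0 ≤ A * L := by positivity
      linarith
    linarith
  have hlip : ∀ w w' : L1R, ‖Φ w - Φ w'‖ ≤ (1 - ε / (2 * Λ)) * ‖w - w'‖ := by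
    intro w w'
    have n1 : ‖Φ w - Φ w'‖ = ∫ x, |helmholtz κ (G w) (H w) x - helmholtz κ (G w') (H w') x| := by
      rw [hΦ, ← Integrable.toL1_sub, L1.norm_eq_integral_norm]
      refine integral_congr_ae ?_
      filter_upwards [Integrable.coeFn_toL1 ((integrable_helmholtz hκ0 (hG w) (hH w)).sub
        (integrable_helmholtz hκ0 (hG w') (hH w')))] with x hx
      rw [hx]; rfl
    have n2 : ‖w - w'‖ = ∫ x, |w x - w' x| := by
      rw [L1.norm_eq_integral_norm]
      refine integral_congr_ae ?_
      filter_upwards [Lp.coeFn_sub w w'] with x hx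
      rw [hx]; rfl
    have hd : Integrable fun x => |w x - w' x| := ((integrable_L1R w).sub (integrable_L1R w')).abs
    have d1 : ∫ x, |G w x - G w' x|
        ≤ (κ ^ 2 * (1 - ε / Λ) + c₁ * ε⁻¹) * ∫ x, |w x - w' x| := by
      rw [← integral_const_mul]
      refine integral_mono ((hG w).sub (hG w')).abs (hd.const_mul _) fun x => ?_
      have e : G w x - G w' x = κ ^ 2 * (J (a x * B x (w x)) - J (a x * B x (w' x)))
          - deriv f x * (B x (w x) - B x (w' x)) := by simp only [hGdef]; ring
      simp only
      rw [e]
      refine (abs_sub _ _).trans ?_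
      rw [abs_mul, abs_mul, abs_of_nonneg (sq_nonneg κ), add_mul]
      refine add_le_add ?_ ?_
      · rw [mul_assoc]
        exact mul_le_mul_of_nonneg_left (hJB x _ _) (sq_nonneg κ)
      · rw [mul_assoc]
        exact mul_le_mul (hf.bdd_deriv x) (hBle x _ _) (abs_nonneg _) hc1
    have d2 : ∫ x, |H w x - H w' x| ≤ (c₀ * ε⁻¹) * ∫ x, |w x - w' x| := by
      rw [← integral_const_mul]
      refine integral_mono ((hH w).sub (hH w')).abs (hd.const_mul _) fun x => ?_
      simp only [hHdef]
      rw [← mul_sub, abs_mul, mul_assoc]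
      exact mul_le_mul (hf.bdd x) (hBle x _ _) (abs_nonneg _) hc0
    have hb := integral_abs_helmholtz_sub_le hκ0 (hG w) (hH w) (hG w') (hH w')
    rw [n1, n2]
    have hI : 0 ≤ ∫ x, |w x - w' x| := integral_nonneg fun x => abs_nonneg _
    have hκi : (κ ^ 2)⁻¹ ≤ κ⁻¹ := inv_anti₀ hκ0 hκsq
    calc _ ≤ _ := hb
      _ ≤ (κ ^ 2)⁻¹ * ((κ ^ 2 * (1 - ε / Λ) + c₁ * ε⁻¹) * ∫ x, |w x - w' x|)
          + κ⁻¹ * ((c₀ * ε⁻¹) * ∫ x, |w x - w' x|) :=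
        add_le_add (mul_le_mul_of_nonneg_left d1 (by positivity))
          (mul_le_mul_of_nonneg_left d2 (by positivity))
      _ = ((1 - ε / Λ) + (κ ^ 2)⁻¹ * (c₁ * ε⁻¹) + κ⁻¹ * (c₀ * ε⁻¹)) * ∫ x, |w x - w' x| := by
        field_simp
      _ ≤ ((1 - ε / Λ) + κ⁻¹ * (c₁ * ε⁻¹) + κ⁻¹ * (c₀ * ε⁻¹)) * ∫ x, |w x - w' x| := by
        gcongr
      _ = ((1 - ε / Λ) + (c₁ + c₀) / (ε * κ)) * ∫ x, |w x - w' x| := by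
        field_simp; ring
      _ ≤ _ := by
        refine mul_le_mul_of_nonneg_right ?_ hI
        have : ε / Λ = 2 * (ε / (2 * Λ)) := by field_simp
        linarith
  have hcw : ContractingWith (Real.toNNReal (1 - ε / (2 * Λ))) Φ := by
    refine ⟨?_, LipschitzWith.of_dist_le_mul fun w w' => ?_⟩
    · rw [← NNReal.coe_lt_coe, Real.coe_toNNReal _ hθ0]
      have : 0 < ε / (2 * Λ) := by positivity
      simp; linarith
    · rw [dist_eq_norm, dist_eq_norm, Real.coe_toNNReal _ hθ0]
      exact hlip w w'
  obtain ⟨w, hw⟩ : ∃ w, Φ w = w := ⟨_, hcw.fixedPoint_isFixedPt⟩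
  have hwae : ∀ᵐ x, w x = helmholtz κ (G w) (H w) x := by
    have := (integrable_helmholtz hκ0 (hG w) (hH w)).coeFn_toL1
    have h2 : (integrable_helmholtz hκ0 (hG w) (hH w)).toL1 _ = w := hw
    rwa [h2] at this
  set y : L1R := (hBi w).toL1 _ with hy
  have hyae : ∀ᵐ x, y x = B x (w x) := (hBi w).coeFn_toL1
  have hβae : ∀ᵐ x, J (a x * y x) + ε * y x = w x := by
    filter_upwards [hyae] with x hx
    rw [hx]; exact hB x (w x)
  refine ⟨y, F - (ε * κ ^ 2) • y, ⟨?_, fun φ hφ => ?_⟩, by abel⟩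
  · exact ((integrable_L1R w).congr (by filter_upwards [hβae] with x hx using hx.symm)
      ).locallyIntegrable
  · have h1 := integral_helmholtz_mul hκ0 (hG w) (hH w) hφ
    have e1 : ∫ x, helmholtz κ (G w) (H w) x * (κ ^ 2 * φ x - deriv (deriv φ) x)
        = κ ^ 2 * (∫ x, w x * φ x) - ∫ x, w x * deriv (deriv φ) x := by
      rw [← integral_const_mul, ← integral_sub
        ((hφ.integrable_mul (integrable_L1R w).locallyIntegrable).const_mul _)
        (hφ.deriv.deriv.integrable_mul (integrable_L1R w).locallyIntegrable)]
      refine integral_congr_ae ?_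
      filter_upwards [hwae] with x hx
      rw [← hx]; ring
    have e2 : ∫ x, (J (a x * y x) + ε * y x) * iteratedDeriv 2 φ x
        = ∫ x, w x * deriv (deriv φ) x := by
      rw [iteratedDeriv_two]
      refine integral_congr_ae ?_
      filter_upwards [hβae] with x hx
      rw [hx]
    have hGφ := hφ.integrable_mul (hG w).locallyIntegrable
    have hHφ := hφ.deriv.integrable_mul (hH w).locallyIntegrable
    have hwφ := hφ.integrable_mul (integrable_L1R w).locallyIntegrable
    have hyfφ : Integrable fun x => y x * deriv (fun t => f t * φ t) x := by
      refine ((hφ.integrable_mul (hf.integrable_deriv_mul (integrable_L1R y)).locallyIntegrable).add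
        (hφ.deriv.integrable_mul (hf.integrable_mul (integrable_L1R y)).locallyIntegrable)).congr
        (Eventually.of_forall fun x => ?_)
      simp only [Pi.add_apply]
      rw [hf.deriv_mul (hasDerivAt_test hφ x).differentiableAt]; ring
    have e3 : ∫ x, (F - (ε * κ ^ 2) • y) x * φ x
        = (∫ x, G w x * φ x) - (∫ x, H w x * deriv φ x) - κ ^ 2 * (∫ x, w x * φ x)
          + ∫ x, y x * deriv (fun t => f t * φ t) x := by
      have j1 : Integrable fun x => G w x * φ x - H w x * deriv φ x := hGφ.sub hHφ
      have j2 : Integrable fun x => G w x * φ x - H w x * deriv φ x - κ ^ 2 * (w x * φ x) :=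
        j1.sub (hwφ.const_mul _)
      rw [← integral_const_mul, ← integral_sub hGφ hHφ, ← integral_sub j1
        (hwφ.const_mul _), ← integral_add j2 hyfφ]
      refine integral_congr_ae ?_
      filter_upwards [Lp.coeFn_sub F ((ε * κ ^ 2) • y), Lp.coeFn_smul (ε * κ ^ 2) y, hyae]
        with x h1 h2 h3
      rw [h1, Pi.sub_apply, h2, Pi.smul_apply, smul_eq_mul,
        hf.deriv_mul (hasDerivAt_test hφ x).differentiableAt]
      simp only [hGdef, hHdef, h3]
      have := hB x (w x)
      linear_combination (-(κ ^ 2 * φ x)) * this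
    rw [e2, e3]
    rw [e1] at h1
    linarith

/-- The range condition for nondegenerate Lipschitz nonlinearities. -/
theorem exists_range_reg {J : ℝ → ℝ} {L ε : ℝ} (hJ : IsLipMono J L) (hε : 0 < ε)
    {a : ℝ → ℝ} {A : ℝ} (ha : ∀ x, 0 ≤ a x) (hA : ∀ x, a x ≤ A) (hac : Continuous a)
    {f : ℝ → ℝ} {c₀ c₁ : ℝ} (hf : IsDrift f c₀ c₁) {μ : ℝ} (hμ : c₁ < μ) (F : L1R) :
    ∃ y v : L1R, v ∈ opB (fun x r => J (a x * r) + ε * r) f y ∧ F = μ • y + v := by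
  obtain ⟨μ₀, hμ₀, hR⟩ := exists_range_reg_large hJ hε ha hA hac hf
  have hacc := isAccretive_opB (isNonlin_reg hJ hε ha hA) hf
  have hm := hacc.isMAccretive (sub_pos.2 hμ₀) fun w => by
    obtain ⟨y, v, hv, e⟩ := hR w
    exact ⟨y, c₁ • y + v, ⟨v, hv, rfl⟩, by rw [e, sub_smul]; abel⟩
  obtain ⟨y, _, ⟨v, hv, rfl⟩, e⟩ := hm.2 (μ - c₁) (sub_pos.2 hμ) F
  exact ⟨y, v, hv, by rw [e, sub_smul]; abel⟩

end DegenerateFP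

namespace DegenerateFP

/-! ### The conjugate function and its smooth Lipschitz approximations -/

/-- The properties of `H^*` which are used: it is nondecreasing, convex, coercive at `+∞` and of
at most quadratic growth. -/
structure IsConj (j : ℝ → ℝ) (C : ℝ) : Prop where
  mono : Monotone j
  convex : ConvexOn ℝ univ j
  lower : ∀ p, p - C ≤ j p
  growth : ∀ p, |j p| ≤ C * (1 + p ^ 2)

/-- As a supremum of affine functions with slopes u ≥ 0, the conjugate is convex and nondecreasing.
The choice u = 1 gives linear coercivity, u = 0 a lower bound by -h(0), and completing the square in
the quadratic minorant of h gives the bound p²/(4a). -/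
theorem isConj_Hstar {h : ℝ → ℝ} {a b : ℝ} (ha : 0 < a) (hb : 0 ≤ b)
    (hh : ∀ u, a * |u| ^ 2 + b ≤ h u) : ∃ C, IsConj (Hstar h) C := by
  have hle : ∀ p u, 0 ≤ u → p * u - h u ≤ Hstar h p := fun p u hu => by
    rw [Hstar_eq ha hh]
    exact le_ciSup (bddAbove_of_quadratic ha hh p) (⟨u, hu⟩ : Ici (0 : ℝ))
  have hge : ∀ p M, (∀ u, 0 ≤ u → p * u - h u ≤ M) → Hstar h p ≤ M := fun p M hM => by
    rw [Hstar_eq ha hh]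
    have : Nonempty (Ici (0 : ℝ)) := ⟨⟨(0 : ℝ), Set.mem_Ici.2 le_rfl⟩⟩
    exact ciSup_le fun u => hM u u.2
  refine ⟨|h 0| + |h 1| + 1 / (4 * a), ?_, ⟨convex_univ, ?_⟩, fun p => ?_, fun p => ?_⟩
  · intro p q hpq
    refine hge p _ fun u hu => le_trans ?_ (hle q u hu)
    have := mul_le_mul_of_nonneg_right hpq hu
    linarith
  · intro p _ q _ s t hs ht hst
    refine hge _ _ fun u hu => ?_
    have h1 := mul_le_mul_of_nonneg_left (hle p u hu) hs
    have h2 := mul_le_mul_of_nonneg_left (hle q u hu) ht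
    simp only [smul_eq_mul]
    have e : (s * p + t * q) * u - h u = s * (p * u - h u) + t * (q * u - h u) := by
      have : t = 1 - s := by linarith
      rw [this]; ring
    linarith
  · have h1 := hle p 1 zero_le_one
    have h2 := le_abs_self (h 1)
    have h3 := abs_nonneg (h 0)
    have h4 : 0 < 1 / (4 * a) := by positivity
    linarith
  · have h1 := hle p 0 le_rfl
    have h2 : Hstar h p ≤ 1 / (4 * a) * p ^ 2 := hge _ _ fun u hu => by
      have h3 := hh u
      rw [sq_abs] at h3
      have : 1 / (4 * a) * p ^ 2 - (p * u - a * u ^ 2) = (p - 2 * a * u) ^ 2 / (4 * a) := by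
        field_simp; ring
      have h4 : 0 ≤ (p - 2 * a * u) ^ 2 / (4 * a) := by positivity
      linarith
    have h5 := le_abs_self (h 0)
    have h6 : 0 < 1 / (4 * a) := by positivity
    have h7 : 0 ≤ 1 / (4 * a) * p ^ 2 := by positivity
    have h8 : 0 ≤ (|h 0| + |h 1|) * p ^ 2 := by positivity
    have h9 := abs_nonneg (h 0)
    have h10 := abs_nonneg (h 1)
    rw [abs_le]
    constructor <;> nlinarith

namespace IsConj

variable {j : ℝ → ℝ} {C : ℝ}

/-- The slope of `j` on `(-∞, P]`. -/
def slopeAt (j : ℝ → ℝ) (P : ℝ) : ℝ := j (P + 1) - j P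

theorem slopeAt_nonneg (hj : IsConj j C) (P : ℝ) : 0 ≤ slopeAt j P :=
  sub_nonneg.2 (hj.mono (by linarith))

/-- Chord slopes of a convex function increase, so every chord to the left of P is dominated by the
chord over [P, P + 1]. -/
theorem sub_le (hj : IsConj j C) {p q P : ℝ} (hpq : p ≤ q) (hq : q ≤ P) :
    j q - j p ≤ slopeAt j P * (q - p) := by
  rcases hpq.eq_or_lt with rfl | hpq
  · simp
  rw [← div_le_iff₀ (sub_pos.2 hpq)]
  have hadj : ∀ {x y z : ℝ}, x < y → y < z → (j y - j x) / (y - x) ≤ (j z - j y) / (z - y) :=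
    fun {x y z} hxy hyz => hj.convex.slope_mono_adjacent (mem_univ x) (mem_univ z) hxy hyz
  have e : slopeAt j P = (j (P + 1) - j P) / (P + 1 - P) := by rw [slopeAt]; simp
  rw [e]
  rcases hq.eq_or_lt with rfl | hq
  · exact hadj hpq (by linarith)
  · exact (hadj hpq hq).trans (hadj hq (by linarith))

theorem abs_sub_le (hj : IsConj j C) {p q P : ℝ} (hp : p ≤ P) (hq : q ≤ P) :
    |j p - j q| ≤ slopeAt j P * |p - q| := by
  rcases le_total p q with h | h
  · rw [abs_sub_comm, abs_sub_comm p, abs_of_nonneg (sub_nonneg.2 (hj.mono h)),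
      abs_of_nonneg (sub_nonneg.2 h)]
    exact hj.sub_le h hq
  · rw [abs_of_nonneg (sub_nonneg.2 (hj.mono h)), abs_of_nonneg (sub_nonneg.2 h)]
    exact hj.sub_le h hp

/-- `j`, continued with slope `1` beyond `K`. -/
def trunc (j : ℝ → ℝ) (K p : ℝ) : ℝ := j (min p K) + (p - min p K)

theorem trunc_eq {K p : ℝ} (h : p ≤ K) : trunc j K p = j p := by simp [trunc, h]

theorem trunc_mono (hj : IsConj j C) (K : ℝ) : Monotone (trunc j K) := fun p q hpq => by
  have h1 := hj.mono (min_le_min_right K hpq)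
  have h2 : p - min p K ≤ q - min q K := by
    rcases le_total p K with hp | hp <;> rcases le_total q K with hq | hq <;>
      simp only [hp, hq, min_eq_left, min_eq_right] <;> linarith
  simp only [trunc]; linarith

theorem trunc_lip (hj : IsConj j C) (K p q : ℝ) :
    |trunc j K p - trunc j K q| ≤ (slopeAt j K + 1) * |p - q| := by
  have h1 := hj.abs_sub_le (min_le_right p K) (min_le_right q K)
  have h2 : |min p K - min q K| ≤ |p - q| := by
    have := abs_min_sub_min_le_max p K q K
    simpa using this
  have h3 : |(p - min p K) - (q - min q K)| ≤ |p - q| := by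
    rcases le_total p K with hp | hp <;> rcases le_total q K with hq | hq <;>
      simp only [hp, hq, min_eq_left, min_eq_right] <;>
      rcases le_total p q with h | h <;>
      simp only [abs_le, neg_le, abs_of_nonneg, abs_of_nonpos, sub_nonneg, sub_nonpos, h] <;>
      constructor <;> linarith
  have e : trunc j K p - trunc j K q = (j (min p K) - j (min q K))
      + ((p - min p K) - (q - min q K)) := by simp only [trunc]; ring
  rw [e, add_mul, one_mul]
  exact (abs_add_le _ _).trans (add_le_add
    (h1.trans (mul_le_mul_of_nonneg_left h2 (hj.slopeAt_nonneg K))) h3)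

theorem trunc_lower (hj : IsConj j C) (K p : ℝ) : p - C ≤ trunc j K p := by
  have := hj.lower (min p K)
  simp only [trunc]; linarith

end IsConj

/-- The average of `g` over `[p, p + δ]`. -/
def avg (δ : ℝ) (g : ℝ → ℝ) (p : ℝ) : ℝ := δ⁻¹ * ∫ t in (0 : ℝ)..δ, g (p + t)

section Avg

variable {δ : ℝ} {g : ℝ → ℝ}

theorem hasDerivAt_avg (hg : Continuous g) (p : ℝ) :
    HasDerivAt (avg δ g) (δ⁻¹ * (g (p + δ) - g p)) p := by
  have e : avg δ g = fun p => δ⁻¹ * ((∫ t in (0 : ℝ)..(p + δ), g t) - ∫ t in (0 : ℝ)..p, g t) := by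
    funext p
    rw [avg, intervalIntegral.integral_interval_sub_left (hg.intervalIntegrable _ _)
      (hg.intervalIntegrable _ _), intervalIntegral.integral_comp_add_left]
    simp
  rw [e]
  have h1 : HasDerivAt (fun p => ∫ t in (0 : ℝ)..(p + δ), g t) (g (p + δ)) p :=
    (hg.integral_hasStrictDerivAt 0 (p + δ)).hasDerivAt.comp_add_const p δ
  exact (h1.sub (hg.integral_hasStrictDerivAt 0 p).hasDerivAt).const_mul _

theorem avg_sub_mem (hδ : 0 < δ) (hg : Continuous g) {p q a b : ℝ}
    (h : ∀ t ∈ Icc 0 δ, a ≤ g (q + t) - g (p + t) ∧ g (q + t) - g (p + t) ≤ b) :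
    a ≤ avg δ g q - avg δ g p ∧ avg δ g q - avg δ g p ≤ b := by
  have c1 : Continuous fun t => g (q + t) := hg.comp (continuous_const.add continuous_id)
  have c2 : Continuous fun t => g (p + t) := hg.comp (continuous_const.add continuous_id)
  have e : avg δ g q - avg δ g p = δ⁻¹ * ∫ t in (0 : ℝ)..δ, (g (q + t) - g (p + t)) := by
    rw [intervalIntegral.integral_sub (c1.intervalIntegrable _ _) (c2.intervalIntegrable _ _),
      avg, avg]; ring
  have h1 := intervalIntegral.integral_mono_on (μ := volume) hδ.le (intervalIntegrable_const (c := a))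
    ((c1.sub c2).intervalIntegrable _ _) fun t ht => (h t ht).1
  have h2 := intervalIntegral.integral_mono_on (μ := volume) hδ.le ((c1.sub c2).intervalIntegrable _ _)
    (intervalIntegrable_const (c := b)) fun t ht => (h t ht).2
  rw [intervalIntegral.integral_const, smul_eq_mul, sub_zero] at h1 h2
  simp only [Pi.sub_apply] at h1 h2
  rw [e, ← div_eq_inv_mul, le_div_iff₀ hδ, div_le_iff₀ hδ]
  exact ⟨by linarith, by linarith⟩

theorem avg_mem (hδ : 0 < δ) (hg : Continuous g) {p a b : ℝ}
    (h : ∀ t ∈ Icc 0 δ, a ≤ g (p + t) ∧ g (p + t) ≤ b) : a ≤ avg δ g p ∧ avg δ g p ≤ b := by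
  have c2 : Continuous fun t => g (p + t) := hg.comp (continuous_const.add continuous_id)
  have h1 := intervalIntegral.integral_mono_on (μ := volume) hδ.le (intervalIntegrable_const (c := a))
    (c2.intervalIntegrable _ _) fun t ht => (h t ht).1
  have h2 := intervalIntegral.integral_mono_on (μ := volume) hδ.le (c2.intervalIntegrable _ _)
    (intervalIntegrable_const (c := b)) fun t ht => (h t ht).2
  rw [intervalIntegral.integral_const, smul_eq_mul, sub_zero] at h1 h2
  rw [avg, ← div_eq_inv_mul, le_div_iff₀ hδ, div_le_iff₀ hδ]
  exact ⟨by linarith, by linarith⟩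

end Avg

/-- The properties of the approximations of `j - j 0`. -/
structure IsApprox (j J : ℝ → ℝ) (C : ℝ) (k : ℕ) : Prop where
  lipMono : ∃ L, IsLipMono J L
  smooth : ∃ J₁ J₂ : ℝ → ℝ, ∃ B, (∀ p, HasDerivAt J (J₁ p) p) ∧ (∀ p, HasDerivAt J₁ (J₂ p) p) ∧
    Continuous J₂ ∧ ∀ p ≤ 0, 0 ≤ J₁ p ∧ J₁ p ≤ IsConj.slopeAt j 1 ∧ 0 ≤ J₂ p ∧ J₂ p ≤ B
  lip : ∀ P : ℝ, P ≤ k → ∀ p ≤ P, ∀ q ≤ P, |J p - J q| ≤ IsConj.slopeAt j (P + 1) * |p - q|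
  lower : ∀ p, p - (C + j 1) ≤ J p
  close : ∀ P : ℝ, 0 ≤ P → P ≤ k → ∀ p ≤ P,
    |J p - (j p - j 0)| ≤ 2 * IsConj.slopeAt j (P + 1) / (k + 1)

/-- Truncate beyond K = k + 1 to make j Lipschitz, average twice to make it C², and subtract the
value at 0. The truncation may destroy convexity, but only far to the right: the sign of the second
derivative is needed on p ≤ 0 alone. -/
theorem IsConj.exists_approx {j : ℝ → ℝ} {C : ℝ} (hj : IsConj j C) (k : ℕ) :
    ∃ J, IsApprox j J C k := by
  set K : ℝ := k + 1 with hK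
  have hK0 : 0 < K := by positivity
  -- Two forward averages look ahead by at most 2δ = 1/K ≤ 1; hence the argument P + 1 in the slopes
  -- and the factor 1/(k + 1) in the distance to j - j(0).
  set δ : ℝ := (2 * K)⁻¹ with hδdef
  have hδ : 0 < δ := by positivity
  have hδ2 : 2 * δ = 1 / K := by rw [hδdef]; field_simp
  have hδ1 : 2 * δ ≤ 1 := by
    rw [hδ2, div_le_one hK0, hK]
    have : (0 : ℝ) ≤ k := Nat.cast_nonneg k
    linarith
  set g := IsConj.trunc j K with hg
  set L := IsConj.slopeAt j K + 1 with hL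
  have hL0 : 0 ≤ L := by have := hj.slopeAt_nonneg K; linarith
  have hglip := hj.trunc_lip K
  have hgm := hj.trunc_mono K
  have hgc : Continuous g := (LipschitzWith.of_dist_le' (K := L) fun a b => by
    rw [Real.dist_eq, Real.dist_eq]; exact hglip a b).continuous
  have hgeq : ∀ p ≤ K, g p = j p := fun p hp => IsConj.trunc_eq hp
  set g₁ := avg δ g with hg₁
  have hd₁ : ∀ p, HasDerivAt g₁ (δ⁻¹ * (g (p + δ) - g p)) p := fun p => hasDerivAt_avg hgc p
  have hg₁c : Continuous g₁ := continuous_iff_continuousAt.2 fun p => (hd₁ p).continuousAt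
  set g₂ := avg δ g₁ with hg₂
  have hd₂ : ∀ p, HasDerivAt g₂ (δ⁻¹ * (g₁ (p + δ) - g₁ p)) p := fun p => hasDerivAt_avg hg₁c p
  have hstep : ∀ p q a b, (∀ t ∈ Icc 0 (2 * δ), a ≤ g (q + t) - g (p + t) ∧
      g (q + t) - g (p + t) ≤ b) → a ≤ g₂ q - g₂ p ∧ g₂ q - g₂ p ≤ b := by
    intro p q a b h
    refine avg_sub_mem hδ hg₁c fun t ht => avg_sub_mem hδ hgc fun s hs => ?_
    rw [add_assoc, add_assoc]
    exact h (t + s) ⟨add_nonneg ht.1 hs.1, by linarith [ht.2, hs.2]⟩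
  have hmem : ∀ p, g p ≤ g₂ p ∧ g₂ p ≤ g (p + 2 * δ) := by
    intro p
    refine avg_mem hδ hg₁c fun t ht => avg_mem hδ hgc fun s hs => ?_
    exact ⟨hgm (by linarith [ht.1, hs.1]), hgm (by linarith [ht.2, hs.2])⟩
  have hmono : Monotone g₂ := fun p q hpq => by
    have := (hstep p q 0 (g (q + 2 * δ) - g p) fun t ht =>
      ⟨sub_nonneg.2 (hgm (by linarith)), sub_le_sub (hgm (by linarith [ht.2]))
        (hgm (by linarith [ht.1]))⟩).1
    linarith
  have hlipgen : ∀ (P' L' : ℝ), 0 ≤ L' →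
      (∀ p q, p ≤ q → q ≤ P' + 1 → g q - g p ≤ L' * (q - p)) →
      ∀ p ≤ P', ∀ q ≤ P', |g₂ p - g₂ q| ≤ L' * |p - q| := by
    intro P' L' hL' h p hp q hq
    wlog hpq : p ≤ q generalizing p q
    · rw [abs_sub_comm, abs_sub_comm p]
      exact this q hq p hp (not_le.1 hpq).le
    rw [abs_sub_comm, abs_sub_comm p, abs_of_nonneg (sub_nonneg.2 (hmono hpq)),
      abs_of_nonneg (sub_nonneg.2 hpq)]
    refine (hstep p q 0 (L' * (q - p)) fun t ht => ⟨sub_nonneg.2 (hgm (by linarith)), ?_⟩).2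
    have := h (p + t) (q + t) (by linarith) (by linarith [ht.2])
    rwa [add_sub_add_right_eq_sub] at this
  have hjle : ∀ P : ℝ, P ≤ k → ∀ p q, p ≤ q → q ≤ P + 1 →
      g q - g p ≤ IsConj.slopeAt j (P + 1) * (q - p) := fun P hP p q hpq hq => by
    have hqK : q ≤ K := by rw [hK]; linarith
    rw [hgeq q hqK, hgeq p (hpq.trans hqK)]
    exact hj.sub_le hpq hq
  refine ⟨fun p => g₂ p - g₂ 0, ⟨L, ?_, ?_, ?_⟩, ?_, ?_, ?_, ?_⟩
  · exact fun p q hpq => sub_le_sub_right (hmono hpq) _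
  · intro p q
    rw [sub_sub_sub_cancel_right]
    refine hlipgen (max p q) L hL0 (fun p q hpq _ => ?_) p (le_max_left _ _) q (le_max_right _ _)
    have := hglip q p
    rw [abs_of_nonneg (sub_nonneg.2 (hgm hpq)), abs_of_nonneg (sub_nonneg.2 hpq)] at this
    exact this
  · simp
  · refine ⟨fun p => δ⁻¹ * (g₁ (p + δ) - g₁ p),
      fun p => δ⁻¹ * (δ⁻¹ * (g (p + δ + δ) - g (p + δ)) - δ⁻¹ * (g (p + δ) - g p)),
      δ⁻¹ * L, fun p => (hd₂ p).sub_const _, fun p => ?_, by fun_prop, fun p hp => ?_⟩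
    · have h1 : HasDerivAt (fun p => g₁ (p + δ)) (δ⁻¹ * (g (p + δ + δ) - g (p + δ))) p :=
        (hd₁ (p + δ)).comp_add_const p δ
      exact (h1.sub (hd₁ p)).const_mul _
    · have h1 := avg_sub_mem hδ hgc (p := p) (q := p + δ) (a := 0)
        (b := IsConj.slopeAt j 1 * δ) fun t ht => by
          refine ⟨sub_nonneg.2 (hgm (by linarith)), ?_⟩
          have h2 : p + δ + t ≤ 1 := by linarith [ht.2]
          have h3 : (1 : ℝ) ≤ K := by rw [hK]; linarith [(Nat.cast_nonneg k : (0 : ℝ) ≤ k)]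
          rw [hgeq _ (h2.trans h3), hgeq _ (by linarith)]
          have := hj.sub_le (show p + t ≤ p + δ + t by linarith) h2
          have e : p + δ + t - (p + t) = δ := by ring
          rwa [e] at this
      -- For p ≤ 0 all arguments involved are at most 1 ≤ K, where the truncation is j itself and
      -- convexity applies.
      have h3 : (1 : ℝ) ≤ K := by rw [hK]; linarith [(Nat.cast_nonneg k : (0 : ℝ) ≤ k)]
      have hδi : 0 < δ⁻¹ := inv_pos.2 hδ
      refine ⟨mul_nonneg hδi.le h1.1, ?_, ?_, ?_⟩
      · have := mul_le_mul_of_nonneg_left h1.2 hδi.le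
        have e : δ⁻¹ * (IsConj.slopeAt j 1 * δ) = IsConj.slopeAt j 1 := by field_simp
        rwa [e] at this
      · refine mul_nonneg hδi.le (sub_nonneg.2 (mul_le_mul_of_nonneg_left ?_ hδi.le))
        rw [hgeq (p + δ + δ) (by linarith), hgeq (p + δ) (by linarith), hgeq p (by linarith)]
        have := hj.convex.slope_mono_adjacent (mem_univ p) (mem_univ (p + δ + δ))
          (show p < p + δ by linarith) (show p + δ < p + δ + δ by linarith)
        rw [add_sub_cancel_left, add_sub_cancel_left] at this
        exact (div_le_div_iff_of_pos_right hδ).1 this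
      · refine mul_le_mul_of_nonneg_left ?_ hδi.le
        have h4 : 0 ≤ g (p + δ) - g p := sub_nonneg.2 (hgm (by linarith))
        have h5 := hglip (p + δ + δ) (p + δ)
        rw [add_sub_cancel_left, abs_of_pos hδ] at h5
        have h6 := mul_le_mul_of_nonneg_left ((le_abs_self _).trans h5) hδi.le
        have e : δ⁻¹ * (L * δ) = L := by field_simp
        rw [e] at h6
        have := mul_nonneg hδi.le h4
        linarith
  · intro P hP p hp q hq
    rw [sub_sub_sub_cancel_right]
    exact hlipgen P _ (hj.slopeAt_nonneg _) (hjle P hP) p hp q hq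
  · intro p
    have h1 := (hmem p).1
    have h2 := (hmem 0).2
    have h3 := hj.trunc_lower K p
    have h4 : g (0 + 2 * δ) ≤ j 1 := by
      rw [hgeq _ (by rw [hK]; linarith [(Nat.cast_nonneg k : (0 : ℝ) ≤ k)])]
      exact hj.mono (by linarith)
    linarith
  · intro P hP0 hP p hp
    have hb : ∀ p ≤ P, 0 ≤ g₂ p - j p ∧ g₂ p - j p ≤ IsConj.slopeAt j (P + 1) / K := by
      intro p hp
      have h1 := hmem p
      have hpK : p ≤ K := by rw [hK]; linarith
      have h2 := hjle P hP p (p + 2 * δ) (by linarith) (by linarith)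
      rw [hgeq p hpK] at h1 h2
      have e : p + 2 * δ - p = 1 / K := by rw [add_sub_cancel_left, hδ2]
      rw [e] at h2
      refine ⟨by linarith, ?_⟩
      have : IsConj.slopeAt j (P + 1) * (1 / K) = IsConj.slopeAt j (P + 1) / K := by ring
      rw [← this]
      linarith
    have h1 := hb p hp
    have h2 := hb 0 hP0
    have e : 2 * IsConj.slopeAt j (P + 1) / (k + 1) = IsConj.slopeAt j (P + 1) / K
      + IsConj.slopeAt j (P + 1) / K := by rw [hK]; ring
    rw [e, abs_le]
    constructor <;> linarith

end DegenerateFP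

namespace DegenerateFP

/-! ### A lower barrier -/

theorem IsAntideriv.of_hasDerivAt {P p : ℝ → ℝ} (h : ∀ x, HasDerivAt P (p x) x)
    (hp : Continuous p) : IsAntideriv P p :=
  ⟨hp.locallyIntegrable, fun a b => (intervalIntegral.integral_eq_sub_of_hasDerivAt
    (fun x _ => h x) (hp.intervalIntegrable a b)).symm⟩

/-- Classical solutions are weak ones: all integrations by parts are against compactly supported
functions, so no decay of u or w is required. Used for the barrier. -/
theorem mem_opB_of_hasDerivAt {β : ℝ → ℝ → ℝ} {f : ℝ → ℝ} {c₀ c₁ : ℝ} (hf : IsDrift f c₀ c₁)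
    {u u₁ w₁ w₂ : ℝ → ℝ} (hu : ∀ x, HasDerivAt u (u₁ x) x) (hu₁ : Continuous u₁)
    (hw : ∀ x, HasDerivAt (fun x => β x (u x)) (w₁ x) x) (hw₁ : ∀ x, HasDerivAt w₁ (w₂ x) x)
    (hw₂ : Continuous w₂) {y v : L1R} (hy : ∀ᵐ x, y x = u x)
    (hv : ∀ᵐ x, v x = -w₂ x - f x * u₁ x) : v ∈ opB β f y := by
  have hβy : (fun x => β x (u x)) =ᵐ[volume] fun x => β x (y x) := by
    filter_upwards [hy] with x hx
    rw [hx]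
  have hc : Continuous fun x => β x (u x) :=
    continuous_iff_continuousAt.2 fun x => (hw x).continuousAt
  have hw₁c : Continuous w₁ := continuous_iff_continuousAt.2 fun x => (hw₁ x).continuousAt
  refine ⟨hc.locallyIntegrable.congr hβy, fun φ hφ => ?_⟩
  have hψ : ContDiff ℝ 1 fun t => f t * φ t :=
    (hf.contDiff.of_le (by norm_num)).mul (hφ.1.of_le (by simp))
  have hψc : HasCompactSupport fun t => f t * φ t := hφ.2.mul_left
  have e1 := (IsAntideriv.of_hasDerivAt hu hu₁).integral_mul_deriv hψ hψc
  have e2 := (IsAntideriv.of_hasDerivAt hw hw₁c).integral_mul_deriv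
    (hφ.deriv.1.of_le (by simp)) hφ.deriv.2
  have e3 := (IsAntideriv.of_hasDerivAt hw₁ hw₂).integral_mul_deriv (hφ.1.of_le (by simp)) hφ.2
  have e4 : ∫ x, y x * deriv (fun t => f t * φ t) x = ∫ x, u x * deriv (fun t => f t * φ t) x := by
    refine integral_congr_ae ?_
    filter_upwards [hy] with x hx
    rw [hx]
  have e5 : ∫ x, β x (y x) * iteratedDeriv 2 φ x = ∫ x, β x (u x) * deriv (deriv φ) x := by
    rw [iteratedDeriv_two]
    refine integral_congr_ae ?_
    filter_upwards [hy] with x hx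
    rw [hx]
  have i1 : Integrable fun x => w₂ x * φ x := hφ.integrable_mul hw₂.locallyIntegrable
  have i2 : Integrable fun x => u₁ x * (f x * φ x) :=
    (hu₁.mul hψ.continuous).integrable_of_hasCompactSupport hψc.mul_left
  have e6 : ∫ x, v x * φ x = -(∫ x, w₂ x * φ x) - ∫ x, u₁ x * (f x * φ x) := by
    have i3 : Integrable fun x => -(w₂ x * φ x) := i1.neg
    rw [← integral_neg, ← integral_sub i3 i2]
    refine integral_congr_ae ?_
    filter_upwards [hv] with x hx
    rw [hx]; ring
  rw [e6, e5, e4, e1, e2, e3]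
  ring

/-- The barrier profile. -/
def bell (x : ℝ) : ℝ := (1 + x ^ 2)⁻¹

/-- The derivative of `bell`. -/
def bell₁ (x : ℝ) : ℝ := -(2 * x) / (1 + x ^ 2) ^ 2

/-- The second derivative of `bell`. -/
def bell₂ (x : ℝ) : ℝ := (6 * x ^ 2 - 2) / (1 + x ^ 2) ^ 3

theorem bell_pos (x : ℝ) : 0 < bell x := by unfold bell; positivity

theorem bell_le_one (x : ℝ) : bell x ≤ 1 := inv_le_one_of_one_le₀ (by nlinarith [sq_nonneg x])

theorem hasDerivAt_bell (x : ℝ) : HasDerivAt bell (bell₁ x) x := by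
  have h : HasDerivAt (fun x : ℝ => 1 + x ^ 2) (2 * x) x := by
    simpa using (hasDerivAt_pow 2 x).const_add 1
  exact h.inv (by positivity)

theorem hasDerivAt_bell₁ (x : ℝ) : HasDerivAt bell₁ (bell₂ x) x := by
  have h : HasDerivAt (fun x : ℝ => 1 + x ^ 2) (2 * x) x := by
    simpa using (hasDerivAt_pow 2 x).const_add 1
  have h0 : 1 + x ^ 2 ≠ 0 := by positivity
  have h1 := (((hasDerivAt_id x).const_mul 2).neg).div (h.pow 2) (pow_ne_zero 2 h0)
  refine h1.congr_deriv ?_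
  simp only [bell₂, id, Pi.neg_apply, Pi.pow_apply]
  rw [div_eq_div_iff (by positivity) (by positivity)]
  push_cast
  ring

theorem continuous_bell : Continuous bell :=
  continuous_iff_continuousAt.2 fun x => (hasDerivAt_bell x).continuousAt

theorem continuous_bell₁ : Continuous bell₁ :=
  continuous_iff_continuousAt.2 fun x => (hasDerivAt_bell₁ x).continuousAt

theorem continuous_bell₂ : Continuous bell₂ := by
  unfold bell₂
  exact Continuous.div (by fun_prop) (by fun_prop) fun x => by positivity

/-- A profile whose derivatives are dominated by itself: all terms of the equation for the barrier
are then comparable with `bell`, and a large zero-order coefficient wins. -/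
theorem abs_bell₁_le (x : ℝ) : |bell₁ x| ≤ bell x := by
  have h0 : 0 < 1 + x ^ 2 := by positivity
  rw [bell₁, bell, abs_div, abs_of_pos (pow_pos h0 2), div_le_iff₀ (pow_pos h0 2), sq (1 + x ^ 2),
    inv_mul_cancel_left₀ h0.ne', abs_le]
  constructor <;> nlinarith [sq_nonneg (x - 1), sq_nonneg (x + 1)]

theorem abs_bell₂_le (x : ℝ) : |bell₂ x| ≤ 6 * bell x := by
  have h0 : 0 < 1 + x ^ 2 := by positivity
  have e : 6 * (1 + x ^ 2)⁻¹ * (1 + x ^ 2) ^ 3 = 6 * (1 + x ^ 2) ^ 2 := by field_simp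
  rw [bell₂, bell, abs_div, abs_of_pos (pow_pos h0 3), div_le_iff₀ (pow_pos h0 3), e, abs_le]
  constructor <;> nlinarith [sq_nonneg x]

theorem integrable_bell : Integrable bell := integrable_inv_one_add_sq

/-- Nonnegative bounded diffusion coefficients with two bounded derivatives. -/
structure IsCoeff (a a₁ a₂ : ℝ → ℝ) (A : ℝ) : Prop where
  hasDerivAt : ∀ x, HasDerivAt a (a₁ x) x
  hasDerivAt₁ : ∀ x, HasDerivAt a₁ (a₂ x) x
  continuous₂ : Continuous a₂
  nonneg : ∀ x, 0 ≤ a x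
  le : ∀ x, a x ≤ A
  abs_le₁ : ∀ x, |a₁ x| ≤ A
  abs_le₂ : ∀ x, |a₂ x| ≤ A
  sq_le : ∀ x, a₁ x ^ 2 ≤ A * a x

namespace IsCoeff

variable {a a₁ a₂ : ℝ → ℝ} {A : ℝ}

theorem continuous (h : IsCoeff a a₁ a₂ A) : Continuous a :=
  continuous_iff_continuousAt.2 fun x => (h.hasDerivAt x).continuousAt

theorem continuous₁ (h : IsCoeff a a₁ a₂ A) : Continuous a₁ :=
  continuous_iff_continuousAt.2 fun x => (h.hasDerivAt₁ x).continuousAt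

theorem nonneg_const (h : IsCoeff a a₁ a₂ A) : 0 ≤ A := (h.nonneg 0).trans (h.le 0)

end IsCoeff

/-- The function u = -N `bell` is a subsolution of the regularized equation: the first-order and
linear second-order contributions are at most (9SA + 6 + c₀) N `bell`, and `lam` leaves one further
N `bell` to lie below F. The comparison principle concludes. -/
theorem neg_bell_le_of_opB {j J f a a₁ a₂ : ℝ → ℝ} {C A c₀ c₁ ε lam N : ℝ} {k : ℕ}
    (hJ : IsApprox j J C k) (hS : 0 ≤ IsConj.slopeAt j 1) (hf : IsDrift f c₀ c₁)
    (ha : IsCoeff a a₁ a₂ A) (hε : 0 < ε) (hε1 : ε ≤ 1) (hN : 0 ≤ N) (hlam : c₁ < lam)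
    (hlam' : 9 * IsConj.slopeAt j 1 * A + 7 + c₀ ≤ lam) {y v : L1R}
    (h : v ∈ opB (fun x r => J (a x * r) + ε * r) f y)
    (hF : ∀ᵐ x, -(N * bell x) ≤ lam * y x + v x) : ∀ᵐ x, -(N * bell x) ≤ y x := by
  obtain ⟨J₁, J₂, B, hJ₁, hJ₂, hJ₂c, hJb⟩ := hJ.smooth
  obtain ⟨L, hL⟩ := hJ.lipMono
  set S := IsConj.slopeAt j 1
  have hA := ha.nonneg_const
  have hB : 0 ≤ B := (hJb 0 le_rfl).2.2.1.trans (hJb 0 le_rfl).2.2.2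
  set q : ℝ → ℝ := fun x => a x * -(N * bell x) with hq
  set q₁ : ℝ → ℝ := fun x => a₁ x * -(N * bell x) + a x * -(N * bell₁ x) with hq₁
  set q₂ : ℝ → ℝ := fun x => (a₂ x * -(N * bell x) + a₁ x * -(N * bell₁ x))
    + (a₁ x * -(N * bell₁ x) + a x * -(N * bell₂ x)) with hq₂
  have dq : ∀ x, HasDerivAt q (q₁ x) x := fun x =>
    (ha.hasDerivAt x).mul ((hasDerivAt_bell x).const_mul N).neg
  have dq₁ : ∀ x, HasDerivAt q₁ (q₂ x) x := fun x =>
    ((ha.hasDerivAt₁ x).mul ((hasDerivAt_bell x).const_mul N).neg).add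
      ((ha.hasDerivAt x).mul ((hasDerivAt_bell₁ x).const_mul N).neg)
  have hqn : ∀ x, q x ≤ 0 := fun x => by
    have := mul_nonneg (ha.nonneg x) (mul_nonneg hN (bell_pos x).le)
    simp only [hq]; linarith
  have cb := continuous_bell
  have cb₁ := continuous_bell₁
  have cb₂ := continuous_bell₂
  have ca := ha.continuous
  have ca₁ := ha.continuous₁
  have ca₂ := ha.continuous₂
  have cf := hf.continuous
  have cJ₁ : Continuous J₁ := continuous_iff_continuousAt.2 fun x => (hJ₂ x).continuousAt
  have cq : Continuous q := by fun_prop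
  have cq₁ : Continuous q₁ := by fun_prop
  have cq₂ : Continuous q₂ := by fun_prop
  have hq₁b : ∀ x, |q₁ x| ≤ 2 * A * N * bell x := fun x => by
    have h1 : |a₁ x * -(N * bell x)| ≤ A * (N * bell x) := by
      rw [abs_mul, abs_neg, abs_of_nonneg (mul_nonneg hN (bell_pos x).le)]
      exact mul_le_mul_of_nonneg_right (ha.abs_le₁ x) (mul_nonneg hN (bell_pos x).le)
    have h2 : |a x * -(N * bell₁ x)| ≤ A * (N * bell x) := by
      rw [abs_mul, abs_neg, abs_mul, abs_of_nonneg hN, abs_of_nonneg (ha.nonneg x)]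
      exact mul_le_mul (ha.le x) (mul_le_mul_of_nonneg_left (abs_bell₁_le x) hN)
        (by positivity) hA
    have := abs_add_le (a₁ x * -(N * bell x)) (a x * -(N * bell₁ x))
    simp only [hq₁]; linarith
  -- The 9 counts a'' `bell` once, a' `bell`' twice, and a `bell`'' with its factor 6.
  have hq₂b : ∀ x, |q₂ x| ≤ 9 * A * N * bell x := fun x => by
    have h1 : |a₂ x * -(N * bell x)| ≤ A * (N * bell x) := by
      rw [abs_mul, abs_neg, abs_of_nonneg (mul_nonneg hN (bell_pos x).le)]
      exact mul_le_mul_of_nonneg_right (ha.abs_le₂ x) (mul_nonneg hN (bell_pos x).le)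
    have h2 : |a₁ x * -(N * bell₁ x)| ≤ A * (N * bell x) := by
      rw [abs_mul, abs_neg, abs_mul, abs_of_nonneg hN]
      exact mul_le_mul (ha.abs_le₁ x) (mul_le_mul_of_nonneg_left (abs_bell₁_le x) hN)
        (by positivity) hA
    have h3 : |a x * -(N * bell₂ x)| ≤ A * (N * (6 * bell x)) := by
      rw [abs_mul, abs_neg, abs_mul, abs_of_nonneg hN, abs_of_nonneg (ha.nonneg x)]
      exact mul_le_mul (ha.le x) (mul_le_mul_of_nonneg_left (abs_bell₂_le x) hN)
        (by positivity) hA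
    have h4 := abs_add_le (a₂ x * -(N * bell x)) (a₁ x * -(N * bell₁ x))
    have h5 := abs_add_le (a₁ x * -(N * bell₁ x)) (a x * -(N * bell₂ x))
    have h6 := abs_add_le (a₂ x * -(N * bell x) + a₁ x * -(N * bell₁ x))
      (a₁ x * -(N * bell₁ x) + a x * -(N * bell₂ x))
    simp only [hq₂]; linarith
  set w₂ : ℝ → ℝ := fun x => (J₂ (q x) * q₁ x * q₁ x + J₁ (q x) * q₂ x) + ε * -(N * bell₂ x)
    with hw₂
  have cw₂ : Continuous w₂ := by fun_prop
  set V : ℝ → ℝ := fun x => -w₂ x - f x * -(N * bell₁ x) with hV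
  have cV : Continuous V := by fun_prop
  have b1 : ∀ x, |J₁ (q x) * q₂ x| ≤ S * (9 * A * N * bell x) := fun x => by
    have := hJb _ (hqn x)
    rw [abs_mul, abs_of_nonneg this.1]
    exact mul_le_mul this.2.1 (hq₂b x) (abs_nonneg _) hS
  have b2 : ∀ x, |ε * -(N * bell₂ x)| ≤ 6 * N * bell x := fun x => by
    rw [abs_mul, abs_neg, abs_mul, abs_of_nonneg hN, abs_of_pos hε]
    have := mul_le_mul hε1 (mul_le_mul_of_nonneg_left (abs_bell₂_le x) hN) (by positivity)
      zero_le_one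
    linarith
  have b3 : ∀ x, |f x * -(N * bell₁ x)| ≤ c₀ * (N * bell x) := fun x => by
    rw [abs_mul, abs_neg, abs_mul, abs_of_nonneg hN]
    exact mul_le_mul (hf.bdd x) (mul_le_mul_of_nonneg_left (abs_bell₁_le x) hN)
      (by positivity) hf.nonneg₀
  -- Convexity of J on the negative axis gives this term the favourable sign. Its size `B`, not
  -- uniform in the regularization, serves only for integrability of `V`.
  have b4 : ∀ x, 0 ≤ J₂ (q x) * q₁ x * q₁ x := fun x => by
    rw [mul_assoc]
    exact mul_nonneg (hJb _ (hqn x)).2.2.1 (mul_self_nonneg _)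
  have b5 : ∀ x, J₂ (q x) * q₁ x * q₁ x ≤ B * (2 * A * N) ^ 2 * bell x := fun x => by
    have h1 : q₁ x * q₁ x ≤ (2 * A * N) ^ 2 * bell x := by
      rw [← sq, ← sq_abs]
      have h2 := pow_le_pow_left₀ (abs_nonneg _) (hq₁b x) 2
      have h3 : bell x ^ 2 ≤ bell x := by nlinarith [bell_pos x, bell_le_one x]
      have h4 := mul_le_mul_of_nonneg_left h3 (sq_nonneg (2 * A * N))
      rw [mul_pow] at h2
      linarith
    rw [mul_assoc, mul_assoc]
    exact mul_le_mul (hJb _ (hqn x)).2.2.2 h1 (mul_self_nonneg _) hB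
  have hVi : Integrable V := by
    refine (integrable_bell.const_mul
      (B * (2 * A * N) ^ 2 + S * (9 * A * N) + 6 * N + c₀ * N)).mono'
      cV.aestronglyMeasurable (Eventually.of_forall fun x => ?_)
    have h1 := abs_le.1 (b1 x)
    have h2 := abs_le.1 (b2 x)
    have h3 := abs_le.1 (b3 x)
    have h4 := b4 x
    have h5 := b5 x
    rw [Real.norm_eq_abs, abs_le]
    simp only [hV, hw₂]
    have e : (B * (2 * A * N) ^ 2 + S * (9 * A * N) + 6 * N + c₀ * N) * bell x
      = B * (2 * A * N) ^ 2 * bell x + S * (9 * A * N * bell x) + 6 * N * bell x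
        + c₀ * (N * bell x) := by ring
    have h6 : 0 ≤ B * (2 * A * N) ^ 2 * bell x := h4.trans h5
    rw [e]
    constructor <;> linarith [h1.1, h1.2, h2.1, h2.2, h3.1, h3.2]
  have hui : Integrable fun x => -(N * bell x) := (integrable_bell.const_mul N).neg
  have hmem : hVi.toL1 V ∈ opB (fun x r => J (a x * r) + ε * r) f (hui.toL1 _) := by
    refine mem_opB_of_hasDerivAt hf (u := fun x => -(N * bell x)) (u₁ := fun x => -(N * bell₁ x))
      (w₁ := fun x => J₁ (q x) * q₁ x + ε * -(N * bell₁ x)) (w₂ := w₂)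
      (fun x => ((hasDerivAt_bell x).const_mul N).neg) (by fun_prop) (fun x => ?_) (fun x => ?_)
      cw₂ hui.coeFn_toL1 hVi.coeFn_toL1
    · exact ((hJ₁ (q x)).comp x (dq x)).add (((hasDerivAt_bell x).const_mul N).neg.const_mul ε)
    · exact (((hJ₂ (q x)).comp x (dq x)).mul (dq₁ x)).add
        (((hasDerivAt_bell₁ x).const_mul N).neg.const_mul ε)
  have hle := ae_le_of_opB (isNonlin_reg hL hε ha.nonneg ha.le) hf hmem h hlam ?_
  · filter_upwards [hle, hui.coeFn_toL1] with x h1 h2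
    rwa [h2] at h1
  · filter_upwards [hui.coeFn_toL1, hVi.coeFn_toL1, hF] with x h1 h2 h3
    rw [h1, h2]
    refine le_trans ?_ h3
    have k1 := abs_le.1 (b1 x)
    have k2 := abs_le.1 (b2 x)
    have k3 := abs_le.1 (b3 x)
    have k4 := b4 x
    have k5 := mul_le_mul_of_nonneg_right hlam' (mul_nonneg hN (bell_pos x).le)
    simp only [hV, hw₂]
    nlinarith [k1.1, k2.1, k3.1]

end DegenerateFP

namespace DegenerateFP

/-! ### Uniform estimates for the regularized problems -/

/-- Uniform estimates for the solution `y` of a regularized problem `lam y + A y = F`; `W` is the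
nonlinearity evaluated at `y`, and `g` is the flux. -/
structure IsRegSol (f a F J : ℝ → ℝ) (lam ε N M D : ℝ) (y g W : ℝ → ℝ) : Prop where
  int_y : Integrable y
  norm_y : ∫ x, |y x| ≤ M
  lower : ∀ᵐ x, -(N * bell x) ≤ y x
  antideriv_g : IsAntideriv g fun x => deriv f x * y x - (F x - lam * y x)
  antideriv_W : IsAntideriv W fun x => g x - f x * y x
  W_eq : ∀ᵐ x, W x = J (a x * y x) + ε * y x
  g_le : ∀ x, |g x| ≤ M
  W_le : ∀ x, |W x| ≤ M
  upper : ∀ᵐ x, a x * y x ≤ M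
  abs_W_le : ∀ᵐ x, |W x| ≤ (D * a x + ε) * |y x|

theorem zero_mem_opB {β : ℝ → ℝ → ℝ} {f : ℝ → ℝ} (h0 : ∀ x, β x 0 = 0) : (0 : L1R) ∈ opB β f 0 := by
  have hz : ∀ᵐ x, (0 : L1R) x = 0 := Lp.coeFn_zero ℝ 1 volume
  have e : (fun _ => (0 : ℝ)) =ᵐ[volume] fun x => β x ((0 : L1R) x) := by
    filter_upwards [hz] with x hx
    rw [hx, h0]
  refine ⟨(locallyIntegrable_const (0 : ℝ)).congr e, fun φ _ => ?_⟩
  have e1 : ∫ x, (0 : L1R) x * φ x = 0 := by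
    rw [← integral_zero ℝ ℝ]
    refine integral_congr_ae ?_
    filter_upwards [hz] with x hx
    rw [hx, zero_mul]
  have e2 : ∫ x, β x ((0 : L1R) x) * iteratedDeriv 2 φ x = 0 := by
    rw [← integral_zero ℝ ℝ]
    refine integral_congr_ae ?_
    filter_upwards [e] with x hx
    rw [← hx, zero_mul]
  have e3 : ∫ x, (0 : L1R) x * deriv (fun t => f t * φ t) x = 0 := by
    rw [← integral_zero ℝ ℝ]
    refine integral_congr_ae ?_
    filter_upwards [hz] with x hx
    rw [hx, zero_mul]
  rw [e1, e2, e3]; simp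

/-- Supplies in every unit interval a point where an a.e. identity holds and y is controlled;
otherwise |y| would have integral at least M + 1 there. -/
theorem exists_abs_le_of_integral_le {y : ℝ → ℝ} {M : ℝ} (hy : Integrable y)
    (hM : ∫ x, |y x| ≤ M) {P : ℝ → Prop} (hP : ∀ᵐ x, P x) (x : ℝ) :
    ∃ t ∈ Icc x (x + 1), P t ∧ |y t| ≤ M + 1 := by
  by_contra! hcon
  have h1 : ∫ t in Icc x (x + 1), (M + 1) ≤ ∫ t in Icc x (x + 1), |y t| := by
    refine setIntegral_mono_on_ae (integrableOn_const (by simp)) hy.abs.integrableOn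
      measurableSet_Icc ?_
    filter_upwards [hP] with t ht hx
    exact (hcon t hx ht).le
  have h2 := setIntegral_le_integral (s := Icc x (x + 1)) hy.abs
    (Eventually.of_forall fun t => abs_nonneg (y t))
  rw [setIntegral_const, Measure.real, Real.volume_Icc, add_sub_cancel_left,
    ENNReal.ofReal_one, ENNReal.toReal_one, one_smul] at h1
  linarith

/-- All constants depend on F and the coefficients but not on the regularization index. Comparison
with the zero solution bounds ‖y‖; integrating g' from -∞ bounds g; good points bound W; coercivity
of J then bounds a y from above, and J is Lipschitz below that bound uniformly. -/
theorem exists_isRegSol {j f a a₁ a₂ : ℝ → ℝ} {C A c₀ c₁ lam N : ℝ} (hj : IsConj j C)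
    (hf : IsDrift f c₀ c₁) (ha : IsCoeff a a₁ a₂ A) (hN : 0 ≤ N) (hlam : c₁ < lam)
    (hlam' : 9 * IsConj.slopeAt j 1 * A + 7 + c₀ ≤ lam) (F : L1R)
    (hF : ∀ᵐ x, |F x| ≤ N * bell x) :
    ∃ M D : ℝ, 0 ≤ M ∧ 0 ≤ D ∧ ∀ k : ℕ, M ≤ k → ∀ J, IsApprox j J C k →
      ∃ y g W, IsRegSol f a F J lam (1 / (k + 1)) N M D y g W := by
  have hA := ha.nonneg_const
  have hc₀ := hf.nonneg₀
  have hc₁ := hf.nonneg₁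
  have hμ : 0 < lam - c₁ := by linarith
  set My := (lam - c₁)⁻¹ * ‖F‖ with hMy
  have hMy0 : 0 ≤ My := by positivity
  set Mg := (c₁ + lam) * My + ‖F‖ with hMg
  have hMg0 : 0 ≤ Mg := by
    have : 0 ≤ lam := by linarith
    positivity
  set R := A * (My + 1) with hR
  have hR0 : 0 ≤ R := by positivity
  set MW := Mg + c₀ * My + IsConj.slopeAt j (R + 1) * R + (My + 1) with hMW
  have hSR := hj.slopeAt_nonneg (R + 1)
  have hMW0 : 0 ≤ MW := by positivity
  set P := MW + |C + j 1| with hP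
  have hP0 : 0 ≤ P := by positivity
  -- For k ≥ P + R the uniform Lipschitz bound on J is available at both levels: R for values at
  -- good points and P for all values of a y.
  refine ⟨P + R, IsConj.slopeAt j (P + 1), by positivity, hj.slopeAt_nonneg _, ?_⟩
  intro k hk J hJ
  obtain ⟨L, hL⟩ := hJ.lipMono
  set ε : ℝ := 1 / (k + 1) with hε
  have hε0 : 0 < ε := by positivity
  have hε1 : ε ≤ 1 := by
    rw [hε, div_le_one (by positivity)]
    linarith [(Nat.cast_nonneg k : (0 : ℝ) ≤ k)]
  obtain ⟨y, v, hv, hFy⟩ := exists_range_reg hL hε0 ha.nonneg ha.le ha.continuous hf hlam F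
  have hnl := isNonlin_reg hL hε0 ha.nonneg ha.le
  set β : ℝ → ℝ → ℝ := fun x r => J (a x * r) + ε * r with hβ
  have hβ0 : ∀ x, β x 0 = 0 := fun x => by simp [hβ, hL.zero]
  have h0 := zero_mem_opB (f := f) hβ0
  have hae : ∀ᵐ x, F x = lam * y x + v x := by
    filter_upwards [Lp.coeFn_add (lam • y) v, Lp.coeFn_smul lam y] with x h1 h2
    rw [hFy, h1, Pi.add_apply, h2]; simp
  have hnorm : ‖y‖ ≤ My := by
    have := (isAccretive_opB hnl hf).norm_sub_le_div hμ (u₁ := y) (u₂ := 0) (w₁ := F) (w₂ := 0)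
      ⟨c₁ • y + v, ⟨v, hv, rfl⟩, by rw [hFy, ← add_assoc, ← add_smul]; simp⟩
      ⟨0, ⟨0, h0, by simp⟩, by simp⟩
    simpa using this
  have hyi := integrable_L1R y
  have hFi := integrable_L1R F
  have hnormy : ∫ x, |y x| ≤ My := by
    rwa [L1.norm_eq_integral_norm] at hnorm
  have hnormF : ∫ x, |F x| = ‖F‖ := by rw [L1.norm_eq_integral_norm]; rfl
  obtain ⟨g, W, hgW⟩ := exists_fluxRep_sub hnl hf hv h0
  have hz : ∀ᵐ x, (0 : L1R) x = 0 := Lp.coeFn_zero ℝ 1 volume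
  have congrA : ∀ {Q q q' : ℝ → ℝ}, IsAntideriv Q q → (∀ᵐ x, q x = q' x) → IsAntideriv Q q' := by
    intro Q q q' h e
    refine ⟨h.1.congr e, fun s t => ?_⟩
    rw [h.2 s t]
    exact intervalIntegral.integral_congr_ae (e.mono fun x hx _ => hx)
  have hag : IsAntideriv g fun x => deriv f x * y x - (F x - lam * y x) := by
    refine congrA hgW.antideriv_g ?_
    filter_upwards [hz, hae] with x h1 h2
    rw [h1, h2]; ring
  have haW : IsAntideriv W fun x => g x - f x * y x := by
    refine congrA hgW.antideriv_W ?_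
    filter_upwards [hz] with x h1
    rw [h1, sub_zero]
  have hW : ∀ᵐ x, W x = J (a x * y x) + ε * y x := by
    filter_upwards [hz, hgW.ae_eq] with x h1 h2
    rw [h2, h1]
    simp [hβ, hL.zero]
  have hlow : ∀ᵐ x, -(N * bell x) ≤ y x :=
    neg_bell_le_of_opB hJ (hj.slopeAt_nonneg 1) hf ha hε0 hε1 hN hlam hlam' hv (by
      filter_upwards [hae, hF] with x h1 h2
      rw [← h1]
      exact (abs_le.1 h2).1)
  set p : ℝ → ℝ := fun x => deriv f x * y x - (F x - lam * y x) with hp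
  have hpi : Integrable p := (hf.integrable_deriv_mul hyi).sub (hFi.sub (hyi.const_mul lam))
  have hpb : ∫ x, |p x| ≤ Mg := by
    have h1 : ∫ x, |p x| ≤ ∫ x, ((c₁ + lam) * |y x| + |F x|) := by
      refine integral_mono hpi.abs ((hyi.abs.const_mul _).add hFi.abs) fun x => ?_
      have h2 : |deriv f x * y x| ≤ c₁ * |y x| := by
        rw [abs_mul]
        exact mul_le_mul_of_nonneg_right (hf.bdd_deriv x) (abs_nonneg _)
      have h3 : |lam * y x| = lam * |y x| := by rw [abs_mul, abs_of_pos (by linarith)]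
      have h4 := abs_sub (deriv f x * y x) (F x - lam * y x)
      have h5 := abs_sub (F x) (lam * y x)
      simp only [hp]
      linarith
    rw [integral_add (hyi.abs.const_mul _) hFi.abs, integral_const_mul, hnormF] at h1
    have := mul_le_mul_of_nonneg_left hnormy (show 0 ≤ c₁ + lam by linarith)
    linarith
  have hint : ∀ {q : ℝ → ℝ} (_ : Integrable q) (s t : ℝ), |∫ x in s..t, q x| ≤ ∫ x, |q x| := by
    intro q hq s t
    rw [intervalIntegral.abs_integral_eq_abs_integral_uIoc]
    exact abs_integral_le_integral_abs.trans
      (setIntegral_le_integral hq.abs (Eventually.of_forall fun t => abs_nonneg _))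
  have hg : ∀ x, |g x| ≤ Mg := by
    intro x
    have h1 : Tendsto (fun s => |g x - g s|) atBot (𝓝 |g x - 0|) :=
      (hgW.tendsto_bot.const_sub (g x)).abs
    rw [sub_zero] at h1
    refine le_of_tendsto h1 (Eventually.of_forall fun s => ?_)
    rw [hag.2 s x]
    exact (hint hpi s x).trans hpb
  have hgc := hag.continuous
  -- At a good point t of [x, x + 1], |y(t)| ≤ My + 1 controls W(t) through the nonlinearity;
  -- integrating g - f y over at most unit length carries the bound to x.
  have hWb : ∀ x, |W x| ≤ MW := by
    intro x
    obtain ⟨t, ht, ht1, ht2⟩ := exists_abs_le_of_integral_le hyi hnormy hW x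
    have h1 := haW.2 x t
    rw [intervalIntegral.integral_sub (hgc.intervalIntegrable _ _)
      (hf.integrable_mul hyi).intervalIntegrable] at h1
    have h2 : |∫ s in x..t, g s| ≤ Mg * |t - x| :=
      intervalIntegral.norm_integral_le_of_norm_le_const (f := g) (a := x) (b := t) (C := Mg)
        fun s _ => (Real.norm_eq_abs _).trans_le (hg s)
    have h3 : |t - x| ≤ 1 := by rw [abs_le]; constructor <;> linarith [ht.1, ht.2]
    have h4 : |∫ s in x..t, f s * y s| ≤ c₀ * My := by
      refine (hint (hf.integrable_mul hyi) x t).trans ?_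
      have : ∫ x, |f x * y x| ≤ ∫ x, c₀ * |y x| := by
        refine integral_mono (hf.integrable_mul hyi).abs (hyi.abs.const_mul _) fun x => ?_
        simp only [abs_mul]
        exact mul_le_mul_of_nonneg_right (hf.bdd x) (abs_nonneg _)
      rw [integral_const_mul] at this
      exact this.trans (mul_le_mul_of_nonneg_left hnormy hc₀)
    have h5 : |a t * y t| ≤ R := by
      rw [abs_mul, abs_of_nonneg (ha.nonneg t)]
      exact mul_le_mul (ha.le t) ht2 (abs_nonneg _) hA
    have h6 := hJ.lip R (by linarith) (a t * y t) (le_of_abs_le h5) 0 hR0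
    rw [hL.zero, sub_zero, sub_zero] at h6
    have h7 := mul_le_mul_of_nonneg_left h5 hSR
    have h8 : |ε * y t| ≤ My + 1 := by
      rw [abs_mul, abs_of_pos hε0]
      have := mul_le_mul hε1 ht2 (abs_nonneg _) zero_le_one
      linarith
    have h9 : |W t| ≤ IsConj.slopeAt j (R + 1) * R + (My + 1) := by
      rw [ht1]
      exact (abs_add_le _ _).trans (add_le_add (h6.trans h7) h8)
    have h10 : Mg * |t - x| ≤ Mg := mul_le_of_le_one_right hMg0 h3
    have e : W x = W t - ((∫ s in x..t, g s) - ∫ s in x..t, f s * y s) := by rw [← h1]; ring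
    rw [e]
    have h11 := abs_sub (W t) ((∫ s in x..t, g s) - ∫ s in x..t, f s * y s)
    have h12 := abs_sub (∫ s in x..t, g s) (∫ s in x..t, f s * y s)
    linarith
  -- Where y > 0, the viscous part ε y of W is positive and may be dropped before using linear
  -- coercivity of J.
  have hup : ∀ᵐ x, a x * y x ≤ P := by
    filter_upwards [hW] with x hx
    rcases le_or_gt (y x) 0 with h1 | h1
    · exact (mul_nonpos_of_nonneg_of_nonpos (ha.nonneg x) h1).trans hP0
    · have h2 := hJ.lower (a x * y x)
      have h3 := (le_abs_self _).trans (hWb x)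
      have h4 := le_abs_self (C + j 1)
      have h5 := mul_pos hε0 h1
      linarith
  refine ⟨fun x => y x, g, W, hyi, hnormy.trans ?_, hlow, hag, haW, hW,
    fun x => (hg x).trans ?_, fun x => (hWb x).trans ?_, ?_, ?_⟩
  · have : 0 ≤ IsConj.slopeAt j (R + 1) * R := by positivity
    have : 0 ≤ c₀ * My := by positivity
    have := abs_nonneg (C + j 1)
    linarith
  · have : 0 ≤ IsConj.slopeAt j (R + 1) * R := by positivity
    have : 0 ≤ c₀ * My := by positivity
    have := abs_nonneg (C + j 1)
    linarith
  · have := abs_nonneg (C + j 1)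
    linarith
  · filter_upwards [hup] with x hx
    linarith
  · filter_upwards [hup, hW] with x hx hx'
    have h6 := hJ.lip P (by linarith) (a x * y x) hx 0 hP0
    rw [hL.zero, sub_zero, sub_zero, abs_mul, abs_of_nonneg (ha.nonneg x)] at h6
    rw [hx']
    refine (abs_add_le _ _).trans ?_
    rw [abs_mul ε, abs_of_pos hε0]
    linarith

end DegenerateFP

namespace DegenerateFP

/-! ### Cutoff functions and vague limits along an ultrafilter -/

/-- `θ` is a `C²` cutoff of `[0, 1]` supported in `(-∞, 2]`, and `κ` a continuous function
dominating the derivatives of `θ` and supported in `(0, 4]`. -/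
structure IsCutoff (θ θ₁ θ₂ κ : ℝ → ℝ) (B : ℝ) : Prop where
  hasDerivAt : ∀ t, HasDerivAt θ (θ₁ t) t
  hasDerivAt₁ : ∀ t, HasDerivAt θ₁ (θ₂ t) t
  continuous₂ : Continuous θ₂
  continuous_dom : Continuous κ
  nonneg : ∀ t, 0 ≤ θ t
  le_one : ∀ t, θ t ≤ 1
  eq_one : ∀ t ≤ 1, θ t = 1
  eq_zero : ∀ t, 2 ≤ t → θ t = 0
  dom_nonneg : ∀ t, 0 ≤ κ t
  dom_le_one : ∀ t, κ t ≤ 1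
  dom_zero : κ 0 = 0
  dom_eq_zero : ∀ t, 4 ≤ t → κ t = 0
  abs_le₁ : ∀ t, |θ₁ t| ≤ B * κ t
  abs_le₂ : ∀ t, |θ₂ t| ≤ B * κ t

theorem exists_isCutoff : ∃ (θ θ₁ θ₂ κ : ℝ → ℝ) (B : ℝ), 0 ≤ B ∧ IsCutoff θ θ₁ θ₂ κ B := by
  set θ : ℝ → ℝ := fun t => Real.smoothTransition (2 - t) with hθ
  have hc : ContDiff ℝ ∞ θ := Real.smoothTransition.contDiff.comp (contDiff_const.sub contDiff_id)
  have hone : ∀ t ≤ 1, θ t = 1 := fun t ht => Real.smoothTransition.one_of_one_le (by linarith)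
  have hzero : ∀ t, 2 ≤ t → θ t = 0 := fun t ht =>
    Real.smoothTransition.zero_of_nonpos (by linarith)
  have hc₁ : ContDiff ℝ ∞ (deriv θ) := (contDiff_infty_iff_deriv.1 hc).2
  have hc₂ : ContDiff ℝ ∞ (deriv (deriv θ)) := (contDiff_infty_iff_deriv.1 hc₁).2
  have hop : ∀ {u : ℝ → ℝ} {S : Set ℝ} {c : ℝ}, IsOpen S → (∀ t ∈ S, u t = c) →
      ∀ t ∈ S, deriv u t = 0 := fun {u S c} hS h t ht => by
    have : u =ᶠ[𝓝 t] fun _ => c := by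
      filter_upwards [hS.mem_nhds ht] with s hs using h s hs
    rw [this.deriv_eq, deriv_const]
  have z1 : ∀ t ∈ Ioi (2 : ℝ), deriv θ t = 0 := hop isOpen_Ioi fun t ht => hzero t (le_of_lt ht)
  have z2 : ∀ t ∈ Ioi (2 : ℝ), deriv (deriv θ) t = 0 := hop isOpen_Ioi z1
  have o1 : ∀ t ∈ Iio (1 : ℝ), deriv θ t = 0 := hop isOpen_Iio fun t ht => hone t (le_of_lt ht)
  have o2 : ∀ t ∈ Iio (1 : ℝ), deriv (deriv θ) t = 0 := hop isOpen_Iio o1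
  have hbd : ∀ {u : ℝ → ℝ}, Continuous u → ∃ B, 0 ≤ B ∧ ∀ t ∈ Icc (1 : ℝ) 2, |u t| ≤ B :=
    fun {u} hu => by
      obtain ⟨B, hB⟩ := isCompact_Icc.exists_bound_of_continuousOn (s := Icc (1 : ℝ) 2)
        hu.continuousOn
      exact ⟨B, (norm_nonneg _).trans (hB 1 ⟨le_rfl, by norm_num⟩), hB⟩
  obtain ⟨B₁, hB₁, h₁⟩ := hbd hc₁.continuous
  obtain ⟨B₂, hB₂, h₂⟩ := hbd hc₂.continuous
  have hθ0 : ∀ t, 0 ≤ θ t := fun t => Real.smoothTransition.nonneg _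
  have hθ1 : ∀ t, θ t ≤ 1 := fun t => Real.smoothTransition.le_one _
  -- Equal to 1 on [1, 2], which carries θ' and θ'', yet zero at 0. Therefore κ(b/δ) → 0 pointwise
  -- as δ → 0, including where b = 0.
  set κ : ℝ → ℝ := fun t => θ (t / 2) * (1 - θ (2 * t)) with hκ
  have hκ0 : ∀ t, 0 ≤ κ t := fun t => mul_nonneg (hθ0 _) (sub_nonneg.2 (hθ1 _))
  have hκ1 : ∀ t ∈ Icc (1 : ℝ) 2, κ t = 1 := fun t ht => by
    simp only [hκ]
    rw [hone (t / 2) (by linarith [ht.2]), hzero (2 * t) (by linarith [ht.1])]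
    norm_num
  have key : ∀ {u : ℝ → ℝ} {b : ℝ}, b ≤ B₁ + B₂ → (∀ t ∈ Ioi (2 : ℝ), u t = 0) →
      (∀ t ∈ Iio (1 : ℝ), u t = 0) → (∀ t ∈ Icc (1 : ℝ) 2, |u t| ≤ b) →
      ∀ t, |u t| ≤ (B₁ + B₂) * κ t := fun {u b} hb hz ho hB t => by
    by_cases ht : t ∈ Icc (1 : ℝ) 2
    · rw [hκ1 t ht, mul_one]
      exact (hB t ht).trans hb
    · have : u t = 0 := by
        rcases lt_or_ge t 1 with h | h
        · exact ho t h
        · exact hz t (not_le.1 fun h' => ht ⟨h, h'⟩)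
      rw [this, abs_zero]
      exact mul_nonneg (by positivity) (hκ0 t)
  have hcθ : Continuous θ := hc.continuous
  exact ⟨θ, deriv θ, deriv (deriv θ), κ, B₁ + B₂, by positivity,
    { hasDerivAt := fun t => (hc.differentiable (by simp)).differentiableAt.hasDerivAt
      hasDerivAt₁ := fun t => (hc₁.differentiable (by simp)).differentiableAt.hasDerivAt
      continuous₂ := hc₂.continuous
      continuous_dom := by fun_prop
      nonneg := hθ0
      le_one := hθ1
      eq_one := hone
      eq_zero := hzero
      dom_nonneg := hκ0
      dom_le_one := fun t => by
        have := mul_le_mul (hθ1 (t / 2)) (sub_le_self 1 (hθ0 (2 * t)))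
          (sub_nonneg.2 (hθ1 (2 * t))) zero_le_one
        simpa using this
      dom_zero := by simp only [hκ]; rw [hone (2 * 0) (by norm_num)]; simp
      dom_eq_zero := fun t ht => by simp only [hκ]; rw [hzero (t / 2) (by linarith)]; simp
      abs_le₁ := key (b := B₁) (by linarith) z1 o1 h₁
      abs_le₂ := key (b := B₂) (by linarith) z2 o2 h₂ }⟩

/-- Test functions which are `1` on a compact set and vanish off a neighbourhood. -/
theorem exists_testFun_eq_one {K U : Set ℝ} (hK : IsCompact K) (hU : IsOpen U) (hKU : K ⊆ U) :
    ∃ φ, IsTestFun φ ∧ (∀ x, 0 ≤ φ x) ∧ (∀ x, φ x ≤ 1) ∧ (∀ x ∈ K, φ x = 1) ∧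
      ∀ x, x ∉ U → φ x = 0 := by
  obtain ⟨R, hR⟩ := hK.isBounded.subset_ball 0
  have hV : IsOpen (U ∩ Metric.ball 0 R) := hU.inter Metric.isOpen_ball
  obtain ⟨φ, h0, h1, h⟩ := exists_contMDiffMap_zero_one_of_isClosed (n := (⊤ : ℕ∞))
    (modelWithCornersSelf ℝ ℝ) hV.isClosed_compl hK.isClosed
    (disjoint_left.2 fun x hx hx' => hx ⟨hKU hx', hR hx'⟩)
  refine ⟨φ, ⟨φ.contMDiff.contDiff, ?_⟩, fun x => (h x).1, fun x => (h x).2, fun x hx => h1 hx,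
    fun x hx => h0 fun hx' => hx hx'.1⟩
  refine HasCompactSupport.of_support_subset_isCompact (isCompact_closedBall (0 : ℝ) R)
    fun x hx => ?_
  by_contra hx'
  exact hx (h0 fun hx'' => hx' (Metric.ball_subset_closedBall hx''.2))

theorem exists_ultrafilter_tendsto (U : Ultrafilter ℕ) {s : ℕ → ℝ} {B : ℝ} (h : ∀ n, |s n| ≤ B) :
    ∃ l, Tendsto s U (𝓝 l) := by
  have h1 : ((U.map s : Ultrafilter ℝ) : Filter ℝ) ≤ 𝓟 (Icc (-B) B) := by
    rw [le_principal_iff]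
    exact Filter.mem_map.2 (Filter.univ_mem' fun n => abs_le.1 (h n))
  obtain ⟨l, -, hl⟩ := isCompact_Icc.ultrafilter_le_nhds (U.map s) h1
  exact ⟨l, hl⟩

/-- An ultrafilter makes all limits of ∫ χ uₙ exist at once. They form a positive linear functional
on compactly supported continuous functions, represented by a measure; cutoffs equal to 1 on large
balls bound its total mass by M. -/
theorem exists_vague_limit (U : Ultrafilter ℕ) {u : ℕ → ℝ → ℝ} {M : ℝ}
    (hu : ∀ n, Integrable (u n)) (hu0 : ∀ n, ∀ᵐ x, 0 ≤ u n x) (hM : ∀ n, ∫ x, u n x ≤ M) :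
    ∃ μ : Measure ℝ, IsFiniteMeasure μ ∧ ∀ χ : ℝ → ℝ, Continuous χ → HasCompactSupport χ →
      Tendsto (fun n => ∫ x, χ x * u n x) U (𝓝 (∫ x, χ x ∂μ)) := by
  have hint : ∀ {χ : ℝ → ℝ}, Continuous χ → HasCompactSupport χ → ∀ n,
      Integrable fun x => χ x * u n x := fun {χ} hχ hc n => by
    obtain ⟨B, hB⟩ := hχ.bounded_above_of_compact_support hc
    exact (hu n).bdd_mul hχ.aestronglyMeasurable (Eventually.of_forall hB)
  have hbd : ∀ {χ : ℝ → ℝ}, Continuous χ → HasCompactSupport χ → ∀ {B : ℝ}, (∀ x, |χ x| ≤ B) →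
      ∀ n, |∫ x, χ x * u n x| ≤ B * M := fun {χ} hχ hc {B} hB n => by
    have hB0 : 0 ≤ B := (abs_nonneg _).trans (hB 0)
    calc |∫ x, χ x * u n x| ≤ ∫ x, |χ x * u n x| := abs_integral_le_integral_abs
      _ ≤ ∫ x, B * u n x := by
          refine integral_mono_ae (hint hχ hc n).abs ((hu n).const_mul B) ?_
          filter_upwards [hu0 n] with x hx
          rw [abs_mul, abs_of_nonneg hx]
          exact mul_le_mul_of_nonneg_right (hB x) hx
      _ = B * ∫ x, u n x := integral_const_mul _ _
      _ ≤ B * M := mul_le_mul_of_nonneg_left (hM n) hB0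
  have hlim : ∀ χ : CompactlySupportedContinuousMap ℝ ℝ,
      ∃ l, Tendsto (fun n => ∫ x, χ x * u n x) U (𝓝 l) := fun χ => by
    obtain ⟨B, hB⟩ := χ.continuous.bounded_above_of_compact_support χ.hasCompactSupport
    exact exists_ultrafilter_tendsto U (hbd χ.continuous χ.hasCompactSupport hB)
  choose Λ hΛ using hlim
  let L : CompactlySupportedContinuousMap ℝ ℝ →ₗ[ℝ] ℝ :=
    { toFun := Λ
      map_add' := fun χ ψ => by
        refine tendsto_nhds_unique (hΛ (χ + ψ)) (((hΛ χ).add (hΛ ψ)).congr fun n => ?_)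
        have i1 : Integrable fun x => χ x * u n x := hint χ.continuous χ.hasCompactSupport n
        have i2 : Integrable fun x => ψ x * u n x := hint ψ.continuous ψ.hasCompactSupport n
        rw [← integral_add i1 i2]
        refine integral_congr_ae (Eventually.of_forall fun x => ?_)
        simp [add_mul]
      map_smul' := fun c χ => by
        refine tendsto_nhds_unique (hΛ (c • χ)) (((hΛ χ).const_mul c).congr fun n => ?_)
        rw [← integral_const_mul]
        refine integral_congr_ae (Eventually.of_forall fun x => ?_)
        simp [mul_assoc] }
  let Lp : CompactlySupportedContinuousMap ℝ ℝ →ₚ[ℝ] ℝ := PositiveLinearMap.mk₀ L fun χ hχ => by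
    refine ge_of_tendsto (hΛ χ) (Eventually.of_forall fun n => integral_nonneg_of_ae ?_)
    filter_upwards [hu0 n] with x hx
    exact mul_nonneg (hχ x) hx
  have hLp : ∀ χ, Lp χ = Λ χ := fun χ => rfl
  set μ := RealRMK.rieszMeasure Lp with hμ
  refine ⟨μ, ?_, fun χ hχ hc => ?_⟩
  · have hball : ∀ m : ℕ, μ (Metric.closedBall 0 m) ≤ ENNReal.ofReal M := by
      intro m
      obtain ⟨φ, hφ, h0, h1, h2, -⟩ := exists_testFun_eq_one
        (isCompact_closedBall (0 : ℝ) m) isOpen_univ (subset_univ _)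
      let χ : CompactlySupportedContinuousMap ℝ ℝ := ⟨⟨φ, hφ.1.continuous⟩, hφ.2⟩
      refine (RealRMK.rieszMeasure_le_of_eq_one Lp (f := χ) h0 (isCompact_closedBall 0 m) h2).trans
        (ENNReal.ofReal_le_ofReal ?_)
      rw [hLp]
      refine le_of_tendsto (hΛ χ) (Eventually.of_forall fun n => ?_)
      have := hbd hφ.1.continuous hφ.2 (B := 1) (fun x => by rw [abs_of_nonneg (h0 x)]; exact h1 x) n
      rw [one_mul] at this
      exact (le_abs_self _).trans this
    refine ⟨lt_of_le_of_lt ?_ (ENNReal.ofReal_lt_top (r := M))⟩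
    rw [← Metric.iUnion_closedBall_nat (0 : ℝ),
      Monotone.measure_iUnion fun m n hmn => Metric.closedBall_subset_closedBall (by exact_mod_cast hmn)]
    exact iSup_le hball
  · let χ' : CompactlySupportedContinuousMap ℝ ℝ := ⟨⟨χ, hχ⟩, hc⟩
    have := RealRMK.integral_rieszMeasure Lp χ'
    rw [hLp] at this
    exact this ▸ hΛ χ'

/-- Passage to the limit in estimates which degenerate on a set. -/
theorem integral_le_of_vague_limit {U : Ultrafilter ℕ} {u : ℕ → ℝ → ℝ} {ε : ℕ → ℝ}
    {μ : Measure ℝ} [IsFiniteMeasure μ]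
    (hμ : ∀ χ : ℝ → ℝ, Continuous χ → HasCompactSupport χ →
      Tendsto (fun n => ∫ x, χ x * u n x) U (𝓝 (∫ x, χ x ∂μ)))
    (hε : Tendsto ε U (𝓝 0)) {Φ r : ℕ → ℝ → ℝ} {Φ₀ : ℝ → ℝ} {B c : ℝ} {C : ℕ → ℝ}
    (hΦ : ∀ i, Continuous (Φ i)) (hΦc : ∀ i, HasCompactSupport (Φ i))
    (hr : ∀ i, Continuous (r i)) (hrc : ∀ i, HasCompactSupport (r i))
    (hΦB : ∀ i x, |Φ i x| ≤ B) (hrB : ∀ i x, |r i x| ≤ B)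
    (hΦ₀ : ∀ x, Tendsto (fun i => Φ i x) atTop (𝓝 (Φ₀ x)))
    (hr₀ : ∀ x, Tendsto (fun i => r i x) atTop (𝓝 0))
    (hle : ∀ i n, ∫ x, Φ i x * u n x ≤ c + (∫ x, r i x * u n x) + ε n * C i) :
    ∫ x, Φ₀ x ∂μ ≤ c := by
  -- The order of limits matters: n first, which kills ε n · C i for fixed i although C i may blow
  -- up; then i → ∞, by dominated convergence for the finite measure μ.
  have h1 : ∀ i, ∫ x, Φ i x ∂μ ≤ c + ∫ x, r i x ∂μ := by
    intro i
    have := le_of_tendsto_of_tendsto (hμ _ (hΦ i) (hΦc i))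
      (((hμ _ (hr i) (hrc i)).const_add c).add (hε.mul_const (C i)))
      (Eventually.of_forall fun n => hle i n)
    simpa using this
  have h2 : Tendsto (fun i => ∫ x, Φ i x ∂μ) atTop (𝓝 (∫ x, Φ₀ x ∂μ)) :=
    tendsto_integral_of_dominated_convergence (fun _ => B)
      (fun i => (hΦ i).aestronglyMeasurable) (integrable_const B)
      (fun i => Eventually.of_forall (hΦB i)) (Eventually.of_forall hΦ₀)
  have h3 : Tendsto (fun i => ∫ x, r i x ∂μ) atTop (𝓝 (∫ _, (0 : ℝ) ∂μ)) :=
    tendsto_integral_of_dominated_convergence (fun _ => B)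
      (fun i => (hr i).aestronglyMeasurable) (integrable_const B)
      (fun i => Eventually.of_forall (hrB i)) (Eventually.of_forall hr₀)
  have := le_of_tendsto_of_tendsto' h2 (h3.const_add c) h1
  simpa using this

end DegenerateFP

namespace DegenerateFP

/-! ### Absolute continuity of the vague limit -/

/-- The measure G μ is finite, so by inner regularity compact null sets K suffice. A test function
equal to 1 on K and supported in an open set of small volume shows that K has arbitrarily small G
μ-mass. -/
theorem ae_eq_zero_of_integral_mul_le {μ : Measure ℝ} [IsFiniteMeasure μ] {G : ℝ → ℝ} {B C : ℝ}
    (hG : Measurable G) (h0 : ∀ x, 0 ≤ G x) (hB : ∀ x, G x ≤ B)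
    (h : ∀ φ, IsTestFun φ → (∀ x, 0 ≤ φ x) → (∀ x, φ x ≤ 1) →
      ∫ x, G x * φ x ∂μ ≤ C * ∫ x, φ x) {E : Set ℝ} (hE : volume E = 0) :
    ∀ᵐ x ∂μ, x ∈ E → G x = 0 := by
  have hGi : Integrable G μ := (integrable_const B).mono' hG.aestronglyMeasurable
    (Eventually.of_forall fun x => by rw [Real.norm_eq_abs, abs_of_nonneg (h0 x)]; exact hB x)
  set ν := μ.withDensity fun x => ENNReal.ofReal (G x) with hν
  have : IsFiniteMeasure ν := isFiniteMeasure_withDensity_ofReal hGi.2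
  have hK : ∀ K : Set ℝ, IsCompact K → volume K = 0 → ν K = 0 := by
    intro K hK hK0
    have e : ν K = ENNReal.ofReal (∫ x in K, G x ∂μ) := by
      rw [hν, withDensity_apply _ hK.measurableSet, ofReal_integral_eq_lintegral_ofReal
        hGi.integrableOn (Eventually.of_forall h0)]
    rw [e, ENNReal.ofReal_eq_zero]
    refine le_of_forall_pos_le_add fun η hη => ?_
    rw [zero_add]
    obtain ⟨V, hKV, hV, hVη⟩ := K.exists_isOpen_lt_of_lt (μ := volume)
      (ENNReal.ofReal (η / (|C| + 1))) (by
        rw [hK0]; exact ENNReal.ofReal_pos.2 (by positivity))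
    obtain ⟨φ, hφ, p0, p1, pK, pV⟩ := exists_testFun_eq_one hK hV hKV
    have h1 : ∫ x in K, G x ∂μ ≤ ∫ x, G x * φ x ∂μ := by
      rw [← integral_indicator hK.measurableSet]
      refine integral_mono (hGi.indicator hK.measurableSet)
        (hGi.mul_bdd (c := 1) hφ.1.continuous.aestronglyMeasurable (Eventually.of_forall fun x => by
          rw [Real.norm_eq_abs, abs_of_nonneg (p0 x)]; exact p1 x)) fun x => ?_
      by_cases hx : x ∈ K
      · simp [hx, pK x hx]
      · simp only [indicator_of_notMem hx]
        exact mul_nonneg (h0 x) (p0 x)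
    have h2 : ∫ x, φ x ≤ η / (|C| + 1) := by
      have h3 : ∫ x, φ x ≤ ∫ x, V.indicator (fun _ => (1 : ℝ)) x := by
        refine integral_mono hφ.integrable ((integrable_indicator_iff hV.measurableSet).2
          (integrableOn_const (hVη.trans ENNReal.ofReal_lt_top).ne)) fun x => ?_
        by_cases hx : x ∈ V
        · simpa [hx] using p1 x
        · simp [hx, pV x hx]
      rw [integral_indicator hV.measurableSet, setIntegral_const, smul_eq_mul, mul_one] at h3
      exact h3.trans (ENNReal.toReal_le_of_le_ofReal (by positivity) hVη.le)
    have h4 : 0 ≤ ∫ x, φ x := integral_nonneg p0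
    calc ∫ x in K, G x ∂μ ≤ C * ∫ x, φ x := h1.trans (h φ hφ p0 p1)
      _ ≤ (|C| + 1) * ∫ x, φ x :=
        mul_le_mul_of_nonneg_right ((le_abs_self C).trans (by linarith)) h4
      _ ≤ (|C| + 1) * (η / (|C| + 1)) := mul_le_mul_of_nonneg_left h2 (by positivity)
      _ = η := by field_simp
  set E' := toMeasurable volume E with hE'
  have hE'm : MeasurableSet E' := measurableSet_toMeasurable _ _
  have hν0 : ν E' = 0 := by
    rw [hE'm.measure_eq_iSup_isCompact]
    simp only [ENNReal.iSup_eq_zero]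
    intro K hKE hKc
    exact hK K hKc (measure_mono_null hKE (by rw [hE', measure_toMeasurable, hE]))
  rw [hν, withDensity_apply _ hE'm, lintegral_eq_zero_iff hG.ennreal_ofReal] at hν0
  have := (ae_restrict_iff' hE'm).1 hν0
  filter_upwards [this] with x hx hxE
  have := ENNReal.ofReal_eq_zero.1 (hx (subset_toMeasurable _ _ hxE))
  exact le_antisymm this (h0 x)

theorem integrable_mul_of_hasCompactSupport {v u : ℝ → ℝ} (hv : Continuous v)
    (hc : HasCompactSupport v) (hu : Integrable u) : Integrable fun x => v x * u x := by
  obtain ⟨B, hB⟩ := hv.bounded_above_of_compact_support hc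
  exact hu.bdd_mul hv.aestronglyMeasurable (Eventually.of_forall hB)

namespace IsCutoff

variable {θ θ₁ θ₂ κ : ℝ → ℝ} {B : ℝ}

theorem continuous (h : IsCutoff θ θ₁ θ₂ κ B) : Continuous θ :=
  continuous_iff_continuousAt.2 fun x => (h.hasDerivAt x).continuousAt

theorem continuous₁ (h : IsCutoff θ θ₁ θ₂ κ B) : Continuous θ₁ :=
  continuous_iff_continuousAt.2 fun x => (h.hasDerivAt₁ x).continuousAt

/-- The cutoff lives where b < 2δ, so the degenerate bound on w costs only a multiple of δ there.
The next lemma is the analogue for κ, which lives where b < 4δ. -/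
theorem mul_le (h : IsCutoff θ θ₁ θ₂ κ B) {a b δ D ε w u : ℝ} (hab : a ≤ b)
    (hδ : 0 < δ) (hD : 0 ≤ D) (hε : 0 ≤ ε) (hu : 0 ≤ u) (hw : w ≤ (D * a + ε) * u) (hw0 : 0 ≤ w) :
    θ (b / δ) * w ≤ (2 * D * δ + ε) * u := by
  rcases le_or_gt 2 (b / δ) with h2 | h2
  · rw [h.eq_zero _ h2, zero_mul]; positivity
  · rw [div_lt_iff₀ hδ] at h2
    have h3 : D * a ≤ D * (2 * δ) := mul_le_mul_of_nonneg_left (by linarith) hD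
    have h4 : (D * a + ε) * u ≤ (2 * D * δ + ε) * u :=
      mul_le_mul_of_nonneg_right (by linarith) hu
    exact (mul_le_of_le_one_left hw0 (h.le_one _)).trans (hw.trans h4)

theorem dom_mul_le (h : IsCutoff θ θ₁ θ₂ κ B) {a b δ D ε w u : ℝ} (hab : a ≤ b)
    (hδ : 0 < δ) (hD : 0 ≤ D) (hε : 0 ≤ ε) (hu : 0 ≤ u) (hw : w ≤ (D * a + ε) * u) :
    κ (b / δ) * w ≤ (4 * D * δ * κ (b / δ) + ε) * u := by
  rcases le_or_gt 4 (b / δ) with h2 | h2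
  · rw [h.dom_eq_zero _ h2, zero_mul]
    have := mul_nonneg hε hu
    linarith
  · rw [div_lt_iff₀ hδ] at h2
    have h3 : D * a ≤ D * (4 * δ) := mul_le_mul_of_nonneg_left (by linarith) hD
    have h4 : (D * a + ε) * u ≤ (D * (4 * δ) + ε) * u :=
      mul_le_mul_of_nonneg_right (by linarith) hu
    have h5 := mul_le_mul_of_nonneg_left (hw.trans h4) (h.dom_nonneg (b / δ))
    have h6 := mul_le_mul_of_nonneg_right (h.dom_le_one (b / δ)) (mul_nonneg hε hu)
    linarith

theorem dom_mul_self_le (h : IsCutoff θ θ₁ θ₂ κ B) {b δ : ℝ} (hδ : 0 < δ) :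
    κ (b / δ) * b ≤ 4 * δ * κ (b / δ) := by
  rcases le_or_gt 4 (b / δ) with h2 | h2
  · rw [h.dom_eq_zero _ h2]; simp
  · rw [div_lt_iff₀ hδ] at h2
    have := mul_le_mul_of_nonneg_left h2.le (h.dom_nonneg (b / δ))
    linarith

end IsCutoff

namespace IsRegSol

variable {f a a₁ a₂ F J : ℝ → ℝ} {c₀ c₁ A lam ε N M D : ℝ} {y g W : ℝ → ℝ}

theorem abs_le (h : IsRegSol f a F J lam ε N M D y g W) (hN : 0 ≤ N) :
    ∀ᵐ x, |y x| ≤ y x + 2 * (N * bell x) := by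
  filter_upwards [h.lower] with x hx
  have := mul_nonneg hN (bell_pos x).le
  rw [abs_le']
  constructor <;> linarith

theorem integrable_add_bell (h : IsRegSol f a F J lam ε N M D y g W) :
    Integrable fun x => y x + 2 * (N * bell x) :=
  h.int_y.add ((integrable_bell.const_mul N).const_mul 2)

/-- The flux equation tested with `f θ(a / δ) φ`. -/
theorem integral_sq_mul_le (h : IsRegSol f a F J lam ε N M D y g W) (hf : IsDrift f c₀ c₁)
    (ha : IsCoeff a a₁ a₂ A) (hN : 0 ≤ N) (hM : 0 ≤ M) (hD : 0 ≤ D) (hε : 0 ≤ ε)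
    {θ θ₁ θ₂ κ : ℝ → ℝ} {B : ℝ} (hB : 0 ≤ B) (hθ : IsCutoff θ θ₁ θ₂ κ B) {φ χ : ℝ → ℝ} {E K δ : ℝ}
    (hφ : IsTestFun φ) (hχ : IsTestFun χ) (hφ0 : ∀ x, 0 ≤ φ x) (hχ0 : ∀ x, 0 ≤ χ x)
    (hχ1 : ∀ x, χ x ≤ 1) (hφχ : ∀ x, φ x ≤ χ x) (hE : 0 ≤ E) (hφ₁ : ∀ x, |deriv φ x| ≤ E * χ x)
    (hK : ∫ x, (y x + 2 * (N * bell x)) ≤ K) (hδ : 0 < δ) (hδ1 : δ ≤ 1) :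
    ∫ x, f x ^ 2 * θ (a x / δ) * φ x * (y x + 2 * (N * bell x)) ≤
      (M * c₀ + 2 * N * c₀ ^ 2) * (∫ x, φ x)
      + (∫ x, (c₁ + c₀ * E + c₀ * B * A) * (4 * D) * (κ (a x / δ) + δ) * χ x
          * (y x + 2 * (N * bell x)))
      + ε * ((c₁ + c₀ * E + c₀ * B * A) / δ * K) := by
  have hc₀ := hf.nonneg₀
  have hc₁ := hf.nonneg₁
  have hA := ha.nonneg_const
  set S := c₁ + c₀ * E + c₀ * B * A with hS
  have hS0 : 0 ≤ S := by positivity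
  have cf := hf.continuous
  have cf' := hf.continuous_deriv
  have ca := ha.continuous
  have ca₁ := ha.continuous₁
  have cθ := hθ.continuous
  have cθ₁ := hθ.continuous₁
  have cκ := hθ.continuous_dom
  have cφ := hφ.1.continuous
  have cφ' := hφ.deriv.1.continuous
  have cχ := hχ.1.continuous
  set u : ℝ → ℝ := fun x => y x + 2 * (N * bell x) with hu
  have hui : Integrable u := h.integrable_add_bell
  -- The extra factor f turns the transport term f y ψ into f² y, a quantity with a sign up to the
  -- barrier correction.
  set ψ : ℝ → ℝ := fun x => f x * θ (a x / δ) * φ x with hψ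
  set ψ₁ : ℝ → ℝ := fun x => (deriv f x * θ (a x / δ) + f x * (θ₁ (a x / δ) * (a₁ x / δ))) * φ x
    + f x * θ (a x / δ) * deriv φ x with hψ₁
  have dψ : ∀ x, HasDerivAt ψ (ψ₁ x) x := fun x =>
    ((hf.hasDerivAt x).mul ((hθ.hasDerivAt _).comp x ((ha.hasDerivAt x).div_const δ))).mul
      (hφ.1.differentiable (by simp)).differentiableAt.hasDerivAt
  have cψ₁ : Continuous ψ₁ := by fun_prop
  have cψ : Continuous ψ := by fun_prop
  have hψd : deriv ψ = ψ₁ := funext fun x => (dψ x).deriv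
  have hψC : ContDiff ℝ 1 ψ := by
    rw [contDiff_one_iff_deriv]
    exact ⟨fun x => (dψ x).differentiableAt, by rwa [hψd]⟩
  have hψc : HasCompactSupport ψ := hφ.2.mul_left
  have hψ₁c : HasCompactSupport ψ₁ := hψd ▸ hψc.deriv
  have e1 := h.antideriv_W.integral_mul_deriv hψC hψc
  rw [hψd] at e1
  have cW := h.antideriv_W.continuous
  have cg := h.antideriv_g.continuous
  have i1 : Integrable fun x => W x * ψ₁ x :=
    (cW.mul cψ₁).integrable_of_hasCompactSupport hψ₁c.mul_left
  have i2 : Integrable fun x => (g x - f x * y x) * ψ x := by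
    have h1 : Integrable fun x => g x * ψ x :=
      (cg.mul cψ).integrable_of_hasCompactSupport hψc.mul_left
    have h2 := integrable_mul_of_hasCompactSupport (cf.mul cψ) hψc.mul_left h.int_y
    refine (h1.sub h2).congr (Eventually.of_forall fun x => ?_)
    simp only [Pi.sub_apply, Pi.mul_apply]; ring
  have i3 : Integrable fun x => f x ^ 2 * θ (a x / δ) * φ x * u x :=
    integrable_mul_of_hasCompactSupport (v := fun x => f x ^ 2 * θ (a x / δ) * φ x)
      (by fun_prop) hφ.2.mul_left hui
  have i4 : Integrable fun x => S * (4 * D) * (κ (a x / δ) + δ) * χ x * u x :=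
    integrable_mul_of_hasCompactSupport (v := fun x => S * (4 * D) * (κ (a x / δ) + δ) * χ x)
      (by fun_prop) hχ.2.mul_left hui
  have i5 : Integrable fun x => ε * (S / δ) * u x := hui.const_mul _
  have e2 : ∫ x, f x ^ 2 * θ (a x / δ) * φ x * u x
      = (∫ x, W x * ψ₁ x) + ∫ x, ((g x - f x * y x) * ψ x + f x ^ 2 * θ (a x / δ) * φ x * u x) := by
    rw [integral_add i2 i3, e1]; ring
  have b1 : ∫ x, ((g x - f x * y x) * ψ x + f x ^ 2 * θ (a x / δ) * φ x * u x)
      ≤ ∫ x, (M * c₀ + 2 * N * c₀ ^ 2) * φ x := by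
    refine integral_mono (i2.add i3) (hφ.integrable.const_mul _) fun x => ?_
    have h1 : g x * f x ≤ M * c₀ := (le_abs_self _).trans (by
      rw [abs_mul]; exact mul_le_mul (h.g_le x) (hf.bdd x) (abs_nonneg _) hM)
    have h2 : f x ^ 2 ≤ c₀ ^ 2 := by
      rw [← sq_abs]; exact pow_le_pow_left₀ (abs_nonneg _) (hf.bdd x) 2
    have h3 : 2 * (N * bell x) * f x ^ 2 ≤ 2 * N * c₀ ^ 2 := by
      have : 2 * (N * bell x) ≤ 2 * N := by
        have := mul_le_mul_of_nonneg_left (bell_le_one x) hN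
        linarith
      exact mul_le_mul this h2 (sq_nonneg _) (by positivity)
    have h4 : θ (a x / δ) * φ x ≤ φ x := mul_le_of_le_one_left (hφ0 x) (hθ.le_one _)
    have h5 : 0 ≤ θ (a x / δ) * φ x := mul_nonneg (hθ.nonneg _) (hφ0 x)
    have e : (g x - f x * y x) * ψ x + f x ^ 2 * θ (a x / δ) * φ x * u x
      = (g x * f x + 2 * (N * bell x) * f x ^ 2) * (θ (a x / δ) * φ x) := by
      simp only [hψ, hu]; ring
    simp only [e]
    exact (mul_le_mul_of_nonneg_right (add_le_add h1 h3) h5).trans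
      (mul_le_mul_of_nonneg_left h4 (by positivity))
  -- The derivative of the cutoff costs 1/δ, but |W| ≤ (D a + ε) u is of order δ u + ε u on its
  -- support. What remains is a multiple of κ(a/δ) + δ, plus an ε-term allowed to blow up with δ.
  have b2 : ∫ x, W x * ψ₁ x
      ≤ ∫ x, (S * (4 * D) * (κ (a x / δ) + δ) * χ x * u x + ε * (S / δ) * u x) := by
    refine integral_mono_ae i1 (i4.add i5) ?_
    filter_upwards [h.abs_le hN, h.abs_W_le] with x hx hWx
    have hu0 : 0 ≤ u x := (abs_nonneg _).trans hx
    have hX : |W x| ≤ (D * a x + ε) * u x := hWx.trans (mul_le_mul_of_nonneg_left hx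
      (add_nonneg (mul_nonneg hD (ha.nonneg x)) hε))
    have t1 := hθ.mul_le le_rfl hδ hD hε hu0 hX (abs_nonneg _)
    have t2 := hθ.dom_mul_le le_rfl hδ hD hε hu0 hX
    set t := θ (a x / δ)
    set k := κ (a x / δ)
    have ht0 : 0 ≤ t := hθ.nonneg _
    have hk0 : 0 ≤ k := hθ.dom_nonneg _
    have s1 : |deriv f x * t| ≤ c₁ * t := by
      rw [abs_mul, abs_of_nonneg ht0]
      exact mul_le_mul_of_nonneg_right (hf.bdd_deriv x) ht0
    have s2 : |f x * (θ₁ (a x / δ) * (a₁ x / δ))| ≤ c₀ * (B * k * (A / δ)) := by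
      rw [abs_mul, abs_mul, abs_div, abs_of_pos hδ]
      exact mul_le_mul (hf.bdd x) (mul_le_mul (hθ.abs_le₁ _)
        (div_le_div_of_nonneg_right (ha.abs_le₁ x) hδ.le) (by positivity) (by positivity))
        (by positivity) hc₀
    have s3 : |f x * t * deriv φ x| ≤ c₀ * t * (E * χ x) := by
      rw [abs_mul, abs_mul, abs_of_nonneg ht0]
      exact mul_le_mul (mul_le_mul_of_nonneg_right (hf.bdd x) ht0) (hφ₁ x) (abs_nonneg _)
        (by positivity)
    have s4 : |ψ₁ x| ≤ (c₁ * t + c₀ * (B * k * (A / δ)) + c₀ * E * t) * χ x := by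
      have q1 : |(deriv f x * t + f x * (θ₁ (a x / δ) * (a₁ x / δ))) * φ x|
          ≤ (c₁ * t + c₀ * (B * k * (A / δ))) * χ x := by
        rw [abs_mul, abs_of_nonneg (hφ0 x)]
        exact mul_le_mul ((abs_add_le _ _).trans (add_le_add s1 s2)) (hφχ x) (hφ0 x)
          (by positivity)
      have := (abs_add_le _ _).trans (add_le_add q1 s3)
      simp only [hψ₁]
      refine this.trans (le_of_eq ?_)
      ring
    have s5 : W x * ψ₁ x ≤ |W x| * |ψ₁ x| := (le_abs_self _).trans (abs_mul _ _).le
    have s6 := s5.trans (mul_le_mul_of_nonneg_left s4 (abs_nonneg (W x)))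
    have e : |W x| * ((c₁ * t + c₀ * (B * k * (A / δ)) + c₀ * E * t) * χ x)
        = ((c₁ + c₀ * E) * (t * |W x|) + c₀ * B * (A / δ) * (k * |W x|)) * χ x := by ring
    rw [e] at s6
    have s7 : (c₁ + c₀ * E) * (t * |W x|) + c₀ * B * (A / δ) * (k * |W x|)
        ≤ (c₁ + c₀ * E) * ((2 * D * δ + ε) * u x)
          + c₀ * B * (A / δ) * ((4 * D * δ * k + ε) * u x) :=
      add_le_add (mul_le_mul_of_nonneg_left t1 (by positivity))
        (mul_le_mul_of_nonneg_left t2 (by positivity))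
    have hεδ : ε ≤ ε / δ := by
      rw [le_div_iff₀ hδ]; exact mul_le_of_le_one_right hε hδ1
    have s8 : (c₁ + c₀ * E) * ((2 * D * δ + ε) * u x)
          + c₀ * B * (A / δ) * ((4 * D * δ * k + ε) * u x)
        ≤ S * (4 * D) * (k + δ) * u x + ε * (S / δ) * u x := by
      have e1 : c₀ * B * (A / δ) * ((4 * D * δ * k + ε) * u x)
        = c₀ * B * A * (4 * D * k + ε / δ) * u x := by field_simp
      have e2 : S * (4 * D) * (k + δ) * u x + ε * (S / δ) * u x
        = S * (4 * D * (k + δ) + ε / δ) * u x := by field_simp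
      rw [e1, e2, ← mul_assoc, ← add_mul]
      refine mul_le_mul_of_nonneg_right ?_ hu0
      have p1 : (c₁ + c₀ * E) * (2 * D * δ + ε) ≤ (c₁ + c₀ * E) * (4 * D * (k + δ) + ε / δ) := by
        refine mul_le_mul_of_nonneg_left ?_ (by positivity)
        have : 0 ≤ D * k := by positivity
        have : 0 ≤ D * δ := by positivity
        linarith
      have p2 : c₀ * B * A * (4 * D * k + ε / δ) ≤ c₀ * B * A * (4 * D * (k + δ) + ε / δ) := by
        refine mul_le_mul_of_nonneg_left ?_ (by positivity)
        have : 0 ≤ D * δ := by positivity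
        linarith
      have p3 : S * (4 * D * (k + δ) + ε / δ) = (c₁ + c₀ * E) * (4 * D * (k + δ) + ε / δ)
        + c₀ * B * A * (4 * D * (k + δ) + ε / δ) := by rw [hS]; ring
      rw [p3]
      exact add_le_add p1 p2
    have s9 := s6.trans (mul_le_mul_of_nonneg_right (s7.trans s8) (hχ0 x))
    refine s9.trans ?_
    have : ε * (S / δ) * u x * χ x ≤ ε * (S / δ) * u x :=
      mul_le_of_le_one_right (by positivity) (hχ1 x)
    linarith
  rw [integral_add i4 i5, integral_const_mul] at b2
  rw [integral_const_mul] at b1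
  have b3 : ε * (S / δ) * ∫ x, u x ≤ ε * (S / δ * K) := by
    rw [mul_assoc]
    exact mul_le_mul_of_nonneg_left (mul_le_mul_of_nonneg_left hK (by positivity)) hε
  rw [e2]
  linarith

end IsRegSol

end DegenerateFP

namespace DegenerateFP

namespace IsRegSol

variable {f a a₁ a₂ F J : ℝ → ℝ} {c₀ c₁ A lam ε N M D : ℝ} {y g W : ℝ → ℝ}

set_option maxHeartbeats 1000000 in
/-- The equation tested with `θ(b / δ) φ`. -/
theorem integral_mul_le (h : IsRegSol f a F J lam ε N M D y g W) (hf : IsDrift f c₀ c₁)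
    (hF : Integrable F) (hFN : ∀ᵐ x, |F x| ≤ N * bell x)
    (ha : ∀ x, 0 ≤ a x) (hN : 0 ≤ N) (hD : 0 ≤ D) (hε : 0 ≤ ε) (hlam : c₁ < lam)
    {θ θ₁ θ₂ κ : ℝ → ℝ} {B : ℝ} (hB : 0 ≤ B) (hθ : IsCutoff θ θ₁ θ₂ κ B) {b b₁ b₂ φ χ : ℝ → ℝ}
    {E K δ : ℝ} (hb : ∀ x, HasDerivAt b (b₁ x) x) (hb₁ : ∀ x, HasDerivAt b₁ (b₂ x) x)
    (cb₂ : Continuous b₂) (hab : ∀ x, a x ≤ b x) (hfb : ∀ x, f x ^ 2 ≤ b x) (hE : 0 ≤ E)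
    (hbE : ∀ x, b₁ x ^ 2 ≤ E * b x)
    (hφ : IsTestFun φ) (hχ : IsTestFun χ) (hφ0 : ∀ x, 0 ≤ φ x) (hχ0 : ∀ x, 0 ≤ χ x)
    (hχ1 : ∀ x, χ x ≤ 1) (hφχ : ∀ x, φ x ≤ χ x) (hφ₁ : ∀ x, |deriv φ x| ≤ E * χ x)
    (hφ₂ : ∀ x, |deriv (deriv φ) x| ≤ E * χ x) (hb₂φ : ∀ x, |b₂ x * φ x| ≤ E * χ x)
    (hb₁φ : ∀ x, |b₁ x * deriv φ x| ≤ E * χ x)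
    (hK : ∫ x, (y x + 2 * (N * bell x)) ≤ K) (hδ : 0 < δ) (hδ1 : δ ≤ 1) :
    ∫ x, (deriv f x + lam) * θ (b x / δ) * φ x * (y x + 2 * (N * bell x)) ≤
      (N + 2 * N * (c₁ + lam)) * (∫ x, φ x)
      + (∫ x, (28 * B * E * D + 2 * E * D + 2 * (1 + E) * B + E) * (κ (b x / δ) + δ
          + θ (b x / δ) * |f x|) * χ x * (y x + 2 * (N * bell x)))
      + ε * ((7 * B * E + E) / δ * K) := by
  have hc₁ := hf.nonneg₁
  have hlam0 : 0 ≤ lam := by linarith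
  have cf := hf.continuous
  have cf' := hf.continuous_deriv
  have cb : Continuous b := continuous_iff_continuousAt.2 fun x => (hb x).continuousAt
  have cb₁ : Continuous b₁ := continuous_iff_continuousAt.2 fun x => (hb₁ x).continuousAt
  have cθ := hθ.continuous
  have cθ₁ := hθ.continuous₁
  have cθ₂ := hθ.continuous₂
  have cκ := hθ.continuous_dom
  have cφ := hφ.1.continuous
  have cφ' := hφ.deriv.1.continuous
  have cφ'' := hφ.deriv.deriv.1.continuous
  have cχ := hχ.1.continuous
  set C := 28 * B * E * D + 2 * E * D + 2 * (1 + E) * B + E with hC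
  have hC0 : 0 ≤ C := by positivity
  set u : ℝ → ℝ := fun x => y x + 2 * (N * bell x) with hu
  have hui : Integrable u := h.integrable_add_bell
  -- With two integrations by parts, the term to be estimated is (f' + lam) ψ y. The cutoff is in b,
  -- which dominates both a and f², so its first derivatives may also meet the drift f y.
  set ψ : ℝ → ℝ := fun x => θ (b x / δ) * φ x with hψ
  set ψ₁ : ℝ → ℝ := fun x => θ₁ (b x / δ) * (b₁ x / δ) * φ x + θ (b x / δ) * deriv φ x with hψ₁
  set ψ₂ : ℝ → ℝ := fun x => ((θ₂ (b x / δ) * (b₁ x / δ) * (b₁ x / δ)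
    + θ₁ (b x / δ) * (b₂ x / δ)) * φ x + θ₁ (b x / δ) * (b₁ x / δ) * deriv φ x)
    + (θ₁ (b x / δ) * (b₁ x / δ) * deriv φ x + θ (b x / δ) * deriv (deriv φ) x) with hψ₂
  have dφ : ∀ x, HasDerivAt φ (deriv φ x) x := fun x =>
    (hφ.1.differentiable (by simp)).differentiableAt.hasDerivAt
  have dφ' : ∀ x, HasDerivAt (deriv φ) (deriv (deriv φ) x) x := fun x =>
    (hφ.deriv.1.differentiable (by simp)).differentiableAt.hasDerivAt
  have dθ : ∀ x, HasDerivAt (fun x => θ (b x / δ)) (θ₁ (b x / δ) * (b₁ x / δ)) x := fun x =>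
    (hθ.hasDerivAt _).comp x ((hb x).div_const δ)
  have dθ₁ : ∀ x, HasDerivAt (fun x => θ₁ (b x / δ)) (θ₂ (b x / δ) * (b₁ x / δ)) x := fun x =>
    (hθ.hasDerivAt₁ _).comp x ((hb x).div_const δ)
  have dψ : ∀ x, HasDerivAt ψ (ψ₁ x) x := fun x => (dθ x).mul (dφ x)
  have dψ₁ : ∀ x, HasDerivAt ψ₁ (ψ₂ x) x := fun x =>
    (((dθ₁ x).mul ((hb₁ x).div_const δ)).mul (dφ x)).add ((dθ x).mul (dφ' x))
  have cψ : Continuous ψ := by fun_prop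
  have cψ₁ : Continuous ψ₁ := by fun_prop
  have cψ₂ : Continuous ψ₂ := by fun_prop
  have hψd : deriv ψ = ψ₁ := funext fun x => (dψ x).deriv
  have hψ₁d : deriv ψ₁ = ψ₂ := funext fun x => (dψ₁ x).deriv
  have hψC : ContDiff ℝ 1 ψ := by
    rw [contDiff_one_iff_deriv]
    exact ⟨fun x => (dψ x).differentiableAt, by rwa [hψd]⟩
  have hψ₁C : ContDiff ℝ 1 ψ₁ := by
    rw [contDiff_one_iff_deriv]
    exact ⟨fun x => (dψ₁ x).differentiableAt, by rwa [hψ₁d]⟩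
  have hψc : HasCompactSupport ψ := hφ.2.mul_left
  have hψ₁c : HasCompactSupport ψ₁ := hψd ▸ hψc.deriv
  have hψ₂c : HasCompactSupport ψ₂ := hψ₁d ▸ hψ₁c.deriv
  have e1 := h.antideriv_W.integral_mul_deriv hψ₁C hψ₁c
  have e2 := h.antideriv_g.integral_mul_deriv hψC hψc
  rw [hψ₁d] at e1
  rw [hψd] at e2
  have cW := h.antideriv_W.continuous
  have cg := h.antideriv_g.continuous
  have i1 : Integrable fun x => W x * ψ₂ x :=
    (cW.mul cψ₂).integrable_of_hasCompactSupport hψ₂c.mul_left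
  have i2 : Integrable fun x => g x * ψ₁ x :=
    (cg.mul cψ₁).integrable_of_hasCompactSupport hψ₁c.mul_left
  have i3 : Integrable fun x => f x * ψ₁ x * y x :=
    integrable_mul_of_hasCompactSupport (v := fun x => f x * ψ₁ x) (by fun_prop)
      hψ₁c.mul_left h.int_y
  have i4 : Integrable fun x => (deriv f x + lam) * ψ x * y x :=
    integrable_mul_of_hasCompactSupport (v := fun x => (deriv f x + lam) * ψ x) (by fun_prop)
      hψc.mul_left h.int_y
  have i5 : Integrable fun x => ψ x * F x := integrable_mul_of_hasCompactSupport cψ hψc hF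
  have i6 : Integrable fun x => (deriv f x + lam) * ψ x * (2 * (N * bell x)) := by
    have cb := continuous_bell
    exact Continuous.integrable_of_hasCompactSupport (by fun_prop) hψc.mul_left.mul_right
  have i7 : Integrable fun x => C * (κ (b x / δ) + δ + θ (b x / δ) * |f x|) * χ x * u x :=
    integrable_mul_of_hasCompactSupport
      (v := fun x => C * (κ (b x / δ) + δ + θ (b x / δ) * |f x|) * χ x)
      (by fun_prop) hχ.2.mul_left hui
  have i8 : Integrable fun x => ε * ((7 * B * E + E) / δ) * u x := hui.const_mul _
  have e3 : ∫ x, (g x - f x * y x) * ψ₁ x = (∫ x, g x * ψ₁ x) - ∫ x, f x * ψ₁ x * y x := by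
    rw [← integral_sub i2 i3]
    exact integral_congr_ae (Eventually.of_forall fun x => by simp only; ring)
  have e4 : ∫ x, (deriv f x * y x - (F x - lam * y x)) * ψ x
      = (∫ x, (deriv f x + lam) * ψ x * y x) - ∫ x, ψ x * F x := by
    rw [← integral_sub i4 i5]
    exact integral_congr_ae (Eventually.of_forall fun x => by simp only; ring)
  have e5 : ∫ x, (deriv f x + lam) * θ (b x / δ) * φ x * u x
      = (∫ x, (W x * ψ₂ x - f x * ψ₁ x * y x))
        + ∫ x, (ψ x * F x + (deriv f x + lam) * ψ x * (2 * (N * bell x))) := by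
    have e6 : ∫ x, (deriv f x + lam) * θ (b x / δ) * φ x * u x
        = (∫ x, (deriv f x + lam) * ψ x * y x)
          + ∫ x, (deriv f x + lam) * ψ x * (2 * (N * bell x)) := by
      rw [← integral_add i4 i6]
      exact integral_congr_ae (Eventually.of_forall fun x => by simp only [hψ, hu]; ring)
    rw [e6, integral_sub i1 i3, integral_add i5 i6]
    rw [e3] at e1
    rw [e4] at e2
    linarith
  have bd1 : ∫ x, (ψ x * F x + (deriv f x + lam) * ψ x * (2 * (N * bell x)))
      ≤ ∫ x, (N + 2 * N * (c₁ + lam)) * φ x := by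
    refine integral_mono_ae (i5.add i6) (hφ.integrable.const_mul _) ?_
    filter_upwards [hFN] with x hx
    have h1 : F x ≤ N := (le_abs_self _).trans (hx.trans (mul_le_of_le_one_right hN (bell_le_one x)))
    have h2 : (deriv f x + lam) * (2 * (N * bell x)) ≤ (c₁ + lam) * (2 * N) := by
      refine mul_le_mul ?_ ?_ ?_ (by positivity)
      · linarith [(_root_.abs_le.1 (hf.bdd_deriv x)).2]
      · linarith [mul_le_of_le_one_right hN (bell_le_one x)]
      · have := mul_nonneg hN (bell_pos x).le
        linarith
    have h4 : ψ x ≤ φ x := mul_le_of_le_one_left (hφ0 x) (hθ.le_one _)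
    have h5 : 0 ≤ ψ x := mul_nonneg (hθ.nonneg _) (hφ0 x)
    have e : ψ x * F x + (deriv f x + lam) * ψ x * (2 * (N * bell x))
      = (F x + (deriv f x + lam) * (2 * (N * bell x))) * ψ x := by ring
    rw [e]
    have h6 : N + (c₁ + lam) * (2 * N) = N + 2 * N * (c₁ + lam) := by ring
    rw [← h6]
    exact (mul_le_mul_of_nonneg_right (add_le_add h1 h2) h5).trans
      (mul_le_mul_of_nonneg_left h4 (by positivity))
  have bd2 : ∫ x, (W x * ψ₂ x - f x * ψ₁ x * y x)
      ≤ ∫ x, (C * (κ (b x / δ) + δ + θ (b x / δ) * |f x|) * χ x * u x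
        + ε * ((7 * B * E + E) / δ) * u x) := by
    refine integral_mono_ae (i1.sub i3) (i7.add i8) ?_
    filter_upwards [h.abs_le hN, h.abs_W_le] with x hx hWx
    have hu0 : 0 ≤ u x := (abs_nonneg _).trans hx
    have hX : |W x| ≤ (D * a x + ε) * u x := hWx.trans (mul_le_mul_of_nonneg_left hx
      (add_nonneg (mul_nonneg hD (ha x)) hε))
    have t1 := hθ.mul_le (hab x) hδ hD hε hu0 hX (abs_nonneg _)
    have t2 := hθ.dom_mul_le (hab x) hδ hD hε hu0 hX
    have t3 := hθ.dom_mul_self_le (b := b x) hδ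
    have a1 := hθ.abs_le₁ (b x / δ)
    have a2 := hθ.abs_le₂ (b x / δ)
    set t := θ (b x / δ)
    set k := κ (b x / δ)
    have ht0 : 0 ≤ t := hθ.nonneg _
    have hk0 : 0 ≤ k := hθ.dom_nonneg _
    have hχx := hχ0 x
    -- The factor δ⁻² is softened by b₁² ≤ E b and by b ≤ 4δ on the support of κ: only δ⁻¹ remains,
    -- to be compensated by W.
    have s1 : |θ₂ (b x / δ) * (b₁ x / δ) * (b₁ x / δ) * φ x| ≤ 4 * B * E * k / δ * χ x := by
      have q0 : θ₂ (b x / δ) * (b₁ x / δ) * (b₁ x / δ) * φ x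
        = θ₂ (b x / δ) * (b₁ x ^ 2 / δ ^ 2) * φ x := by field_simp
      have q1 : 0 ≤ b₁ x ^ 2 / δ ^ 2 := by positivity
      rw [q0, abs_mul, abs_mul, abs_of_nonneg q1, abs_of_nonneg (hφ0 x)]
      refine mul_le_mul ?_ (hφχ x) (hφ0 x) (by positivity)
      calc |θ₂ (b x / δ)| * (b₁ x ^ 2 / δ ^ 2) ≤ B * k * (E * b x / δ ^ 2) :=
            mul_le_mul a2 (div_le_div_of_nonneg_right (hbE x) (by positivity)) q1 (by positivity)
        _ = B * E / δ ^ 2 * (k * b x) := by ring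
        _ ≤ B * E / δ ^ 2 * (4 * δ * k) := mul_le_mul_of_nonneg_left t3 (by positivity)
        _ = 4 * B * E * k / δ := by field_simp
    have s2 : |θ₁ (b x / δ) * (b₂ x / δ) * φ x| ≤ B * E * k / δ * χ x := by
      have q0 : θ₁ (b x / δ) * (b₂ x / δ) * φ x = θ₁ (b x / δ) * (b₂ x * φ x) / δ := by ring
      rw [q0, abs_div, abs_mul, abs_of_pos hδ]
      have := mul_le_mul a1 (hb₂φ x) (abs_nonneg _) (by positivity)
      refine (div_le_div_of_nonneg_right this hδ.le).trans (le_of_eq ?_)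
      ring
    have s3 : |θ₁ (b x / δ) * (b₁ x / δ) * deriv φ x| ≤ B * E * k / δ * χ x := by
      have q0 : θ₁ (b x / δ) * (b₁ x / δ) * deriv φ x
        = θ₁ (b x / δ) * (b₁ x * deriv φ x) / δ := by ring
      rw [q0, abs_div, abs_mul, abs_of_pos hδ]
      have := mul_le_mul a1 (hb₁φ x) (abs_nonneg _) (by positivity)
      refine (div_le_div_of_nonneg_right this hδ.le).trans (le_of_eq ?_)
      ring
    have s4 : |t * deriv (deriv φ) x| ≤ E * t * χ x := by
      rw [abs_mul, abs_of_nonneg ht0]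
      refine (mul_le_mul_of_nonneg_left (hφ₂ x) ht0).trans (le_of_eq ?_)
      ring
    have s5 : |ψ₂ x| ≤ (7 * B * E / δ * k + E * t) * χ x := by
      have q0 : ψ₂ x = θ₂ (b x / δ) * (b₁ x / δ) * (b₁ x / δ) * φ x
        + θ₁ (b x / δ) * (b₂ x / δ) * φ x + θ₁ (b x / δ) * (b₁ x / δ) * deriv φ x
        + θ₁ (b x / δ) * (b₁ x / δ) * deriv φ x + t * deriv (deriv φ) x := by
        simp only [hψ₂]; ring
      rw [q0]
      refine (abs_add_le _ _).trans ((add_le_add ((abs_add_le _ _).trans (add_le_add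
        ((abs_add_le _ _).trans (add_le_add ((abs_add_le _ _).trans (add_le_add s1 s2)) s3))
        s3)) s4).trans (le_of_eq ?_))
      ring
    have s6 : |f x * ψ₁ x| ≤ (2 * (1 + E) * B * k + E * (t * |f x|)) * χ x := by
      have q1 : |f x * (θ₁ (b x / δ) * (b₁ x / δ) * φ x)| ≤ 2 * (1 + E) * B * k * χ x := by
        -- By f² ≤ b and b₁² ≤ E b, the product f b₁ is of order b; this cancels the δ⁻¹ in the
        -- drift term, where no smallness of W is available.
        have q2 : |f x * b₁ x| ≤ (1 + E) / 2 * b x := by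
          have z1 := hfb x
          have z2 := hbE x
          rw [_root_.abs_le]
          constructor <;> nlinarith [sq_nonneg (f x - b₁ x), sq_nonneg (f x + b₁ x)]
        have q0 : f x * (θ₁ (b x / δ) * (b₁ x / δ) * φ x)
          = θ₁ (b x / δ) * (f x * b₁ x) / δ * φ x := by ring
        rw [q0, abs_mul, abs_div, abs_mul, abs_of_pos hδ, abs_of_nonneg (hφ0 x)]
        refine mul_le_mul ?_ (hφχ x) (hφ0 x) (by positivity)
        rw [div_le_iff₀ hδ]
        calc |θ₁ (b x / δ)| * |f x * b₁ x| ≤ B * k * ((1 + E) / 2 * b x) :=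
              mul_le_mul a1 q2 (abs_nonneg _) (by positivity)
          _ = B * (1 + E) / 2 * (k * b x) := by ring
          _ ≤ B * (1 + E) / 2 * (4 * δ * k) := mul_le_mul_of_nonneg_left t3 (by positivity)
          _ = 2 * (1 + E) * B * k * δ := by ring
      have q3 : |f x * (t * deriv φ x)| ≤ E * (t * |f x|) * χ x := by
        rw [abs_mul, abs_mul, abs_of_nonneg ht0]
        have := mul_le_mul_of_nonneg_left (hφ₁ x) (mul_nonneg (abs_nonneg (f x)) ht0)
        linarith
      have e : f x * ψ₁ x = f x * (θ₁ (b x / δ) * (b₁ x / δ) * φ x) + f x * (t * deriv φ x) := by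
        simp only [hψ₁]; ring
      rw [e, add_mul]
      exact (abs_add_le _ _).trans (add_le_add q1 q3)
    have w1 : W x * ψ₂ x ≤ (7 * B * E / δ * ((4 * D * δ * k + ε) * u x)
        + E * ((2 * D * δ + ε) * u x)) * χ x := by
      refine (le_abs_self _).trans ?_
      rw [abs_mul]
      refine (mul_le_mul_of_nonneg_left s5 (abs_nonneg _)).trans ?_
      have e : |W x| * ((7 * B * E / δ * k + E * t) * χ x)
        = (7 * B * E / δ * (k * |W x|) + E * (t * |W x|)) * χ x := by ring
      rw [e]
      exact mul_le_mul_of_nonneg_right (add_le_add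
        (mul_le_mul_of_nonneg_left t2 (by positivity)) (mul_le_mul_of_nonneg_left t1 hE)) hχx
    have w2 : -(f x * ψ₁ x * y x) ≤ (2 * (1 + E) * B * k + E * (t * |f x|)) * χ x * u x := by
      refine (neg_le_abs _).trans ?_
      rw [abs_mul]
      exact mul_le_mul s6 hx (abs_nonneg _) (by positivity)
    have hεδ : ε ≤ ε / δ := by
      rw [le_div_iff₀ hδ]; exact mul_le_of_le_one_right hε hδ1
    have e7 : 7 * B * E / δ * ((4 * D * δ * k + ε) * u x)
      = (28 * B * E * D * k + ε * (7 * B * E / δ)) * u x := by field_simp; ring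
    have e8 : E * ((2 * D * δ + ε) * u x) ≤ (2 * E * D * δ + ε * (E / δ)) * u x := by
      have : E * ε ≤ ε * (E / δ) := by
        have := mul_le_mul_of_nonneg_left hεδ hE
        calc E * ε ≤ E * (ε / δ) := this
          _ = ε * (E / δ) := by ring
      rw [← mul_assoc]
      refine mul_le_mul_of_nonneg_right ?_ hu0
      linarith
    have w3 : W x * ψ₂ x ≤ (28 * B * E * D * k + 2 * E * D * δ) * χ x * u x
        + ε * ((7 * B * E + E) / δ) * u x := by
      rw [e7] at w1
      have z1 := mul_le_mul_of_nonneg_right e8 hχx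
      have z2 : ε * ((7 * B * E + E) / δ) * u x * χ x ≤ ε * ((7 * B * E + E) / δ) * u x :=
        mul_le_of_le_one_right (by positivity) (hχ1 x)
      have z3 : ε * ((7 * B * E + E) / δ) = ε * (7 * B * E / δ) + ε * (E / δ) := by ring
      rw [z3] at z2 ⊢
      linarith
    have w4 : (28 * B * E * D * k + 2 * E * D * δ) + (2 * (1 + E) * B * k + E * (t * |f x|))
        ≤ C * (k + δ + t * |f x|) := by
      have z1 : 0 ≤ t * |f x| := by positivity
      have e : C * (k + δ + t * |f x|) - ((28 * B * E * D * k + 2 * E * D * δ)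
        + (2 * (1 + E) * B * k + E * (t * |f x|)))
        = (2 * E * D + E) * k + (28 * B * E * D + 2 * (1 + E) * B + E) * δ
          + (28 * B * E * D + 2 * E * D + 2 * (1 + E) * B) * (t * |f x|) := by
        rw [hC]; ring
      have : 0 ≤ (2 * E * D + E) * k + (28 * B * E * D + 2 * (1 + E) * B + E) * δ
          + (28 * B * E * D + 2 * E * D + 2 * (1 + E) * B) * (t * |f x|) := by positivity
      linarith
    have w5 := mul_le_mul_of_nonneg_right (mul_le_mul_of_nonneg_right w4 hχx) hu0
    linarith
  rw [integral_add i7 i8, integral_const_mul] at bd2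
  rw [integral_const_mul] at bd1
  have bd3 : ε * ((7 * B * E + E) / δ) * ∫ x, u x ≤ ε * ((7 * B * E + E) / δ * K) := by
    rw [mul_assoc]
    exact mul_le_mul_of_nonneg_left (mul_le_mul_of_nonneg_left hK (by positivity)) hε
  rw [e5]
  linarith

end IsRegSol

end DegenerateFP

namespace DegenerateFP

/-! ### Passage to the limit in the cutoff estimates. -/

theorem IsTestFun.exists_abs_le_mul {φ χ v : ℝ → ℝ} (hφ : IsTestFun φ)
    (hχ0 : ∀ x, 0 ≤ χ x) (hχ : ∀ x ∈ tsupport φ, χ x = 1) (hv : Continuous v)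
    (hv0 : ∀ x, x ∉ tsupport φ → v x = 0) : ∃ E, 0 ≤ E ∧ ∀ x, |v x| ≤ E * χ x := by
  have hc : HasCompactSupport v := HasCompactSupport.of_support_subset_isCompact hφ.2
    fun x hx => by_contra fun h => hx (hv0 x h)
  obtain ⟨E, hE⟩ := hv.bounded_above_of_compact_support hc
  have hE0 : 0 ≤ E := (norm_nonneg _).trans (hE 0)
  refine ⟨E, hE0, fun x => ?_⟩
  by_cases hx : x ∈ tsupport φ
  · rw [hχ x hx, mul_one]; exact hE x
  · rw [hv0 x hx, abs_zero]; exact mul_nonneg hE0 (hχ0 x)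

theorem tendsto_div_one_div {b : ℝ} (hb : 0 < b) :
    Tendsto (fun i : ℕ => b / (1 / ((i : ℝ) + 1))) atTop atTop := by
  have : (fun i : ℕ => b / (1 / ((i : ℝ) + 1))) = fun i : ℕ => b * ((i : ℝ) + 1) := by
    funext i; field_simp
  rw [this]
  exact (tendsto_atTop_add_const_right _ _ tendsto_natCast_atTop_atTop).const_mul_atTop hb

namespace IsCutoff

variable {θ θ₁ θ₂ κ : ℝ → ℝ} {B : ℝ}

theorem tendsto (h : IsCutoff θ θ₁ θ₂ κ B) {b : ℝ} (hb : 0 ≤ b) :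
    Tendsto (fun i : ℕ => θ (b / (1 / ((i : ℝ) + 1)))) atTop (𝓝 (if b = 0 then 1 else 0)) := by
  rcases hb.eq_or_lt with rfl | hb
  · simp only [zero_div, if_true, h.eq_one 0 zero_le_one]
    exact tendsto_const_nhds
  · rw [if_neg hb.ne']
    refine tendsto_const_nhds.congr' ?_
    filter_upwards [(tendsto_div_one_div hb).eventually_ge_atTop 2] with i hi
    exact (h.eq_zero _ hi).symm

theorem tendsto_dom (h : IsCutoff θ θ₁ θ₂ κ B) {b : ℝ} (hb : 0 ≤ b) :
    Tendsto (fun i : ℕ => κ (b / (1 / ((i : ℝ) + 1)))) atTop (𝓝 0) := by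
  rcases hb.eq_or_lt with rfl | hb
  · simp only [zero_div, h.dom_zero]
    exact tendsto_const_nhds
  · refine tendsto_const_nhds.congr' ?_
    filter_upwards [(tendsto_div_one_div hb).eventually_ge_atTop 4] with i hi
    exact (h.dom_eq_zero _ hi).symm

end IsCutoff

section Limit

variable {f a a₁ a₂ F : ℝ → ℝ} {c₀ c₁ A lam N M D : ℝ} {J y g W : ℕ → ℝ → ℝ} {ε : ℕ → ℝ}
  {U : Ultrafilter ℕ} {μ : Measure ℝ}

set_option maxHeartbeats 1000000 in
-- The cutoffs θ(a/δ) tend to the indicator of {a = 0}, while the remainder κ(a/δ) + δ tends to 0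
-- everywhere. Thus μ has no singular part on {a = 0, f ≠ 0}.
theorem integral_sq_mul_limit_le [IsFiniteMeasure μ]
    (hs : ∀ n, IsRegSol f a F (J n) lam (ε n) N M D (y n) (g n) (W n))
    (hf : IsDrift f c₀ c₁) (ha : IsCoeff a a₁ a₂ A) (hN : 0 ≤ N) (hM : 0 ≤ M) (hD : 0 ≤ D)
    (hε : ∀ n, 0 ≤ ε n) (hεt : Tendsto ε U (𝓝 0)) {K : ℝ}
    (hK : ∀ n, ∫ x, (y n x + 2 * (N * bell x)) ≤ K)
    (hμ : ∀ χ : ℝ → ℝ, Continuous χ → HasCompactSupport χ →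
      Tendsto (fun n => ∫ x, χ x * (y n x + 2 * (N * bell x))) U (𝓝 (∫ x, χ x ∂μ)))
    {φ : ℝ → ℝ} (hφ : IsTestFun φ) (hφ0 : ∀ x, 0 ≤ φ x) (hφ1 : ∀ x, φ x ≤ 1) :
    ∫ x, f x ^ 2 * (if a x = 0 then 1 else 0) * φ x ∂μ
      ≤ (M * c₀ + 2 * N * c₀ ^ 2) * ∫ x, φ x := by
  have hc₀ := hf.nonneg₀
  have hc₁ := hf.nonneg₁
  have hA := ha.nonneg_const
  obtain ⟨χ, hχ, hχ0, hχ1, hχK, -⟩ := exists_testFun_eq_one hφ.2 isOpen_univ (subset_univ _)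
  have hz : ∀ x, x ∉ tsupport φ → φ x = 0 := fun x hx => image_eq_zero_of_notMem_tsupport hx
  have hφχ : ∀ x, φ x ≤ χ x := fun x => by
    by_cases hx : x ∈ tsupport φ
    · rw [hχK x hx]; exact hφ1 x
    · rw [hz x hx]; exact hχ0 x
  obtain ⟨E, hE, hφ₁⟩ := hφ.exists_abs_le_mul hχ0 hχK hφ.deriv.1.continuous fun x hx =>
    image_eq_zero_of_notMem_tsupport fun h => hx (tsupport_deriv_subset h)
  obtain ⟨θ, θ₁, θ₂, κ, B, hB, hθ⟩ := exists_isCutoff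
  have cf := hf.continuous
  have ca := ha.continuous
  have cθ := hθ.continuous
  have cκ := hθ.continuous_dom
  have cφ := hφ.1.continuous
  have cχ := hχ.1.continuous
  set S := (c₁ + c₀ * E + c₀ * B * A) * (4 * D) with hS
  have hS0 : 0 ≤ S := by positivity
  have hδ0 : ∀ i : ℕ, 0 < 1 / ((i : ℝ) + 1) := fun i => by positivity
  have hδ1 : ∀ i : ℕ, 1 / ((i : ℝ) + 1) ≤ 1 := fun i => by
    rw [div_le_one (by positivity)]
    linarith [(Nat.cast_nonneg i : (0 : ℝ) ≤ i)]
  refine integral_le_of_vague_limit hμ hεt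
    (Φ := fun i x => f x ^ 2 * θ (a x / (1 / ((i : ℝ) + 1))) * φ x)
    (r := fun i x => S * (κ (a x / (1 / ((i : ℝ) + 1))) + 1 / ((i : ℝ) + 1)) * χ x)
    (B := c₀ ^ 2 + S * 2)
    (C := fun i => (c₁ + c₀ * E + c₀ * B * A) / (1 / ((i : ℝ) + 1)) * K)
    (fun i => by fun_prop) (fun i => hφ.2.mul_left) (fun i => by fun_prop)
    (fun i => hχ.2.mul_left) (fun i x => ?_) (fun i x => ?_) (fun x => ?_) (fun x => ?_)
    fun i n => (hs n).integral_sq_mul_le hf ha hN hM hD (hε n) hB hθ hφ hχ hφ0 hχ0 hχ1 hφχ hE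
      hφ₁ (hK n) (hδ0 i) (hδ1 i)
  · have h1 : 0 ≤ θ (a x / (1 / ((i : ℝ) + 1))) := hθ.nonneg _
    rw [abs_of_nonneg (mul_nonneg (mul_nonneg (sq_nonneg _) h1) (hφ0 x))]
    have h2 : f x ^ 2 ≤ c₀ ^ 2 := by
      rw [← sq_abs]; exact pow_le_pow_left₀ (abs_nonneg _) (hf.bdd x) 2
    have h3 : f x ^ 2 * θ (a x / (1 / ((i : ℝ) + 1))) * φ x ≤ c₀ ^ 2 * 1 * 1 :=
      mul_le_mul (mul_le_mul h2 (hθ.le_one _) h1 (by positivity)) (hφ1 x) (hφ0 x) (by positivity)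
    linarith
  · have h1 : 0 ≤ κ (a x / (1 / ((i : ℝ) + 1))) := hθ.dom_nonneg _
    have h4 := (hδ0 i).le
    rw [abs_of_nonneg (mul_nonneg (mul_nonneg hS0 (add_nonneg h1 h4)) (hχ0 x))]
    have h3 : S * (κ (a x / (1 / ((i : ℝ) + 1))) + 1 / ((i : ℝ) + 1)) * χ x ≤ S * (1 + 1) * 1 :=
      mul_le_mul (mul_le_mul_of_nonneg_left (add_le_add (hθ.dom_le_one _) (hδ1 i)) hS0) (hχ1 x)
        (hχ0 x) (by positivity)
    have := sq_nonneg c₀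
    linarith
  · exact ((hθ.tendsto (ha.nonneg x)).const_mul _).mul_const _
  · have := (((hθ.tendsto_dom (ha.nonneg x)).add
      (tendsto_one_div_add_atTop_nhds_zero_nat (𝕜 := ℝ))).const_mul S).mul_const (χ x)
    simpa using this

set_option maxHeartbeats 1000000 in
-- Used with b = a + f², whose zero set is {a = f = 0}. The extra remainder θ(b/δ)|f| tends to |f|
-- on {b = 0} and to 0 elsewhere, hence to 0 everywhere.
theorem integral_mul_limit_le [IsFiniteMeasure μ]
    (hs : ∀ n, IsRegSol f a F (J n) lam (ε n) N M D (y n) (g n) (W n))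
    (hf : IsDrift f c₀ c₁) (ha : IsCoeff a a₁ a₂ A) (hF : Integrable F)
    (hFN : ∀ᵐ x, |F x| ≤ N * bell x) (hN : 0 ≤ N) (hD : 0 ≤ D) (hlam : c₁ < lam)
    (hε : ∀ n, 0 ≤ ε n) (hεt : Tendsto ε U (𝓝 0)) {K : ℝ}
    (hK : ∀ n, ∫ x, (y n x + 2 * (N * bell x)) ≤ K)
    (hμ : ∀ χ : ℝ → ℝ, Continuous χ → HasCompactSupport χ →
      Tendsto (fun n => ∫ x, χ x * (y n x + 2 * (N * bell x))) U (𝓝 (∫ x, χ x ∂μ)))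
    {φ : ℝ → ℝ} (hφ : IsTestFun φ) (hφ0 : ∀ x, 0 ≤ φ x) (hφ1 : ∀ x, φ x ≤ 1) :
    ∫ x, (deriv f x + lam) * (if a x + f x ^ 2 = 0 then 1 else 0) * φ x ∂μ
      ≤ (N + 2 * N * (c₁ + lam)) * ∫ x, φ x := by
  have hc₀ := hf.nonneg₀
  have hc₁ := hf.nonneg₁
  have hA := ha.nonneg_const
  obtain ⟨χ, hχ, hχ0, hχ1, hχK, -⟩ := exists_testFun_eq_one hφ.2 isOpen_univ (subset_univ _)
  have hz : ∀ x, x ∉ tsupport φ → φ x = 0 := fun x hx => image_eq_zero_of_notMem_tsupport hx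
  have hz₁ : ∀ x, x ∉ tsupport φ → deriv φ x = 0 := fun x hx =>
    image_eq_zero_of_notMem_tsupport fun h => hx (tsupport_deriv_subset h)
  have hz₂ : ∀ x, x ∉ tsupport φ → deriv (deriv φ) x = 0 := fun x hx =>
    image_eq_zero_of_notMem_tsupport fun h =>
      hx (tsupport_deriv_subset (tsupport_deriv_subset h))
  have hφχ : ∀ x, φ x ≤ χ x := fun x => by
    by_cases hx : x ∈ tsupport φ
    · rw [hχK x hx]; exact hφ1 x
    · rw [hz x hx]; exact hχ0 x
  have cf := hf.continuous
  have cf' := hf.continuous_deriv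
  have hf' : ContDiff ℝ 1 (deriv f) := by
    have : ContDiff ℝ (1 + 1) f := by
      have := hf.contDiff
      norm_num
      exact this
    exact ((contDiff_succ_iff_deriv (n := 1)).1 this).2.2
  have cf'' : Continuous (deriv (deriv f)) := hf'.continuous_deriv le_rfl
  have df' : ∀ x, HasDerivAt (deriv f) (deriv (deriv f) x) x := fun x =>
    (hf'.differentiable (by simp)).differentiableAt.hasDerivAt
  have ca := ha.continuous
  have ca₁ := ha.continuous₁
  have ca₂ := ha.continuous₂
  have cφ := hφ.1.continuous
  have cφ' := hφ.deriv.1.continuous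
  have cχ := hχ.1.continuous
  set b : ℝ → ℝ := fun x => a x + f x ^ 2 with hb
  set b₁ : ℝ → ℝ := fun x => a₁ x + 2 * f x * deriv f x with hb₁
  set b₂ : ℝ → ℝ := fun x => a₂ x + (2 * deriv f x * deriv f x + 2 * f x * deriv (deriv f) x)
    with hb₂
  have cb : Continuous b := by fun_prop
  have cb₁ : Continuous b₁ := by fun_prop
  have cb₂ : Continuous b₂ := by fun_prop
  have db : ∀ x, HasDerivAt b (b₁ x) x := fun x => by
    have := (ha.hasDerivAt x).add ((hf.hasDerivAt x).pow 2)
    refine this.congr_deriv ?_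
    simp only [hb₁]; push_cast; ring
  have db₁ : ∀ x, HasDerivAt b₁ (b₂ x) x := fun x =>
    (ha.hasDerivAt₁ x).add (((hf.hasDerivAt x).const_mul 2).mul (df' x))
  obtain ⟨E₁, hE₁, h₁⟩ := hφ.exists_abs_le_mul hχ0 hχK cφ' hz₁
  obtain ⟨E₂, hE₂, h₂⟩ := hφ.exists_abs_le_mul hχ0 hχK hφ.deriv.deriv.1.continuous hz₂
  obtain ⟨E₃, hE₃, h₃⟩ := hφ.exists_abs_le_mul hχ0 hχK (cb₂.mul cφ) fun x hx => by simp [hz x hx]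
  obtain ⟨E₄, hE₄, h₄⟩ := hφ.exists_abs_le_mul hχ0 hχK (cb₁.mul cφ') fun x hx => by
    simp [hz₁ x hx]
  -- The first two terms yield b₁² ≤ 2 a₁² + 8 f² f'² ≤ E b; the others absorb derivatives of φ and
  -- their products with those of b.
  set E := 2 * A + 8 * c₁ ^ 2 + E₁ + E₂ + E₃ + E₄ with hE
  have hE0 : 0 ≤ E := by positivity
  have hup : ∀ {v e : ℝ}, e ≤ E → ∀ {x}, v ≤ e * χ x → v ≤ E * χ x := fun {v e} he {x} hv =>
    hv.trans (mul_le_mul_of_nonneg_right he (hχ0 x))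
  have hc1s := sq_nonneg c₁
  have hbE : ∀ x, b₁ x ^ 2 ≤ E * b x := fun x => by
    have q1 := ha.sq_le x
    have q2 : deriv f x ^ 2 ≤ c₁ ^ 2 := by
      rw [← sq_abs]; exact pow_le_pow_left₀ (abs_nonneg _) (hf.bdd_deriv x) 2
    have q3 := mul_le_mul_of_nonneg_left q2 (sq_nonneg (f x))
    have q4 : b₁ x ^ 2 ≤ 2 * a₁ x ^ 2 + 8 * (f x ^ 2 * deriv f x ^ 2) := by
      simp only [hb₁]; nlinarith [sq_nonneg (a₁ x - 2 * f x * deriv f x)]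
    have q5 : 0 ≤ b x := add_nonneg (ha.nonneg x) (sq_nonneg _)
    have q6 : (2 * A + 8 * c₁ ^ 2) * b x ≤ E * b x :=
      mul_le_mul_of_nonneg_right (by rw [hE]; linarith) q5
    have q7 : 0 ≤ A * f x ^ 2 := by positivity
    have q8 : 0 ≤ c₁ ^ 2 * a x := mul_nonneg hc1s (ha.nonneg x)
    have q9 : (2 * A + 8 * c₁ ^ 2) * b x = 2 * (A * a x) + 2 * (A * f x ^ 2)
      + 8 * (c₁ ^ 2 * a x) + 8 * (f x ^ 2 * c₁ ^ 2) := by simp only [hb]; ring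
    linarith
  obtain ⟨θ, θ₁, θ₂, κ, B, hB, hθ⟩ := exists_isCutoff
  have cθ := hθ.continuous
  have cκ := hθ.continuous_dom
  set S := 28 * B * E * D + 2 * E * D + 2 * (1 + E) * B + E with hS
  have hS0 : 0 ≤ S := by positivity
  have hδ0 : ∀ i : ℕ, 0 < 1 / ((i : ℝ) + 1) := fun i => by positivity
  have hδ1 : ∀ i : ℕ, 1 / ((i : ℝ) + 1) ≤ 1 := fun i => by
    rw [div_le_one (by positivity)]
    linarith [(Nat.cast_nonneg i : (0 : ℝ) ≤ i)]
  have hb0 : ∀ x, 0 ≤ b x := fun x => add_nonneg (ha.nonneg x) (sq_nonneg _)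
  have hlow : ∀ x, 0 ≤ deriv f x + lam ∧ deriv f x + lam ≤ c₁ + lam := fun x => by
    have := abs_le.1 (hf.bdd_deriv x)
    constructor <;> linarith [this.1, this.2]
  refine integral_le_of_vague_limit hμ hεt
    (Φ := fun i x => (deriv f x + lam) * θ (b x / (1 / ((i : ℝ) + 1))) * φ x)
    (r := fun i x => S * (κ (b x / (1 / ((i : ℝ) + 1))) + 1 / ((i : ℝ) + 1)
      + θ (b x / (1 / ((i : ℝ) + 1))) * |f x|) * χ x)
    (B := c₁ + lam + S * (2 + c₀))
    (C := fun i => (7 * B * E + E) / (1 / ((i : ℝ) + 1)) * K)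
    (fun i => by fun_prop) (fun i => hφ.2.mul_left) (fun i => by fun_prop)
    (fun i => hχ.2.mul_left) (fun i x => ?_) (fun i x => ?_) (fun x => ?_) (fun x => ?_)
    fun i n => (hs n).integral_mul_le hf hF hFN ha.nonneg hN hD (hε n) hlam hB hθ db db₁ cb₂
      (fun x => le_add_of_nonneg_right (sq_nonneg _)) (fun x => le_add_of_nonneg_left (ha.nonneg x))
      hE0 hbE hφ hχ hφ0 hχ0 hχ1 hφχ (fun x => hup (by rw [hE]; linarith) (h₁ x))
      (fun x => hup (by rw [hE]; linarith) (h₂ x)) (fun x => hup (by rw [hE]; linarith) (h₃ x))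
      (fun x => hup (by rw [hE]; linarith) (h₄ x)) (hK n) (hδ0 i) (hδ1 i)
  · have h1 : 0 ≤ θ (b x / (1 / ((i : ℝ) + 1))) := hθ.nonneg _
    rw [abs_of_nonneg (mul_nonneg (mul_nonneg (hlow x).1 h1) (hφ0 x))]
    have h3 : (deriv f x + lam) * θ (b x / (1 / ((i : ℝ) + 1))) * φ x ≤ (c₁ + lam) * 1 * 1 :=
      mul_le_mul (mul_le_mul (hlow x).2 (hθ.le_one _) h1 (by linarith)) (hφ1 x) (hφ0 x)
        (by linarith)
    have : 0 ≤ S * (2 + c₀) := by positivity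
    linarith
  · have h1 : 0 ≤ κ (b x / (1 / ((i : ℝ) + 1))) := hθ.dom_nonneg _
    have h2 : 0 ≤ θ (b x / (1 / ((i : ℝ) + 1))) := hθ.nonneg _
    have h4 := (hδ0 i).le
    rw [abs_of_nonneg (mul_nonneg (mul_nonneg hS0 (add_nonneg (add_nonneg h1 h4)
      (mul_nonneg h2 (abs_nonneg _)))) (hχ0 x))]
    have h3 : S * (κ (b x / (1 / ((i : ℝ) + 1))) + 1 / ((i : ℝ) + 1)
        + θ (b x / (1 / ((i : ℝ) + 1))) * |f x|) * χ x ≤ S * (1 + 1 + 1 * c₀) * 1 :=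
      mul_le_mul (mul_le_mul_of_nonneg_left (add_le_add (add_le_add (hθ.dom_le_one _) (hδ1 i))
        (mul_le_mul (hθ.le_one _) (hf.bdd x) (abs_nonneg _) zero_le_one)) hS0) (hχ1 x)
        (hχ0 x) (by positivity)
    linarith
  · exact ((hθ.tendsto (hb0 x)).const_mul _).mul_const _
  · have := ((((hθ.tendsto_dom (hb0 x)).add
      (tendsto_one_div_add_atTop_nhds_zero_nat (𝕜 := ℝ))).add
      ((hθ.tendsto (hb0 x)).mul_const |f x|)).const_mul S).mul_const (χ x)
    have e : S * (0 + 0 + (if b x = 0 then 1 else 0) * |f x|) * χ x = 0 := by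
      by_cases h0 : b x = 0
      · have : f x = 0 := by
          have h5 := ha.nonneg x
          have h6 := sq_nonneg (f x)
          have h7 : f x ^ 2 = 0 := by simp only [hb] at h0; linarith
          exact pow_eq_zero_iff (two_ne_zero) |>.1 h7
        simp [this]
      · simp [h0]
    rwa [e] at this

/-- A null set `T` is split into {a = 0, f ≠ 0}, {a = f = 0} and {a > 0}, each shown to carry no
μ-mass. On the middle piece the weight f' + lam is strictly positive because `lam` > c₁. -/
theorem absolutelyContinuous_limit [IsFiniteMeasure μ]
    (hs : ∀ n, IsRegSol f a F (J n) lam (ε n) N M D (y n) (g n) (W n))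
    (hf : IsDrift f c₀ c₁) (ha : IsCoeff a a₁ a₂ A) (hF : Integrable F)
    (hFN : ∀ᵐ x, |F x| ≤ N * bell x) (hN : 0 ≤ N) (hM : 0 ≤ M) (hD : 0 ≤ D) (hlam : c₁ < lam)
    (hε : ∀ n, 0 ≤ ε n) (hεt : Tendsto ε U (𝓝 0)) {K : ℝ}
    (hK : ∀ n, ∫ x, (y n x + 2 * (N * bell x)) ≤ K)
    (hμ : ∀ χ : ℝ → ℝ, Continuous χ → HasCompactSupport χ →
      Tendsto (fun n => ∫ x, χ x * (y n x + 2 * (N * bell x))) U (𝓝 (∫ x, χ x ∂μ))) :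
    μ ≪ volume := by
  have hc₁ := hf.nonneg₁
  have cf := hf.continuous
  have cf' := hf.continuous_deriv
  have ca := ha.continuous
  intro T hT
  have hlow : ∀ x, 0 < deriv f x + lam ∧ deriv f x + lam ≤ c₁ + lam := fun x => by
    have := abs_le.1 (hf.bdd_deriv x)
    constructor <;> linarith [this.1, this.2]
  have hite : ∀ {p : Prop} [Decidable p], (0 : ℝ) ≤ (if p then 1 else 0) ∧
      (if p then 1 else 0) ≤ (1 : ℝ) := fun {p} _ => by split_ifs <;> simp
  have k1 := ae_eq_zero_of_integral_mul_le (μ := μ)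
    (G := fun x => f x ^ 2 * (if a x = 0 then 1 else 0)) (B := c₀ ^ 2)
    ((cf.pow 2).measurable.mul (Measurable.ite (ca.measurable (measurableSet_singleton 0))
      measurable_const measurable_const))
    (fun x => mul_nonneg (sq_nonneg _) hite.1)
    (fun x => by
      have h2 : f x ^ 2 ≤ c₀ ^ 2 := by
        rw [← sq_abs]; exact pow_le_pow_left₀ (abs_nonneg _) (hf.bdd x) 2
      exact (mul_le_of_le_one_right (sq_nonneg _) hite.2).trans h2)
    (fun φ hφ h0 h1 => integral_sq_mul_limit_le hs hf ha hN hM hD hε hεt hK hμ hφ h0 h1) hT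
  have k2 := ae_eq_zero_of_integral_mul_le (μ := μ)
    (G := fun x => (deriv f x + lam) * (if a x + f x ^ 2 = 0 then 1 else 0)) (B := c₁ + lam)
    ((cf'.add_const lam).measurable.mul (Measurable.ite
      ((show Continuous fun x => a x + f x ^ 2 by fun_prop).measurable (measurableSet_singleton 0))
      measurable_const measurable_const))
    (fun x => mul_nonneg (hlow x).1.le hite.1)
    (fun x => (mul_le_of_le_one_right (hlow x).1.le hite.2).trans (hlow x).2)
    (fun φ hφ h0 h1 =>
      integral_mul_limit_le hs hf ha hF hFN hN hD hlam hε hεt hK hμ hφ h0 h1) hT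
  obtain ⟨θ, θ₁, θ₂, κ, B, hB, hθ⟩ := exists_isCutoff
  have cθ := hθ.continuous
  -- The weight 1 - θ(m a) vanishes unless m a > 1, where y ≤ m M; it equals 1 once m a ≥ 2, so the
  -- weights exhaust {a > 0} as m grows.
  have k3 : ∀ m : ℕ, ∀ᵐ x ∂μ, x ∈ T → 1 - θ (m * a x) = 0 := fun m =>
    ae_eq_zero_of_integral_mul_le (μ := μ) (G := fun x => 1 - θ (m * a x)) (B := 1)
      (C := m * M + 2 * N) (by fun_prop) (fun x => sub_nonneg.2 (hθ.le_one _))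
      (fun x => sub_le_self _ (hθ.nonneg _)) (fun φ hφ h0 h1 => by
        have cφ := hφ.1.continuous
        refine le_of_tendsto (hμ (fun x => (1 - θ (m * a x)) * φ x) (by fun_prop) hφ.2.mul_left)
          (Eventually.of_forall fun n => ?_)
        rw [← integral_const_mul]
        refine integral_mono_ae (integrable_mul_of_hasCompactSupport
          (v := fun x => (1 - θ (m * a x)) * φ x) (by fun_prop)
          hφ.2.mul_left (hs n).integrable_add_bell) (hφ.integrable.const_mul _) ?_
        filter_upwards [(hs n).upper, (hs n).abs_le hN] with x hx hx'
        have hu0 := (abs_nonneg _).trans hx'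
        have hm : (0 : ℝ) ≤ m := Nat.cast_nonneg m
        rcases le_or_gt (m * a x) 1 with h | h
        · rw [hθ.eq_one _ h]
          simp only [sub_self, zero_mul]
          exact mul_nonneg (by positivity) (h0 x)
        · have e1 : y n x ≤ m * M := by
            rcases le_or_gt (y n x) 0 with h2 | h2
            · exact h2.trans (by positivity)
            · have h3 := mul_le_mul_of_nonneg_left hx hm
              have h4 := mul_le_mul_of_nonneg_right h.le h2.le
              linarith
          have e2 : 2 * (N * bell x) ≤ 2 * N := by
            linarith [mul_le_of_le_one_right hN (bell_le_one x)]
          have e3 : (1 - θ (m * a x)) * φ x ≤ φ x :=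
            mul_le_of_le_one_left (h0 x) (sub_le_self _ (hθ.nonneg _))
          calc (1 - θ (m * a x)) * φ x * (y n x + 2 * (N * bell x))
              ≤ φ x * (m * M + 2 * N) :=
                mul_le_mul e3 (add_le_add e1 e2) hu0 (h0 x)
            _ = (m * M + 2 * N) * φ x := mul_comm _ _) hT
  have : ∀ᵐ x ∂μ, x ∉ T := by
    filter_upwards [k1, k2, ae_all_iff.2 k3] with x h1 h2 h3 hx
    have h1 := h1 hx
    have h2 := h2 hx
    by_cases ha0 : a x = 0
    · rw [if_pos ha0, mul_one] at h1
      rw [ha0, h1, add_zero, if_pos rfl, mul_one] at h2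
      exact (hlow x).1.ne' h2
    · have hapos := lt_of_le_of_ne (ha.nonneg x) (Ne.symm ha0)
      obtain ⟨m, hm⟩ := exists_nat_ge (2 / a x)
      have h4 := h3 m hx
      rw [hθ.eq_zero _ (by rwa [div_le_iff₀ hapos] at hm)] at h4
      norm_num at h4
  rw [ae_iff] at this
  simpa using this

end Limit

end DegenerateFP

namespace DegenerateFP

/-! ### Identification of the limit -/

/-- Test with normalized bumps shrinking to x ∈ V; their supports eventually lie in V, and the
averages converge to y(x) at almost every x by Lebesgue differentiation. -/
theorem ae_le_of_integral_mul_le {y : ℝ → ℝ} {V : Set ℝ} {c : ℝ}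
    (hy : LocallyIntegrable y volume) (hV : IsOpen V)
    (h : ∀ χ, IsTestFun χ → (∀ x, 0 ≤ χ x) → (∀ x, x ∉ V → χ x = 0) →
      c * ∫ x, χ x ≤ ∫ x, χ x * y x) : ∀ᵐ x, x ∈ V → c ≤ y x := by
  let b : ℕ → ContDiffBump (0 : ℝ) := fun i =>
    ⟨1 / ((i : ℝ) + 1) / 2, 1 / ((i : ℝ) + 1), by positivity, half_lt_self (by positivity)⟩
  have hb : Tendsto (fun i => (b i).rOut) atTop (𝓝 0) := tendsto_one_div_add_atTop_nhds_zero_nat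
  have hconv := ContDiffBump.ae_convolution_tendsto_right_of_locallyIntegrable (φ := b) (K := 2)
    (μ := volume) hb (Eventually.of_forall fun i => (mul_div_cancel₀ _ two_ne_zero).ge) hy
  filter_upwards [hconv] with x hx hxV
  obtain ⟨r, hr, hrV⟩ := Metric.isOpen_iff.1 hV x hxV
  refine ge_of_tendsto hx ?_
  filter_upwards [hb.eventually_lt_const hr] with i hi
  set χ : ℝ → ℝ := fun t => (b i).normed volume (x - t) with hχ
  have hχ1 : ∫ t, χ t = 1 := by
    rw [hχ, integral_sub_left_eq_self (fun t => (b i).normed volume t) volume x]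
    exact (b i).integral_normed
  have h1 := h χ ⟨(b i).contDiff_normed.comp (contDiff_const.sub contDiff_id),
      (b i).hasCompactSupport_normed.comp_homeomorph (Homeomorph.subLeft x)⟩
    (fun t => (b i).nonneg_normed _) fun t ht => by
      by_contra hne
      have h2 : x - t ∈ Function.support ((b i).normed volume) := hne
      rw [(b i).support_normed_eq, Metric.mem_ball, dist_zero_right, Real.norm_eq_abs] at h2
      refine ht (hrV ?_)
      rw [Metric.mem_ball, Real.dist_eq, abs_sub_comm]
      exact h2.trans hi
  rw [hχ1, mul_one] at h1
  rw [convolution_eq_swap]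
  exact h1

section Limit

variable {f a a₁ a₂ F : ℝ → ℝ} {c₀ c₁ A lam N M D : ℝ} {J y g W : ℕ → ℝ → ℝ} {ε : ℕ → ℝ}
  {U : Ultrafilter ℕ} {y₀ : ℝ → ℝ}

theorem IsRegSol.integral_add_bell_le {J y g W : ℝ → ℝ} {ε : ℝ}
    (h : IsRegSol f a F J lam ε N M D y g W) :
    ∫ x, (y x + 2 * (N * bell x)) ≤ M + 2 * (N * ∫ x, bell x) := by
  rw [integral_add h.int_y ((integrable_bell.const_mul N).const_mul 2), integral_const_mul,
    integral_const_mul]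
  have : ∫ x, y x ≤ ∫ x, |y x| := integral_mono h.int_y h.int_y.abs fun x => le_abs_self _
  linarith [h.norm_y]

/-- Adding 2N `bell` makes the approximations nonnegative and dominates |y|. The weak limit is the
density of the vague limit minus the same function. -/
theorem exists_weak_limit (U : Ultrafilter ℕ)
    (hs : ∀ n, IsRegSol f a F (J n) lam (ε n) N M D (y n) (g n) (W n))
    (hf : IsDrift f c₀ c₁) (ha : IsCoeff a a₁ a₂ A) (hF : Integrable F)
    (hFN : ∀ᵐ x, |F x| ≤ N * bell x) (hN : 0 ≤ N) (hM : 0 ≤ M) (hD : 0 ≤ D) (hlam : c₁ < lam)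
    (hε : ∀ n, 0 ≤ ε n) (hεt : Tendsto ε U (𝓝 0)) :
    ∃ y₀ : ℝ → ℝ, Integrable y₀ ∧ ∀ χ : ℝ → ℝ, Continuous χ → HasCompactSupport χ →
      Tendsto (fun n => ∫ x, χ x * y n x) U (𝓝 (∫ x, χ x * y₀ x)) := by
  have hK := fun n => (hs n).integral_add_bell_le
  obtain ⟨μ, hμf, hμ⟩ := exists_vague_limit U (u := fun n x => y n x + 2 * (N * bell x))
    (fun n => (hs n).integrable_add_bell)
    (fun n => ((hs n).abs_le hN).mono fun x hx => (abs_nonneg _).trans hx) hK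
  have hac := absolutelyContinuous_limit hs hf ha hF hFN hN hM hD hlam hε hεt hK hμ
  have hi : Integrable fun x => (μ.rnDeriv volume x).toReal := Measure.integrable_toReal_rnDeriv
  have hb := (integrable_bell.const_mul N).const_mul 2
  refine ⟨fun x => (μ.rnDeriv volume x).toReal - 2 * (N * bell x), hi.sub hb, fun χ hχ hc => ?_⟩
  have e1 : ∫ x, χ x ∂μ = ∫ x, χ x * (μ.rnDeriv volume x).toReal := by
    rw [← integral_rnDeriv_smul hac]
    simp_rw [smul_eq_mul, mul_comm]
  have i1 := integrable_mul_of_hasCompactSupport hχ hc hi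
  have i2 := integrable_mul_of_hasCompactSupport hχ hc hb
  have h1 := hμ χ hχ hc
  rw [e1] at h1
  have h2 := h1.sub_const (∫ x, χ x * (2 * (N * bell x)))
  rw [← integral_sub i1 i2] at h2
  simp_rw [mul_sub]
  refine h2.congr fun n => ?_
  have i3 := integrable_mul_of_hasCompactSupport hχ hc (hs n).int_y
  rw [← integral_sub (integrable_mul_of_hasCompactSupport hχ hc (hs n).integrable_add_bell) i2]
  exact integral_congr_ae (Eventually.of_forall fun x => by simp only; ring)

theorem ae_le_of_weak_limit (hUy : ∀ χ : ℝ → ℝ, Continuous χ → HasCompactSupport χ →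
      Tendsto (fun n => ∫ x, χ x * y n x) U (𝓝 (∫ x, χ x * y₀ x)))
    (hy : ∀ n, Integrable (y n)) (hy₀ : Integrable y₀) {V : Set ℝ} (hV : IsOpen V) {c : ℝ}
    (h : ∀ᶠ n in (U : Filter ℕ), ∀ᵐ x, x ∈ V → c ≤ y n x) : ∀ᵐ x, x ∈ V → c ≤ y₀ x := by
  refine ae_le_of_integral_mul_le hy₀.locallyIntegrable hV fun χ hχ h0 hχV => ?_
  refine ge_of_tendsto (hUy χ hχ.1.continuous hχ.2) ?_
  filter_upwards [h] with n hn
  rw [← integral_const_mul]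
  refine integral_mono_ae (hχ.integrable.const_mul c)
    (integrable_mul_of_hasCompactSupport hχ.1.continuous hχ.2 (hy n)) ?_
  filter_upwards [hn] with x hx
  by_cases hxV : x ∈ V
  · rw [mul_comm]
    exact mul_le_mul_of_nonneg_left (hx hxV) (h0 x)
  · simp [hχV x hxV]

theorem ae_ge_of_weak_limit (hUy : ∀ χ : ℝ → ℝ, Continuous χ → HasCompactSupport χ →
      Tendsto (fun n => ∫ x, χ x * y n x) U (𝓝 (∫ x, χ x * y₀ x)))
    (hy : ∀ n, Integrable (y n)) (hy₀ : Integrable y₀) {V : Set ℝ} (hV : IsOpen V) {c : ℝ}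
    (h : ∀ᶠ n in (U : Filter ℕ), ∀ᵐ x, x ∈ V → y n x ≤ c) : ∀ᵐ x, x ∈ V → y₀ x ≤ c := by
  have := ae_le_of_weak_limit (U := U) (y := fun n x => -y n x) (y₀ := fun x => -y₀ x) (c := -c)
    (fun χ hχ hc => by
      simp_rw [mul_neg, integral_neg]
      exact (hUy χ hχ hc).neg) (fun n => (hy n).neg) hy₀.neg hV (by
      filter_upwards [h] with n hn
      filter_upwards [hn] with x hx hxV using neg_le_neg (hx hxV))
  filter_upwards [this] with x hx hxV using neg_le_neg_iff.1 (hx hxV)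

/-- Where a ≥ δ one has -N ≤ y ≤ M/δ, so W' = g - f y is bounded independently of the
regularization. This is the compactness on the nondegenerate set. -/
theorem IsRegSol.abs_sub_le {J y g W : ℝ → ℝ} {ε : ℝ}
    (h : IsRegSol f a F J lam ε N M D y g W) (hf : IsDrift f c₀ c₁) (hN : 0 ≤ N) (hM : 0 ≤ M)
    {δ : ℝ} (hδ : 0 < δ) {s t : ℝ} (hst : ∀ x ∈ uIcc s t, δ ≤ a x) :
    |W t - W s| ≤ (M + c₀ * (M / δ + N)) * |t - s| := by
  have hc₀ := hf.nonneg₀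
  rw [h.antideriv_W.2 s t]
  rw [← Real.norm_eq_abs]
  refine intervalIntegral.norm_integral_le_of_norm_le_const_ae ?_
  filter_upwards [h.upper, h.lower] with x hx hx' hxI
  have hax := hst x (uIoc_subset_uIcc hxI)
  have e : |y x| ≤ M / δ + N := by
    rw [abs_le']
    constructor
    · rcases le_or_gt (y x) 0 with h0 | h0
      · exact h0.trans (by positivity)
      · have : y x ≤ M / δ := by
          rw [le_div_iff₀ hδ]
          have := mul_le_mul_of_nonneg_right hax h0.le
          linarith
        linarith
    · have h1 := mul_le_of_le_one_right hN (bell_le_one x)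
      have h2 : 0 ≤ M / δ := by positivity
      linarith
  rw [Real.norm_eq_abs]
  refine (abs_sub _ _).trans (add_le_add (h.g_le x) ?_)
  rw [abs_mul]
  exact mul_le_mul (hf.bdd x) e (abs_nonneg _) hc₀

theorem exists_local_lipschitz
    (hs : ∀ n, IsRegSol f a F (J n) lam (ε n) N M D (y n) (g n) (W n))
    (hf : IsDrift f c₀ c₁) (hac : Continuous a) (hN : 0 ≤ N) (hM : 0 ≤ M) {x₀ : ℝ}
    (hx₀ : 0 < a x₀) : ∃ r > 0, ∃ L, 0 ≤ L ∧ ∀ n, ∀ x ∈ Metric.ball x₀ r,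
      |W n x - W n x₀| ≤ L * |x - x₀| := by
  have hc₀ := hf.nonneg₀
  obtain ⟨r, hr, h⟩ := Metric.eventually_nhds_iff_ball.1
    (hac.continuousAt.eventually_const_lt (half_lt_self hx₀))
  refine ⟨r, hr, M + c₀ * (M / (a x₀ / 2) + N), by positivity, fun n x hx => ?_⟩
  refine (hs n).abs_sub_le hf hN hM (half_pos hx₀) fun z hz => (h z ?_).le
  exact (convex_ball x₀ r).ordConnected.uIcc_subset (Metric.mem_ball_self hr) hx hz

/-- Near a point with a > 0 the functions W n are equi-Lipschitz, so the Cauchy property at a nearby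
rational passes to that point. -/
theorem exists_pointwise_limit
    (hs : ∀ n, IsRegSol f a F (J n) lam (ε n) N M D (y n) (g n) (W n))
    (hf : IsDrift f c₀ c₁) (hac : Continuous a) (hN : 0 ≤ N) (hM : 0 ≤ M)
    (hq : ∀ q : ℚ, ∃ l, Tendsto (fun n => W n q) atTop (𝓝 l)) :
    ∃ w : ℝ → ℝ, ∀ x, 0 < a x → Tendsto (fun n => W n x) atTop (𝓝 (w x)) := by
  suffices h : ∀ x, ∃ l, 0 < a x → Tendsto (fun n => W n x) atTop (𝓝 l) by
    choose w hw using h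
    exact ⟨w, hw⟩
  intro x
  by_cases hx : 0 < a x
  swap
  · exact ⟨0, fun h => absurd h hx⟩
  obtain ⟨r, hr, L, hL, hlip⟩ := exists_local_lipschitz hs hf hac hN hM hx
  suffices hc : CauchySeq fun n => W n x by
    obtain ⟨l, hl⟩ := cauchySeq_tendsto_of_complete hc
    exact ⟨l, fun _ => hl⟩
  rw [Metric.cauchySeq_iff']
  intro e he
  set ρ := min r (e / (4 * (L + 1))) with hρ
  have hρ0 : 0 < ρ := lt_min hr (by positivity)
  obtain ⟨q, hq1, hq2⟩ := exists_rat_btwn (show x < x + ρ by linarith)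
  have hqx : |(q : ℝ) - x| < ρ := by rw [abs_lt]; constructor <;> linarith
  have hqb : (q : ℝ) ∈ Metric.ball x r := by
    rw [Metric.mem_ball, Real.dist_eq]; exact hqx.trans_le (min_le_left _ _)
  have hLq : L * |(q : ℝ) - x| ≤ e / 4 := by
    have h1 : |(q : ℝ) - x| ≤ e / (4 * (L + 1)) := hqx.le.trans (min_le_right _ _)
    calc L * |(q : ℝ) - x| ≤ (L + 1) * (e / (4 * (L + 1))) :=
          mul_le_mul (by linarith) h1 (abs_nonneg _) (by positivity)
      _ = e / 4 := by field_simp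
  obtain ⟨l, hl⟩ := hq q
  obtain ⟨m, hm⟩ := Metric.cauchySeq_iff'.1 hl.cauchySeq (e / 4) (by positivity)
  refine ⟨m, fun n hn => ?_⟩
  have h1 := hm n hn
  have h2 := abs_le.1 ((hlip n q hqb).trans hLq)
  have h3 := abs_le.1 ((hlip m q hqb).trans hLq)
  rw [Real.dist_eq, abs_lt] at h1 ⊢
  constructor <;> linarith [h1.1, h1.2, h2.1, h2.2, h3.1, h3.2]

/-- A countable product of compact intervals is sequentially compact; this is the diagonal
extraction. -/
theorem exists_subseq_tendsto {M : ℝ} (hW : ∀ n x, |W n x| ≤ M) :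
    ∃ s : ℕ → ℕ, StrictMono s ∧ ∀ q : ℚ, ∃ l, Tendsto (fun n => W (s n) q) atTop (𝓝 l) := by
  have hc : IsCompact (univ.pi fun _ : ℚ => Icc (-M) M) := isCompact_univ_pi fun _ => isCompact_Icc
  obtain ⟨l, -, s, hs, hl⟩ := hc.tendsto_subseq (x := fun n (q : ℚ) => W n q)
    fun n q _ => abs_le.1 (hW n q)
  exact ⟨s, hs, fun q => ⟨l q, tendsto_pi_nhds.1 hl q⟩⟩

end Limit

end DegenerateFP

namespace DegenerateFP

/-! ### Identification of the nonlinearity and the limit equation. -/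

theorem IsConj.continuous {j : ℝ → ℝ} {C : ℝ} (hj : IsConj j C) : Continuous j :=
  continuousOn_univ.1 (hj.convex.continuousOn isOpen_univ)

theorem integral_deriv_eq_zero {φ : ℝ → ℝ} (hφ : IsTestFun φ) : ∫ x, deriv φ x = 0 := by
  have h : IsAntideriv (fun _ : ℝ => (1 : ℝ)) fun _ => 0 :=
    IsAntideriv.of_hasDerivAt (fun x => hasDerivAt_const x 1) continuous_const
  have := h.integral_mul_deriv (hφ.1.of_le (by simp)) hφ.2
  simpa using this

section Limit

variable {f a a₁ a₂ F j : ℝ → ℝ} {c₀ c₁ A lam N M D : ℝ} {J y g W : ℕ → ℝ → ℝ} {ε : ℕ → ℝ}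
  {U : Ultrafilter ℕ} {y₀ w : ℝ → ℝ}

/-- A strict inequality at x₀ between w and the nonlinearity at level c persists on a ball for all
large n, by equi-Lipschitz continuity of W n and uniform convergence of J n on half-lines.
Monotonicity of r ↦ J n(a r) + ε r turns it into a bound of y n by c, the form that survives weak
convergence. -/
theorem eventually_ae_le
    (hs : ∀ n, IsRegSol f a F (J n) lam (ε n) N M D (y n) (g n) (W n))
    (hf : IsDrift f c₀ c₁) (ha : IsCoeff a a₁ a₂ A) (hN : 0 ≤ N) (hM : 0 ≤ M)
    (hε : ∀ n, 0 ≤ ε n) (hεt : Tendsto ε atTop (𝓝 0)) (hJm : ∀ n, Monotone (J n))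
    (hJ : ∀ P, ∀ e > 0, ∀ᶠ n in atTop, ∀ p ≤ P, |J n p - (j p - j 0)| ≤ e) (hjc : Continuous j)
    (hw : ∀ x, 0 < a x → Tendsto (fun n => W n x) atTop (𝓝 (w x))) {x₀ c : ℝ} (hx₀ : 0 < a x₀) :
    (j (a x₀ * c) - j 0 < w x₀ → ∃ r > 0, ∀ᶠ n in atTop, ∀ᵐ x, x ∈ Metric.ball x₀ r → c ≤ y n x) ∧
    (w x₀ < j (a x₀ * c) - j 0 →
      ∃ r > 0, ∀ᶠ n in atTop, ∀ᵐ x, x ∈ Metric.ball x₀ r → y n x ≤ c) := by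
  have hA := ha.nonneg_const
  have ca := ha.continuous
  have key : ∀ e > 0, ∃ r > 0, ∀ᶠ n in atTop, ∀ x ∈ Metric.ball x₀ r,
      |W n x - w x₀| ≤ e ∧ |J n (a x * c) + ε n * c - (j (a x₀ * c) - j 0)| ≤ e := by
    intro e he
    obtain ⟨r, hr, L, hL, hlip⟩ := exists_local_lipschitz hs hf ca hN hM hx₀
    have hjac : ContinuousAt (fun x => j (a x * c)) x₀ := by fun_prop
    obtain ⟨r', hr', h'⟩ := Metric.continuousAt_iff.1 hjac (e / 3) (by positivity)
    set ρ := min r (min r' (e / (2 * (L + 1)))) with hρ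
    have hρ0 : 0 < ρ := lt_min hr (lt_min hr' (by positivity))
    refine ⟨ρ, hρ0, ?_⟩
    have hεc : Tendsto (fun n => ε n * c) atTop (𝓝 0) := by simpa using hεt.mul_const c
    filter_upwards [Metric.tendsto_nhds.1 (hw x₀ hx₀) (e / 2) (by positivity),
      -- All arguments a x * c are at most A |c|, so one half-line suffices for every x in the ball.
      hJ (A * |c|) (e / 3) (by positivity), Metric.tendsto_nhds.1 hεc (e / 3) (by positivity)]
      with n h1 h2 h3 x hx
    rw [Real.dist_eq] at h1 h3
    rw [sub_zero] at h3
    rw [Metric.mem_ball, hρ, lt_min_iff, lt_min_iff] at hx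
    constructor
    · have k1 := hlip n x (Metric.mem_ball.2 hx.1)
      have k2 : L * |x - x₀| ≤ e / 2 := by
        have h1 : |x - x₀| ≤ e / (2 * (L + 1)) := by
          rw [← Real.dist_eq]; exact hx.2.2.le
        calc L * |x - x₀| ≤ (L + 1) * (e / (2 * (L + 1))) :=
              mul_le_mul (by linarith) h1 (abs_nonneg _) (by positivity)
          _ = e / 2 := by field_simp
      have k3 := abs_sub_le (W n x) (W n x₀) (w x₀)
      linarith
    · have k1 := h' hx.2.1
      rw [Real.dist_eq] at k1
      have k2 := h2 (a x * c) ((mul_le_mul_of_nonneg_left (le_abs_self c) (ha.nonneg x)).trans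
        (mul_le_mul_of_nonneg_right (ha.le x) (abs_nonneg c)))
      have k1 := abs_lt.1 k1
      have k2 := abs_le.1 k2
      have k3 := abs_lt.1 h3
      rw [abs_le]
      constructor <;> linarith [k1.1, k1.2, k2.1, k2.2, k3.1, k3.2]
  constructor
  · intro hlt
    obtain ⟨r, hr, h⟩ := key ((w x₀ - (j (a x₀ * c) - j 0)) / 3) (by linarith)
    refine ⟨r, hr, ?_⟩
    filter_upwards [h] with n hn
    filter_upwards [(hs n).W_eq] with x hx hxr
    obtain ⟨k1, k2⟩ := hn x hxr
    by_contra hlt'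
    have hlt' := (not_le.1 hlt').le
    have k3 := hJm n (mul_le_mul_of_nonneg_left hlt' (ha.nonneg x))
    have k4 := mul_le_mul_of_nonneg_left hlt' (hε n)
    have k1 := abs_le.1 k1
    have k2 := abs_le.1 k2
    linarith [k1.1, k2.2]
  · intro hlt
    obtain ⟨r, hr, h⟩ := key (((j (a x₀ * c) - j 0) - w x₀) / 3) (by linarith)
    refine ⟨r, hr, ?_⟩
    filter_upwards [h] with n hn
    filter_upwards [(hs n).W_eq] with x hx hxr
    obtain ⟨k1, k2⟩ := hn x hxr
    by_contra hlt'
    have hlt' := (not_le.1 hlt').le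
    have k3 := hJm n (mul_le_mul_of_nonneg_left hlt' (ha.nonneg x))
    have k4 := mul_le_mul_of_nonneg_left hlt' (hε n)
    have k1 := abs_le.1 k1
    have k2 := abs_le.1 k2
    linarith [k1.2, k2.1]

/-- Weak convergence of y n does not commute with j, but one-sided bounds by constants pass to the
limit. Rational c with j(a c) - j(0) < w lie below y₀, those with the opposite inequality lie above;
continuity in c leaves only equality, even where j is flat. -/
theorem ae_eq_of_weak_limit
    (hs : ∀ n, IsRegSol f a F (J n) lam (ε n) N M D (y n) (g n) (W n))
    (hf : IsDrift f c₀ c₁) (ha : IsCoeff a a₁ a₂ A) (hN : 0 ≤ N) (hM : 0 ≤ M)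
    (hε : ∀ n, 0 ≤ ε n) (hεt : Tendsto ε atTop (𝓝 0)) (hJm : ∀ n, Monotone (J n))
    (hJ : ∀ P, ∀ e > 0, ∀ᶠ n in atTop, ∀ p ≤ P, |J n p - (j p - j 0)| ≤ e) (hjc : Continuous j)
    (hU : (U : Filter ℕ) ≤ atTop)
    (hw : ∀ x, 0 < a x → Tendsto (fun n => W n x) atTop (𝓝 (w x))) (hy₀ : Integrable y₀)
    (hUy : ∀ χ : ℝ → ℝ, Continuous χ → HasCompactSupport χ →
      Tendsto (fun n => ∫ x, χ x * y n x) U (𝓝 (∫ x, χ x * y₀ x))) :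
    ∀ᵐ x, 0 < a x → w x = j (a x * y₀ x) - j 0 := by
  -- A set that is null near each of its points is null, so conclusions on balls of varying radius
  -- combine.
  have hnull : ∀ {P Q : ℝ → Prop}, (∀ x₀, P x₀ → ∃ r > 0, ∀ᵐ x, x ∈ Metric.ball x₀ r → Q x) →
      ∀ᵐ x, P x → Q x := by
    intro P Q h
    have : volume {x | P x ∧ ¬ Q x} = 0 := by
      refine measure_null_of_locally_null _ fun x₀ hx₀ => ?_
      obtain ⟨r, hr, hQ⟩ := h x₀ hx₀.1
      refine ⟨{x | P x ∧ ¬ Q x} ∩ Metric.ball x₀ r,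
        inter_mem self_mem_nhdsWithin (mem_nhdsWithin_of_mem_nhds (Metric.ball_mem_nhds x₀ hr)), ?_⟩
      refine measure_mono_null (fun x hx => ?_) (ae_iff.1 hQ)
      exact fun hq => hx.1.2 (hq hx.2)
    rw [ae_iff]
    refine measure_mono_null (fun x hx => ?_) this
    exact Classical.not_imp.1 hx
  have hev := fun {x₀ : ℝ} (c : ℝ) (hx₀ : 0 < a x₀) =>
    eventually_ae_le (c := c) hs hf ha hN hM hε hεt hJm hJ hjc hw hx₀
  have h1 : ∀ c : ℚ, ∀ᵐ x, (0 < a x ∧ j (a x * c) - j 0 < w x) → (c : ℝ) ≤ y₀ x := fun c =>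
    hnull fun x₀ hx₀ => by
      obtain ⟨r, hr, h⟩ := (hev (c : ℝ) hx₀.1).1 hx₀.2
      exact ⟨r, hr, ae_le_of_weak_limit hUy (fun n => (hs n).int_y) hy₀ Metric.isOpen_ball
        (h.filter_mono hU)⟩
  have h2 : ∀ c : ℚ, ∀ᵐ x, (0 < a x ∧ w x < j (a x * c) - j 0) → y₀ x ≤ (c : ℝ) := fun c =>
    hnull fun x₀ hx₀ => by
      obtain ⟨r, hr, h⟩ := (hev (c : ℝ) hx₀.1).2 hx₀.2
      exact ⟨r, hr, ae_ge_of_weak_limit hUy (fun n => (hs n).int_y) hy₀ Metric.isOpen_ball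
        (h.filter_mono hU)⟩
  filter_upwards [ae_all_iff.2 h1, ae_all_iff.2 h2] with x k1 k2 hx
  have hcont : ContinuousAt (fun c => j (a x * c) - j 0) (y₀ x) := by fun_prop
  rcases lt_trichotomy (w x) (j (a x * y₀ x) - j 0) with h | h | h
  · obtain ⟨r, hr, hr'⟩ := Metric.eventually_nhds_iff.1 (hcont.eventually_const_lt h)
    obtain ⟨q, hq1, hq2⟩ := exists_rat_btwn (show y₀ x - r < y₀ x by linarith)
    have := k2 q ⟨hx, hr' (by rw [Real.dist_eq, abs_lt]; constructor <;> linarith)⟩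
    linarith
  · exact h
  · obtain ⟨r, hr, hr'⟩ := Metric.eventually_nhds_iff.1 (hcont.eventually_lt_const h)
    obtain ⟨q, hq1, hq2⟩ := exists_rat_btwn (show y₀ x < y₀ x + r by linarith)
    have := k1 q ⟨hx, hr' (by rw [Real.dist_eq, abs_lt]; constructor <;> linarith)⟩
    linarith

theorem IsRegSol.integral_mul_deriv_deriv {J y g W : ℝ → ℝ} {ε : ℝ}
    (h : IsRegSol f a F J lam ε N M D y g W) (hf : IsDrift f c₀ c₁) (hF : Integrable F)
    {φ : ℝ → ℝ} (hφ : IsTestFun φ) :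
    ∫ x, W x * deriv (deriv φ) x
      = (∫ x, deriv (fun t => f t * φ t) x * y x) + lam * (∫ x, φ x * y x) - ∫ x, φ x * F x := by
  have cf := hf.continuous
  have cf' := hf.continuous_deriv
  have cφ := hφ.1.continuous
  have cφ' := hφ.deriv.1.continuous
  have cg := h.antideriv_g.continuous
  have e1 := h.antideriv_W.integral_mul_deriv (hφ.deriv.1.of_le (by simp)) hφ.deriv.2
  have e2 := h.antideriv_g.integral_mul_deriv (hφ.1.of_le (by simp)) hφ.2
  have i1 : Integrable fun x => g x * deriv φ x :=
    (cg.mul cφ').integrable_of_hasCompactSupport hφ.deriv.2.mul_left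
  have i2 : Integrable fun x => f x * deriv φ x * y x :=
    integrable_mul_of_hasCompactSupport (v := fun x => f x * deriv φ x) (by fun_prop)
      hφ.deriv.2.mul_left h.int_y
  have i3 : Integrable fun x => deriv f x * φ x * y x :=
    integrable_mul_of_hasCompactSupport (v := fun x => deriv f x * φ x) (by fun_prop)
      hφ.2.mul_left h.int_y
  have i4 := integrable_mul_of_hasCompactSupport cφ hφ.2 h.int_y
  have i5 := integrable_mul_of_hasCompactSupport cφ hφ.2 hF
  have e3 : ∫ x, (g x - f x * y x) * deriv φ x
      = (∫ x, g x * deriv φ x) - ∫ x, f x * deriv φ x * y x := by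
    rw [← integral_sub i1 i2]
    exact integral_congr_ae (Eventually.of_forall fun x => by simp only; ring)
  have i6 : Integrable fun x => deriv f x * φ x * y x + lam * (φ x * y x) :=
    i3.add (i4.const_mul lam)
  have e4 : ∫ x, (deriv f x * y x - (F x - lam * y x)) * φ x
      = (∫ x, deriv f x * φ x * y x) + lam * (∫ x, φ x * y x) - ∫ x, φ x * F x := by
    rw [← integral_const_mul, ← integral_add i3 (i4.const_mul lam), ← integral_sub i6 i5]
    exact integral_congr_ae (Eventually.of_forall fun x => by simp only; ring)
  have e5 : ∫ x, deriv (fun t => f t * φ t) x * y x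
      = (∫ x, deriv f x * φ x * y x) + ∫ x, f x * deriv φ x * y x := by
    rw [← integral_add i3 i2]
    refine integral_congr_ae (Eventually.of_forall fun x => ?_)
    simp only
    rw [hf.deriv_mul (hφ.1.differentiable (by simp)).differentiableAt]; ring
  rw [e1, e3, e2, e4, e5]
  ring

/-- Away from {a = 0} the convergence of W n is pointwise and dominated; near it θ(a/δ) W n has size
(2Dδ + ε) in L¹. Letting n → ∞ and then δ → 0 leaves the limit candidate, which vanishes on {a = 0}.
-/
theorem integral_eq_of_weak_limit
    (hs : ∀ n, IsRegSol f a F (J n) lam (ε n) N M D (y n) (g n) (W n))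
    (ha : IsCoeff a a₁ a₂ A) (hN : 0 ≤ N) (hD : 0 ≤ D)
    (hε : ∀ n, 0 ≤ ε n) (hεt : Tendsto ε atTop (𝓝 0)) (hU : (U : Filter ℕ) ≤ atTop)
    (hw : ∀ x, 0 < a x → Tendsto (fun n => W n x) atTop (𝓝 (w x))) {w₀ : ℝ → ℝ}
    (hw₀m : AEStronglyMeasurable w₀ volume) (hw₀ : ∀ᵐ x, 0 < a x → w x = w₀ x)
    (hw₀0 : ∀ x, a x = 0 → w₀ x = 0) {χ : ℝ → ℝ} (hχ : Continuous χ) (hχc : HasCompactSupport χ)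
    {l : ℝ} (hl : Tendsto (fun n => ∫ x, W n x * χ x) U (𝓝 l)) :
    (∀ᵐ x, |w₀ x| ≤ M) ∧ l = ∫ x, w₀ x * χ x := by
  have hw₀M : ∀ᵐ x, |w₀ x| ≤ M := by
    have hM : 0 ≤ M := (abs_nonneg _).trans ((hs 0).W_le 0)
    filter_upwards [hw₀] with x hx
    rcases (ha.nonneg x).eq_or_lt with h | h
    · rw [hw₀0 x h.symm, abs_zero]; exact hM
    · rw [← hx h]
      exact le_of_tendsto (hw x h).abs (Eventually.of_forall fun n => (hs n).W_le x)
  refine ⟨hw₀M, ?_⟩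
  obtain ⟨θ, θ₁, θ₂, κ, B, hB, hθ⟩ := exists_isCutoff
  have cθ := hθ.continuous
  have ca := ha.continuous
  obtain ⟨E, hE⟩ := hχ.bounded_above_of_compact_support hχc
  have hE' : ∀ x, |χ x| ≤ E := hE
  have hE0 : 0 ≤ E := (abs_nonneg _).trans (hE' 0)
  set K := M + 2 * (N * ∫ x, bell x) with hK
  have hχi : Integrable χ := hχ.integrable_of_hasCompactSupport hχc
  have hdom : Integrable fun x => M * |χ x| := hχi.abs.const_mul M
  have hc : ∀ i : ℕ, Continuous fun x => θ (a x / (1 / ((i : ℝ) + 1))) := fun i => by fun_prop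
  have hbd : ∀ i : ℕ, |l - ∫ x, w₀ x * χ x * (1 - θ (a x / (1 / ((i : ℝ) + 1))))|
      ≤ 2 * D * (1 / ((i : ℝ) + 1)) * E * K := by
    intro i
    have hδ : 0 < 1 / ((i : ℝ) + 1) := by positivity
    set δ := 1 / ((i : ℝ) + 1)
    have h1 : Tendsto (fun n => ∫ x, W n x * χ x * (1 - θ (a x / δ))) atTop
        (𝓝 (∫ x, w₀ x * χ x * (1 - θ (a x / δ)))) := by
      refine tendsto_integral_of_dominated_convergence (fun x => M * |χ x|) (fun n => ?_) hdom
        (fun n => Eventually.of_forall fun x => ?_) ?_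
      · have cW := (hs n).antideriv_W.continuous
        have := hc i
        exact ((cW.mul hχ).mul (continuous_const.sub (hc i))).aestronglyMeasurable
      · rw [Real.norm_eq_abs, abs_mul, abs_mul, abs_of_nonneg (sub_nonneg.2 (hθ.le_one _))]
        have hM : 0 ≤ M := (abs_nonneg _).trans ((hs 0).W_le 0)
        have := mul_le_mul (mul_le_mul_of_nonneg_right ((hs n).W_le x) (abs_nonneg (χ x)))
          (sub_le_self 1 (hθ.nonneg (a x / δ))) (sub_nonneg.2 (hθ.le_one _)) (by positivity)
        rwa [mul_one] at this
      · filter_upwards [hw₀] with x hx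
        rcases (ha.nonneg x).eq_or_lt with h | h
        · rw [← h, zero_div, hθ.eq_one 0 zero_le_one]
          simp
        · rw [← hx h]
          exact ((hw x h).mul_const _).mul_const _
    have h2 : Tendsto (fun n => |(∫ x, W n x * χ x) - ∫ x, W n x * χ x * (1 - θ (a x / δ))|) U
        (𝓝 |l - ∫ x, w₀ x * χ x * (1 - θ (a x / δ))|) := (hl.sub (h1.mono_left hU)).abs
    have h3 : Tendsto (fun n => (2 * D * δ + ε n) * E * K) U (𝓝 ((2 * D * δ + 0) * E * K)) :=
      (((hεt.mono_left hU).const_add _).mul_const E).mul_const K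
    rw [add_zero] at h3
    refine le_of_tendsto_of_tendsto' h2 h3 fun n => ?_
    have cW := (hs n).antideriv_W.continuous
    have i1 : Integrable fun x => W n x * χ x :=
      (cW.mul hχ).integrable_of_hasCompactSupport hχc.mul_left
    have i2 : Integrable fun x => W n x * χ x * (1 - θ (a x / δ)) :=
      ((cW.mul hχ).mul (continuous_const.sub (hc i))).integrable_of_hasCompactSupport
        hχc.mul_left.mul_right
    have hui := (hs n).integrable_add_bell
    rw [← integral_sub i1 i2]
    refine abs_integral_le_integral_abs.trans ?_
    calc ∫ x, |W n x * χ x - W n x * χ x * (1 - θ (a x / δ))|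
        ≤ ∫ x, (2 * D * δ + ε n) * E * (y n x + 2 * (N * bell x)) := by
          refine integral_mono_ae (i1.sub i2).abs (hui.const_mul _) ?_
          filter_upwards [(hs n).abs_le hN, (hs n).abs_W_le] with x hx hWx
          have hu0 := (abs_nonneg _).trans hx
          have hX : |W n x| ≤ (D * a x + ε n) * (y n x + 2 * (N * bell x)) :=
            hWx.trans (mul_le_mul_of_nonneg_left hx
              (add_nonneg (mul_nonneg hD (ha.nonneg x)) (hε n)))
          have t1 := hθ.mul_le le_rfl hδ hD (hε n) hu0 hX (abs_nonneg _)
          have e : W n x * χ x - W n x * χ x * (1 - θ (a x / δ)) = θ (a x / δ) * W n x * χ x := by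
            ring
          rw [e, abs_mul, abs_mul, abs_of_nonneg (hθ.nonneg _)]
          have := mul_le_mul t1 (hE' x) (abs_nonneg _)
            (mul_nonneg (add_nonneg (by positivity) (hε n)) hu0)
          linarith
      _ = (2 * D * δ + ε n) * E * ∫ x, (y n x + 2 * (N * bell x)) := integral_const_mul _ _
      _ ≤ (2 * D * δ + ε n) * E * K := mul_le_mul_of_nonneg_left (hs n).integral_add_bell_le
          (mul_nonneg (add_nonneg (by positivity) (hε n)) hE0)
  have h4 : Tendsto (fun i : ℕ => ∫ x, w₀ x * χ x * (1 - θ (a x / (1 / ((i : ℝ) + 1))))) atTop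
      (𝓝 (∫ x, w₀ x * χ x)) := by
    refine tendsto_integral_of_dominated_convergence (fun x => M * |χ x|) (fun i => ?_) hdom
      (fun i => ?_) (Eventually.of_forall fun x => ?_)
    · exact (hw₀m.mul hχ.aestronglyMeasurable).mul
        (continuous_const.sub (hc i)).aestronglyMeasurable
    · filter_upwards [hw₀M] with x hx
      rw [Real.norm_eq_abs, abs_mul, abs_mul, abs_of_nonneg (sub_nonneg.2 (hθ.le_one _))]
      have := mul_le_mul (mul_le_mul_of_nonneg_right hx (abs_nonneg (χ x)))
        (sub_le_self 1 (hθ.nonneg (a x / (1 / ((i : ℝ) + 1))))) (sub_nonneg.2 (hθ.le_one _))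
        (mul_nonneg ((abs_nonneg _).trans hx) (abs_nonneg _))
      rwa [mul_one] at this
    · have := ((hθ.tendsto (ha.nonneg x)).const_sub 1).const_mul (w₀ x * χ x)
      have e : w₀ x * χ x * (1 - if a x = 0 then 1 else 0) = w₀ x * χ x := by
        by_cases h0 : a x = 0
        · rw [hw₀0 x h0]; ring
        · rw [if_neg h0]; ring
      rwa [e] at this
  have h5 : Tendsto (fun i : ℕ => 2 * D * (1 / ((i : ℝ) + 1)) * E * K) atTop (𝓝 0) := by
    have := (((tendsto_one_div_add_atTop_nhds_zero_nat (𝕜 := ℝ)).const_mul (2 * D)).mul_const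
      E).mul_const K
    simpa using this
  have h6 := le_of_tendsto_of_tendsto' (h4.const_sub l).abs h5 hbd
  exact sub_eq_zero.1 (abs_eq_zero.1 (le_antisymm h6 (abs_nonneg _)))

end Limit

/-- Regularized solutions are extracted first along a subsequence with W convergent at rationals,
then along a free ultrafilter for weak convergence of y; limits at infinity remain valid along the
ultrafilter. The limit equation holds for j(a y) - j(0). -/
theorem exists_range_of_abs_le_bell {j f a a₁ a₂ : ℝ → ℝ} {C A c₀ c₁ lam N : ℝ} (hj : IsConj j C)
    (hf : IsDrift f c₀ c₁) (ha : IsCoeff a a₁ a₂ A) (hN : 0 ≤ N) (hlam : c₁ < lam)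
    (hlam' : 9 * IsConj.slopeAt j 1 * A + 7 + c₀ ≤ lam) (F : L1R)
    (hF : ∀ᵐ x, |F x| ≤ N * bell x) :
    ∃ y : L1R, F ∈ shift lam (opB (fun x r => j (a x * r)) f) y := by
  obtain ⟨M, D, hM, hD, hsol⟩ := exists_isRegSol hj hf ha hN hlam hlam' F hF
  -- The index is shifted by ⌈M⌉ so that the uniform estimates hold from the first term on.
  have hk : ∀ n : ℕ, M ≤ ((n + ⌈M⌉₊ : ℕ) : ℝ) := fun n => by
    have := Nat.le_ceil M
    push_cast
    linarith [(Nat.cast_nonneg n : (0 : ℝ) ≤ n)]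
  choose J' hJ' using fun n : ℕ => hj.exists_approx (n + ⌈M⌉₊)
  choose y' g' W' hs' using fun n : ℕ => hsol (n + ⌈M⌉₊) (hk n) (J' n) (hJ' n)
  obtain ⟨s, hsm, hq⟩ := exists_subseq_tendsto (W := W') fun n x => (hs' n).W_le x
  set k : ℕ → ℕ := fun n => s n + ⌈M⌉₊ with hkdef
  have hkt : Tendsto k atTop atTop := tendsto_atTop_mono (fun n => Nat.le_add_right _ _) hsm.tendsto_atTop
  set ε : ℕ → ℝ := fun n => 1 / ((k n : ℝ) + 1) with hεdef
  have hε : ∀ n, 0 ≤ ε n := fun n => by positivity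
  have hεt : Tendsto ε atTop (𝓝 0) :=
    (tendsto_one_div_add_atTop_nhds_zero_nat (𝕜 := ℝ)).comp hkt
  set J := fun n => J' (s n)
  set y := fun n => y' (s n)
  set g := fun n => g' (s n)
  set W := fun n => W' (s n)
  have hs : ∀ n, IsRegSol f a F (J n) lam (ε n) N M D (y n) (g n) (W n) := fun n => hs' (s n)
  have hJm : ∀ n, Monotone (J n) := fun n => by
    obtain ⟨L, hL⟩ := (hJ' (s n)).lipMono
    exact hL.mono
  have hJ : ∀ P, ∀ e > 0, ∀ᶠ n in atTop, ∀ p ≤ P, |J n p - (j p - j 0)| ≤ e := by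
    intro P e he
    have h1 : Tendsto (fun n => 2 * IsConj.slopeAt j (max P 0 + 1) * (1 / ((k n : ℝ) + 1))) atTop
        (𝓝 0) := by
      have := hεt.const_mul (2 * IsConj.slopeAt j (max P 0 + 1))
      rwa [mul_zero] at this
    have h2 : Tendsto (fun n => (k n : ℝ)) atTop atTop := tendsto_natCast_atTop_atTop.comp hkt
    filter_upwards [h1.eventually_lt_const he, h2.eventually_ge_atTop (max P 0)] with n h3 h4 p hp
    have := (hJ' (s n)).close (max P 0) (le_max_right _ _) h4 p (hp.trans (le_max_left _ _))
    refine this.trans (le_trans (le_of_eq ?_) h3.le)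
    rw [mul_one_div]
  set U : Ultrafilter ℕ := hyperfilter ℕ
  have hU : (U : Filter ℕ) ≤ atTop := Nat.hyperfilter_le_atTop
  have hFi := integrable_L1R F
  obtain ⟨y₀, hy₀, hUy⟩ := exists_weak_limit U hs hf ha hFi hF hN hM hD hlam hε (hεt.mono_left hU)
  obtain ⟨w, hw⟩ := exists_pointwise_limit hs hf ha.continuous hN hM hq
  have hjc := hj.continuous
  have hww := ae_eq_of_weak_limit hs hf ha hN hM hε hεt hJm hJ hjc hU hw hy₀ hUy
  set Y : L1R := hy₀.toL1 y₀ with hY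
  have hYae : ∀ᵐ x, Y x = y₀ x := hy₀.coeFn_toL1
  set w₀ : ℝ → ℝ := fun x => j (a x * Y x) - j 0 with hw₀
  have hYm : AEStronglyMeasurable (fun x => Y x) volume := (integrable_L1R Y).aestronglyMeasurable
  have hjm : AEStronglyMeasurable (fun x => j (a x * Y x)) volume :=
    hjc.comp_aestronglyMeasurable (ha.continuous.aestronglyMeasurable.mul hYm)
  have hw₀m : AEStronglyMeasurable w₀ volume := hjm.sub aestronglyMeasurable_const
  have hw₀w : ∀ᵐ x, 0 < a x → w x = w₀ x := by
    filter_upwards [hww, hYae] with x h1 h2 h3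
    simp only [hw₀]
    rw [h1 h3, h2]
  have hw₀0 : ∀ x, a x = 0 → w₀ x = 0 := fun x hx => by simp [hw₀, hx]
  have hmain := fun {χ : ℝ → ℝ} (hχ : Continuous χ) (hχc : HasCompactSupport χ) {l : ℝ} =>
    integral_eq_of_weak_limit (l := l) hs ha hN hD hε hεt hU hw hw₀m hw₀w hw₀0 hχ hχc
  have hw₀M : ∀ᵐ x, |w₀ x| ≤ M :=
    (hmain (χ := fun _ => 0) (l := 0) continuous_const HasCompactSupport.zero (by simp)).1
  have hw₀l : LocallyIntegrable w₀ volume :=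
    (locallyIntegrable_const M).mono hw₀m (by
      filter_upwards [hw₀M] with x hx
      rw [Real.norm_eq_abs, Real.norm_eq_abs]
      exact hx.trans (le_abs_self M))
  have hloc : LocallyIntegrable (fun x => j (a x * Y x)) volume := by
    refine (hw₀l.add (locallyIntegrable_const (j 0))).congr (Eventually.of_forall fun x => ?_)
    simp [hw₀]
  refine ⟨Y, F - lam • Y, ⟨hloc, fun φ hφ => ?_⟩, by abel⟩
  have cφ := hφ.1.continuous
  have cd : Continuous (deriv fun t => f t * φ t) := by
    have : ContDiff ℝ 1 fun t => f t * φ t :=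
      (hf.contDiff.of_le (by norm_num)).mul (hφ.1.of_le (by simp))
    exact this.continuous_deriv le_rfl
  have cc : HasCompactSupport (deriv fun t => f t * φ t) :=
    HasCompactSupport.deriv (f := fun t => f t * φ t) hφ.2.mul_left
  have ht := (((hUy _ cd cc).add ((hUy φ cφ hφ.2).const_mul lam)).sub_const (∫ x, φ x * F x))
  have ht' := ht.congr fun n => ((hs n).integral_mul_deriv_deriv hf hFi hφ).symm
  have h1 := (hmain hφ.deriv.deriv.1.continuous hφ.deriv.deriv.2 ht').2
  have e1 : ∫ x, (F - lam • Y) x * φ x = (∫ x, φ x * F x) - lam * ∫ x, φ x * y₀ x := by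
    rw [← integral_const_mul, ← integral_sub (integrable_mul_of_hasCompactSupport cφ hφ.2 hFi)
      ((integrable_mul_of_hasCompactSupport cφ hφ.2 hy₀).const_mul lam)]
    refine integral_congr_ae ?_
    filter_upwards [Lp.coeFn_sub F (lam • Y), Lp.coeFn_smul lam Y, hYae] with x k1 k2 k3
    rw [k1, Pi.sub_apply, k2, Pi.smul_apply, k3, smul_eq_mul]; ring
  have e2 : ∫ x, Y x * deriv (fun t => f t * φ t) x
      = ∫ x, deriv (fun t => f t * φ t) x * y₀ x := by
    refine integral_congr_ae ?_
    filter_upwards [hYae] with x k3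
    rw [k3, mul_comm]
  have e3 : ∫ x, j (a x * Y x) * iteratedDeriv 2 φ x = ∫ x, w₀ x * deriv (deriv φ) x := by
    have i1 := hφ.deriv.deriv.integrable_mul hw₀l
    -- The constant j(0), removed by normalizing the approximations, may be restored because φ'' has
    -- zero integral.
    have i2 := hφ.deriv.deriv.integrable.const_mul (j 0)
    have : ∫ x, w₀ x * deriv (deriv φ) x
        = (∫ x, w₀ x * deriv (deriv φ) x) + ∫ x, j 0 * deriv (deriv φ) x := by
      rw [integral_const_mul, integral_deriv_eq_zero hφ.deriv]; ring
    rw [this, ← integral_add i1 i2, iteratedDeriv_two]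
    exact integral_congr_ae (Eventually.of_forall fun x => by simp only [hw₀]; ring)
  rw [e1, e2, e3, ← h1]
  ring

end DegenerateFP

namespace DegenerateFP

/-! ### Closedness, and the main result -/

theorem abs_intervalIntegral_le {q : ℝ → ℝ} (hq : Integrable q) (s t : ℝ) :
    |∫ x in s..t, q x| ≤ ∫ x, |q x| := by
  rw [intervalIntegral.abs_integral_eq_abs_integral_uIoc]
  exact abs_integral_le_integral_abs.trans
    (setIntegral_le_integral hq.abs (Eventually.of_forall fun t => abs_nonneg _))

/-- The L¹ norms of z and v alone control the oscillation of W on bounded sets; this provides the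
majorant in the closedness proof. -/
theorem FluxRep.abs_sub_le {f z v w g W : ℝ → ℝ} {c₀ c₁ : ℝ} (h : FluxRep f z v w g W)
    (hf : IsDrift f c₀ c₁) (hz : Integrable z) (hv : Integrable v) (x t : ℝ) :
    |W t - W x| ≤ (c₁ * (∫ x, |z x|) + ∫ x, |v x|) * |t - x| + c₀ * ∫ x, |z x| := by
  have hp := (hf.integrable_deriv_mul hz).sub hv
  have hg : ∀ x, |g x| ≤ c₁ * (∫ x, |z x|) + ∫ x, |v x| := by
    intro x
    have h1 : Tendsto (fun s => |g x - g s|) atBot (𝓝 |g x - 0|) :=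
      (h.tendsto_bot.const_sub (g x)).abs
    rw [sub_zero] at h1
    refine le_of_tendsto h1 (Eventually.of_forall fun s => ?_)
    rw [h.antideriv_g.2 s x, ← integral_const_mul, ← integral_add (hz.abs.const_mul _) hv.abs]
    refine (abs_intervalIntegral_le hp s x).trans (integral_mono hp.abs
      ((hz.abs.const_mul _).add hv.abs) fun x => ?_)
    refine (abs_sub _ _).trans (add_le_add ?_ le_rfl)
    rw [abs_mul]
    exact mul_le_mul_of_nonneg_right (hf.bdd_deriv x) (abs_nonneg _)
  have hfz := hf.integrable_mul hz
  rw [h.antideriv_W.2 x t, intervalIntegral.integral_sub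
    (h.antideriv_g.continuous.intervalIntegrable _ _) hfz.intervalIntegrable]
  refine (abs_sub _ _).trans (add_le_add ?_ ((abs_intervalIntegral_le hfz x t).trans ?_))
  · rw [← Real.norm_eq_abs]
    exact intervalIntegral.norm_integral_le_of_norm_le_const fun s _ =>
      (Real.norm_eq_abs _).trans_le (hg s)
  · rw [← integral_const_mul]
    refine integral_mono hfz.abs (hz.abs.const_mul _) fun x => ?_
    simp only [abs_mul]
    exact mul_le_mul_of_nonneg_right (hf.bdd x) (abs_nonneg _)

theorem tendsto_integral_mul_of_tendsto {u : ℕ → L1R} {u₀ : L1R}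
    (hu : Tendsto u atTop (𝓝 u₀)) {χ : ℝ → ℝ} (hχ : Continuous χ) (hc : HasCompactSupport χ) :
    Tendsto (fun n => ∫ x, u n x * χ x) atTop (𝓝 (∫ x, u₀ x * χ x)) := by
  obtain ⟨B, hB⟩ := hχ.bounded_above_of_compact_support hc
  have hB' : ∀ x, |χ x| ≤ B := hB
  have hi : ∀ u : L1R, Integrable fun x => u x * χ x := fun u =>
    (integrable_L1R u).mul_bdd (c := B) hχ.aestronglyMeasurable (Eventually.of_forall hB)
  have h1 : Tendsto (fun n => B * ‖u n - u₀‖) atTop (𝓝 0) := by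
    simpa using (tendsto_iff_norm_sub_tendsto_zero.1 hu).const_mul B
  refine tendsto_iff_norm_sub_tendsto_zero.2
    (squeeze_zero (fun _ => norm_nonneg _) (fun n => ?_) h1)
  rw [← integral_sub (hi _) (hi _), L1.norm_eq_integral_norm, ← integral_const_mul]
  refine abs_integral_le_integral_abs.trans (integral_mono_ae ((hi _).sub (hi _)).abs
    ((integrable_L1R _).norm.const_mul B) ?_)
  filter_upwards [Lp.coeFn_sub (u n) u₀] with x hx
  rw [hx, Pi.sub_apply, ← sub_mul, abs_mul, mul_comm, Real.norm_eq_abs]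
  exact mul_le_mul_of_nonneg_right (hB' x) (abs_nonneg _)

/-- A subsequence of u converges a.e., hence so do the values of β. Superlinear growth of β prevents
passing to the limit by L¹ convergence alone; the oscillation bound on W, anchored at one point,
gives a locally bounded majorant and dominated convergence applies. -/
theorem isClosed_opB {β : ℝ → ℝ → ℝ} {C : ℝ} {f : ℝ → ℝ} {c₀ c₁ : ℝ} (hβ : IsNonlin β C)
    (hβc : Continuous fun q : ℝ × ℝ => β q.1 q.2) (hf : IsDrift f c₀ c₁) (u v : ℕ → L1R)
    (u₀ v₀ : L1R) (h : ∀ n, v n ∈ opB β f (u n)) (hu : Tendsto u atTop (𝓝 u₀))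
    (hv : Tendsto v atTop (𝓝 v₀)) : v₀ ∈ opB β f u₀ := by
  obtain ⟨s, hs, hae⟩ := (tendstoInMeasure_of_tendsto_Lp hu).exists_seq_tendsto_ae
  have hu' := hu.comp hs.tendsto_atTop
  have hv' := hv.comp hs.tendsto_atTop
  obtain ⟨Bu, hBu⟩ := hu'.norm.bddAbove_range
  obtain ⟨Bv, hBv⟩ := hv'.norm.bddAbove_range
  have hBu' : ∀ n, ∫ x, |u (s n) x| ≤ Bu := fun n => by
    have : ‖u (s n)‖ ≤ Bu := hBu ⟨n, rfl⟩
    rwa [L1.norm_eq_integral_norm] at this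
  have hBv' : ∀ n, ∫ x, |v (s n) x| ≤ Bv := fun n => by
    have : ‖v (s n)‖ ≤ Bv := hBv ⟨n, rfl⟩
    rwa [L1.norm_eq_integral_norm] at this
  have hrep : ∀ n, ∃ g W, FluxRep f (fun x => u (s n) x) (fun x => v (s n) x)
      (fun x => β x (u (s n) x)) g W := fun n =>
    exists_fluxRep hf (integrable_L1R _) (integrable_L1R _) (h (s n)).1 (h (s n)).2
      (integrable_L1R (u (s n))) (Eventually.of_forall fun x => hβ.growth x _)
  choose g W hgW using hrep
  have hβt : ∀ᵐ x, Tendsto (fun n => β x (u (s n) x)) atTop (𝓝 (β x (u₀ x))) := by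
    filter_upwards [hae] with x hx
    have hc : Continuous fun r => β x r := hβc.comp (continuous_const.prodMk continuous_id)
    exact (hc.tendsto _).comp hx
  have hall := ae_all_iff.2 fun n => (hgW n).ae_eq
  -- The anchor: at `x₀` the values of β converge, hence are bounded, and coincide with those of the
  -- continuous representatives W n.
  obtain ⟨x₀, hx₀, hx₀'⟩ := (hβt.and hall).exists
  obtain ⟨B₀, hB₀⟩ := hx₀.norm.bddAbove_range
  have hc₀ := hf.nonneg₀
  have hc₁ := hf.nonneg₁
  set b : ℝ → ℝ := fun x => B₀ + ((c₁ * Bu + Bv) * |x - x₀| + c₀ * Bu) with hb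
  have hbc : Continuous b := by fun_prop
  have hdom : ∀ n, ∀ᵐ x, |β x (u (s n) x)| ≤ b x := fun n => by
    filter_upwards [(hgW n).ae_eq] with x hx
    have h1 := (hgW n).abs_sub_le hf (integrable_L1R _) (integrable_L1R _) x₀ x
    have h2 : |W n x₀| ≤ B₀ := by
      rw [hx₀' n]
      exact hB₀ ⟨n, rfl⟩
    have h3 : (c₁ * (∫ x, |u (s n) x|) + ∫ x, |v (s n) x|) * |x - x₀|
        ≤ (c₁ * Bu + Bv) * |x - x₀| := mul_le_mul_of_nonneg_right
      (add_le_add (mul_le_mul_of_nonneg_left (hBu' n) hc₁) (hBv' n)) (abs_nonneg _)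
    have h4 := mul_le_mul_of_nonneg_left (hBu' n) hc₀
    have h5 := abs_sub_abs_le_abs_sub (W n x) (W n x₀)
    rw [← hx]
    simp only [hb]
    linarith
  have hlim : ∀ᵐ x, |β x (u₀ x)| ≤ b x := by
    filter_upwards [hβt, ae_all_iff.2 hdom] with x h1 h2
    exact le_of_tendsto h1.abs (Eventually.of_forall h2)
  have hm : ∀ y : L1R, AEStronglyMeasurable (fun x => β x (y x)) volume := fun y =>
    hβc.comp_aestronglyMeasurable
      (continuous_id.aestronglyMeasurable.prodMk (integrable_L1R y).aestronglyMeasurable)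
  refine ⟨(hbc.locallyIntegrable (μ := volume)).mono (hm u₀) ?_, fun φ hφ => ?_⟩
  · filter_upwards [hlim] with x hx
    rw [Real.norm_eq_abs, Real.norm_eq_abs]
    exact hx.trans (le_abs_self _)
  have cd : Continuous (deriv fun t => f t * φ t) := by
    have : ContDiff ℝ 1 fun t => f t * φ t :=
      (hf.contDiff.of_le (by norm_num)).mul (hφ.1.of_le (by simp))
    exact this.continuous_deriv le_rfl
  have cc : HasCompactSupport (deriv fun t => f t * φ t) :=
    HasCompactSupport.deriv (f := fun t => f t * φ t) hφ.2.mul_left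
  have t1 := tendsto_integral_mul_of_tendsto hv' hφ.1.continuous hφ.2
  have t2 := tendsto_integral_mul_of_tendsto hu' cd cc
  have cφ := hφ.deriv.deriv.1.continuous
  have t3 : Tendsto (fun n => ∫ x, β x (u (s n) x) * deriv (deriv φ) x) atTop
      (𝓝 (∫ x, β x (u₀ x) * deriv (deriv φ) x)) := by
    refine tendsto_integral_of_dominated_convergence (fun x => |b x * deriv (deriv φ) x|)
      (fun n => (hm _).mul cφ.aestronglyMeasurable)
      ((hbc.mul cφ).integrable_of_hasCompactSupport hφ.deriv.deriv.2.mul_left).abs (fun n => ?_) ?_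
    · filter_upwards [hdom n] with x hx
      rw [Real.norm_eq_abs, abs_mul, abs_mul]
      exact mul_le_mul_of_nonneg_right (hx.trans (le_abs_self _)) (abs_nonneg _)
    · filter_upwards [hβt] with x hx
      exact hx.mul_const _
  rw [iteratedDeriv_two]
  refine tendsto_nhds_unique t1 ((t3.neg.sub t2.neg).congr fun n => ?_)
  have := (h (s n)).2 φ hφ
  rw [iteratedDeriv_two] at this
  exact this.symm

/-- Continuous compactly supported functions are dense in L¹ and are dominated by multiples of the
strictly positive `bell`. -/
theorem dense_abs_le_bell : Dense {F : L1R | ∃ N, 0 ≤ N ∧ ∀ᵐ x, |F x| ≤ N * bell x} := by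
  intro F
  rw [Metric.mem_closure_iff]
  intro e he
  obtain ⟨φ, hφc, hφe, hφ, hφi⟩ :=
    (integrable_L1R F).exists_hasCompactSupport_integral_sub_le (half_pos he)
  refine ⟨hφi.toL1 φ, ?_, ?_⟩
  · obtain ⟨N, hN⟩ := (show Continuous fun x => φ x * (1 + x ^ 2) by
      fun_prop).bounded_above_of_compact_support hφc.mul_right
    refine ⟨N, (norm_nonneg _).trans (hN 0), ?_⟩
    filter_upwards [hφi.coeFn_toL1] with x hx
    have h1 := hN x
    have h2 : 0 < 1 + x ^ 2 := by positivity
    rw [Real.norm_eq_abs, abs_mul, abs_of_pos h2] at h1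
    rw [hx, bell, ← div_eq_mul_inv, le_div_iff₀ h2]
    exact h1
  · rw [dist_eq_norm, L1.norm_eq_integral_norm]
    refine lt_of_le_of_lt (le_of_eq_of_le ?_ hφe) (half_lt_self he)
    refine integral_congr_ae ?_
    filter_upwards [Lp.coeFn_sub F (hφi.toL1 φ), hφi.coeFn_toL1] with x h1 h2
    rw [h1, Pi.sub_apply, h2]

theorem isMAccretive_opB {j f a a₁ a₂ : ℝ → ℝ} {C A c₀ c₁ : ℝ} (hj : IsConj j C)
    (hf : IsDrift f c₀ c₁) (ha : IsCoeff a a₁ a₂ A) :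
    IsMAccretive (shift c₁ (opB (fun x r => j (a x * r)) f)) := by
  have hA := ha.nonneg_const
  have hC : 0 ≤ C := by simpa using (abs_nonneg _).trans (hj.growth 0)
  have hβ : IsNonlin (fun x r => j (a x * r)) (C * (1 + A ^ 2)) :=
    { mono := fun x r s hrs => hj.mono (mul_le_mul_of_nonneg_left hrs (ha.nonneg x))
      growth := fun x r => by
        refine (hj.growth _).trans ?_
        have h1 := pow_le_pow_left₀ (ha.nonneg x) (ha.le x) 2
        have h2 := mul_le_mul_of_nonneg_right h1 (sq_nonneg r)
        rw [mul_assoc, mul_pow]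
        refine mul_le_mul_of_nonneg_left ?_ hC
        nlinarith [sq_nonneg A, sq_nonneg r] }
  have hβc : Continuous fun q : ℝ × ℝ => j (a q.1 * q.2) :=
    hj.continuous.comp ((ha.continuous.comp continuous_fst).mul continuous_snd)
  have hacc := isAccretive_opB hβ hf
  -- Large enough for the barrier, and larger than c₁ thanks to the 7; since c₁ I is already in the
  -- operator, the range condition is proved at `lam` - c₁.
  set lam := 9 * IsConj.slopeAt j 1 * A + 7 + c₀ + c₁ with hlam
  have hS := hj.slopeAt_nonneg 1
  have hpos : 0 < lam - c₁ := by
    have := hf.nonneg₀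
    have : 0 ≤ 9 * IsConj.slopeAt j 1 * A := by positivity
    linarith
  refine hacc.isMAccretive hpos (hacc.range_of_dense ?_ hpos ?_)
  · intro u w u₀ w₀ h hu hw
    choose v hv hwv using h
    refine ⟨w₀ - c₁ • u₀, isClosed_opB hβ hβc hf u v u₀ _ hv hu ?_, by abel⟩
    refine (hw.sub (hu.const_smul c₁)).congr fun n => ?_
    rw [hwv n]; abel
  · refine dense_abs_le_bell.mono ?_
    rintro F ⟨N, hN, hF⟩
    obtain ⟨y, v, hv, hFv⟩ := exists_range_of_abs_le_bell hj hf ha hN (lam := lam) (by linarith)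
      (by have := hf.nonneg₁; linarith) F hF
    refine ⟨y, c₁ • y + v, ⟨v, hv, rfl⟩, ?_⟩
    rw [hFv, ← add_assoc, ← add_smul]
    congr 2; ring

theorem MemCb.hasDerivAt {f : ℝ → ℝ} (hf : MemCb 2 f) (x : ℝ) : HasDerivAt f (deriv f x) x :=
  (hf.1.differentiable (by norm_num)).differentiableAt.hasDerivAt

theorem MemCb.exists_isDrift {f : ℝ → ℝ} (hf : MemCb 2 f) : ∃ c₀ c₁, IsDrift f c₀ c₁ := by
  obtain ⟨c₀, h₀⟩ := hf.2 0 (by norm_num)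
  obtain ⟨c₁, h₁⟩ := hf.2 1 (by norm_num)
  rw [iteratedDeriv_zero] at h₀
  rw [iteratedDeriv_one] at h₁
  exact ⟨c₀, c₁, hf.1, h₀, h₁⟩

/-- For a = σ²/2 one has a'² = σ² σ'² = 2 σ'² a, so the bound of a'² by a multiple of a is automatic
and tolerates zeros of σ. -/
theorem MemCb.exists_isCoeff {σ : ℝ → ℝ} (hσ : MemCb 2 σ) :
    ∃ a₁ a₂ A, IsCoeff (fun x => σ x ^ 2 / 2) a₁ a₂ A := by
  obtain ⟨s₀, h₀⟩ := hσ.2 0 (by norm_num)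
  obtain ⟨s₁, h₁⟩ := hσ.2 1 (by norm_num)
  obtain ⟨s₂, h₂⟩ := hσ.2 2 le_rfl
  rw [iteratedDeriv_zero] at h₀
  rw [iteratedDeriv_one] at h₁
  rw [iteratedDeriv_two] at h₂
  have n₀ := (abs_nonneg _).trans (h₀ 0)
  have n₁ := (abs_nonneg _).trans (h₁ 0)
  have n₂ := (abs_nonneg _).trans (h₂ 0)
  set S := s₀ + s₁ + s₂ with hS
  have hS0 : 0 ≤ S := by positivity
  have b₀ : ∀ x, |σ x| ≤ S := fun x => (h₀ x).trans (by rw [hS]; linarith)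
  have b₁ : ∀ x, |deriv σ x| ≤ S := fun x => (h₁ x).trans (by rw [hS]; linarith)
  have b₂ : ∀ x, |deriv (deriv σ) x| ≤ S := fun x => (h₂ x).trans (by rw [hS]; linarith)
  have hσ' : ContDiff ℝ 1 (deriv σ) := by
    have : ContDiff ℝ (1 + 1) σ := by
      have := hσ.1
      norm_num
      exact this
    exact ((contDiff_succ_iff_deriv (n := 1)).1 this).2.2
  have c₀ := hσ.1.continuous
  have c₁ := hσ'.continuous
  have c₂ := hσ'.continuous_deriv le_rfl
  have sq : ∀ {r : ℝ}, |r| ≤ S → r ^ 2 ≤ S ^ 2 := fun {r} hr => by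
    rw [← sq_abs]; exact pow_le_pow_left₀ (abs_nonneg _) hr 2
  have mul : ∀ {r s : ℝ}, |r| ≤ S → |s| ≤ S → |r * s| ≤ S ^ 2 := fun {r s} hr hs => by
    rw [abs_mul, pow_two]; exact mul_le_mul hr hs (abs_nonneg _) hS0
  refine ⟨fun x => σ x * deriv σ x, fun x => deriv σ x * deriv σ x + σ x * deriv (deriv σ) x,
    2 * S ^ 2, ?_, ?_, by fun_prop, fun x => by positivity, fun x => ?_, fun x => ?_, fun x => ?_,
    fun x => ?_⟩
  · intro x
    refine (((hσ.hasDerivAt x).pow 2).div_const 2).congr_deriv ?_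
    push_cast; ring
  · exact fun x => (hσ.hasDerivAt x).mul
      (hσ'.differentiable (by simp)).differentiableAt.hasDerivAt
  · have := sq (b₀ x)
    have := sq_nonneg S
    linarith
  · have := mul (b₀ x) (b₁ x)
    have := sq_nonneg S
    linarith
  · have h1 := mul (b₁ x) (b₁ x)
    have h2 := mul (b₀ x) (b₂ x)
    have h3 := abs_add_le (deriv σ x * deriv σ x) (σ x * deriv (deriv σ) x)
    linarith
  · have := mul_le_mul_of_nonneg_left (sq (b₁ x)) (sq_nonneg (σ x))
    rw [mul_pow]
    linarith

end DegenerateFP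

end

theorem mainTheorem5 (h f σ : ℝ → ℝ)
    (h_convex : ConvexOn ℝ Set.univ h) (h_cont : Continuous h)
    (h_growth : ∃ α₁ α₂ : ℝ, 0 < α₁ ∧ 0 ≤ α₂ ∧ ∀ u, α₁ * |u| ^ 2 + α₂ ≤ h u)
    (hf : DegenerateFP.MemCb 2 f)
    (hf'' : MeasureTheory.Integrable (iteratedDeriv 2 f) MeasureTheory.volume)
    (hσ : DegenerateFP.MemCb 2 σ) :
    DegenerateFP.IsQuasiMAccretive (DegenerateFP.opA h σ f) := by
  obtain ⟨α₁, α₂, hα₁, hα₂, hh⟩ := h_growth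
  obtain ⟨C, hj⟩ := DegenerateFP.isConj_Hstar hα₁ hα₂ hh
  obtain ⟨c₀, c₁, hdrift⟩ := hf.exists_isDrift
  obtain ⟨a₁, a₂, A, ha⟩ := hσ.exists_isCoeff
  -- `opA` is by definition `opB` with β(x, r) = H^*(σ(x)² r / 2).
  exact ⟨c₁, DegenerateFP.isMAccretive_opB hj hdrift ha⟩
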